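/- Let $\Bbbk$ be a field and let $\mathcal C$ be a fusion category over $\Bbbk$: a $\Bbbk$-linear abelian monoidal category with bilinear tensor product and finite-dimensional Hom spaces that is semisimple with finitely many simple objects up to isomorphism, has simple unit, and in which every object has a left and a right dual. Let $\mathcal D$ be a triangulated category that is a left module category over $\mathcal C$, i.e. there is an additive monoidal functor from $\mathcal C$ to the additive endofunctors of $\mathcal D$, $C\mapsto C\otimes-$, such that every $C\otimes-$ is exact (triangulated). Then $K_0(\mathcal D)$ is a module over the fusion ring $K_0(\mathcal C)$ by $[C]\cdot[X]=[C\otimes X]$, and $\mathbb C$ is a $K_0(\mathcal C)$-module through the Frobenius--Perron dimension $\mathrm{FPdim}\colon K_0(\mathcal C)\to\mathbb R$, the additive map sending the class of a simple object $S$ to the largest real eigenvalue of the matrix of multiplication by $[S]$ in the basis of simple objects. A stability condition $(\mathcal P,Z)$ on $\mathcal D$ consists of a slicing $\mathcal P=(\mathcal P(\phi))_{\phi\in\mathbb R}$ (full additive subcategories, closed under isomorphism, with $\mathcal P(\phi+1)=\mathcal P(\phi)[1]$, $\mathrm{Hom}(\mathcal P(\phi_1),\mathcal P(\phi_2))=0$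 for $\phi_1>\phi_2$, and finite Harder--Narasimhan filtrations for all objects) and a homomorphism $Z\colon K_0(\mathcal D)\to\mathbb C$ with $Z(E)\in\mathbb R_{>0}e^{i\pi\phi}$ for all $0\ne E\in\mathcal P(\phi)$; local finiteness is not part of this definition. It is $\mathcal C$-equivariant if $C\otimes\mathcal P(\phi)\subseteq\mathcal P(\phi)$ for all $C\in\mathcal C$, $\phi\in\mathbb R$, and $Z$ is $K_0(\mathcal C)$-linear. For an interval $I$, $\mathcal P(I)$ denotes the full subcategory of the objects whose semistable pieces have phases in $I$; $\mathcal P$ is locally finite if for some $\varepsilon>0$ every $\mathcal P((\phi-\varepsilon,\phi+\varepsilon))$ is a quasi-abelian category of finite length. A stability function on an abelian category $\mathcal A$ is a homomorphism $Z\colon K_0(\mathcal A)\to\mathbb C$ sending every nonzero object into $\{re^{i\pi\phi}: r>0,\ 0<\phi\le1\}$; $\phi$ is then the phase of the object, and a nonzero object is semistable if none of its nonzero subobjects has larger phase. It has the Harder--Narasimhan property if every object has a finite filtration with semistable quotients of strictly decreasing phases. If $\mathcal A$ is an abelian module category over $\mathcal C$, a stability function on $\mathcal A$ is $\mathcal C$-equivariant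 if it is $K_0(\mathcal C)$-linear. **Theorem.** Assigning to $\sigma=(\mathcal P,Z)$ its standard heart $\mathcal H=\mathcal P((0,1])$ together with the stability function $Z_{\mathcal H}$ given by $Z_{\mathcal H}([E])=Z([E])$ for $E\in\mathcal H$ defines a bijection between 1. the $\mathcal C$-equivariant stability conditions on $\mathcal D$, and 2. the pairs $(\mathcal H,Z_{\mathcal H})$ of a heart $\mathcal H$ of a bounded $t$-structure on $\mathcal D$ (closed under isomorphism) with $C\otimes\mathcal H\subseteq\mathcal H$ for all $C\in\mathcal C$, so that $\mathcal H$ is a module subcategory over $\mathcal C$, and a $\mathcal C$-equivariant stability function $Z_{\mathcal H}$ on $\mathcal H$ with the Harder--Narasimhan property. Moreover, if $\sigma$ corresponds to $(\mathcal H,Z_{\mathcal H})$, then for $0<\phi\le1$ the category $\mathcal P(\phi)$ consists of the zero objects and the $Z_{\mathcal H}$-semistable objects of $\mathcal H$ of phase $\phi$ (and $\mathcal P(\phi+n)=\mathcal P(\phi)[n]$ for $n\in\mathbb Z$). The slicing $\mathcal P$ is locally finite if and only if the family of subcategories of $\mathcal D$ so defined from $(\mathcal H,Z_{\mathcal H})$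 is locally finite. For every finitely generated free abelian group $\Lambda$ and homomorphism $v\colon K_0(\mathcal D)\to\Lambda$, the central charge $Z$ factors through $v$ if and only if $Z_{\mathcal H}$ factors through the composite $K_0(\mathcal H)\to K_0(\mathcal D)\xrightarrow{v}\Lambda$. Hence the bijection restricts to the stability conditions that are locally finite, or whose central charge factors through $v$, and the pairs with the corresponding property. -/

import Mathlib

open CategoryTheory CategoryTheory.Limits CategoryTheory.Pretriangulated
open CategoryTheory.MonoidalCategory
open scoped CategoryTheory.MonoidalCategory.MonoidalLeftAction ZeroObject

namespace FusionStab

set_option linter.unusedSectionVars false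

universe w v₁ u₁ v₂ u₂ v₃ u₃

/-! ### Grothendieck groups -/

section GrothendieckGroups

/-- The relations `[X₂] = [X₁] + [X₃]` for the short exact sequences `0 → X₁ → X₂ → X₃ → 0`. -/
def AbK0Rel (A : Type u₁) [Category.{v₁} A] [HasZeroMorphisms A] :
    AddSubgroup (FreeAbelianGroup A) :=
  AddSubgroup.closure {x | ∃ S : ShortComplex A, S.ShortExact ∧
    x = FreeAbelianGroup.of S.X₂ - (FreeAbelianGroup.of S.X₁ + FreeAbelianGroup.of S.X₃)}

/-- The Grothendieck group of an abelian category `A`. The definition makes sense for any category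
with zero morphisms; it is used for abelian categories, such as hearts of t-structures. -/
abbrev AbK0 (A : Type u₁) [Category.{v₁} A] [HasZeroMorphisms A] : Type u₁ :=
  FreeAbelianGroup A ⧸ AbK0Rel A

/-- The class of an object in the Grothendieck group of an abelian category. -/
def AbK0.of {A : Type u₁} [Category.{v₁} A] [HasZeroMorphisms A] (X : A) : AbK0 A :=
  QuotientAddGroup.mk (FreeAbelianGroup.of X)

theorem AbK0.of_shortExact {A : Type u₁} [Category.{v₁} A] [HasZeroMorphisms A]
    (S : ShortComplex A) (hS : S.ShortExact) :
    AbK0.of S.X₂ = AbK0.of S.X₁ + AbK0.of S.X₃ := by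
  have h : FreeAbelianGroup.of S.X₂ - (FreeAbelianGroup.of S.X₁ + FreeAbelianGroup.of S.X₃)
      ∈ AbK0Rel A := AddSubgroup.subset_closure ⟨S, hS, rfl⟩
  have h2 := (QuotientAddGroup.eq_zero_iff _).2 h
  rw [QuotientAddGroup.mk_sub, sub_eq_zero, QuotientAddGroup.mk_add] at h2
  exact h2

/-- The homomorphism out of `AbK0 A` given by a function additive on short exact sequences. -/
def AbK0.lift {A : Type u₁} [Category.{v₁} A] [HasZeroMorphisms A] {G : Type*} [AddCommGroup G]
    (f : A → G) (hf : ∀ S : ShortComplex A, S.ShortExact → f S.X₂ = f S.X₁ + f S.X₃) :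
    AbK0 A →+ G :=
  QuotientAddGroup.lift (AbK0Rel A) (FreeAbelianGroup.lift f) (by
    rw [AbK0Rel, AddSubgroup.closure_le]
    rintro _ ⟨S, hS, rfl⟩
    simp [hf S hS])

@[simp]
theorem AbK0.lift_of {A : Type u₁} [Category.{v₁} A] [HasZeroMorphisms A] {G : Type*}
    [AddCommGroup G] (f : A → G)
    (hf : ∀ S : ShortComplex A, S.ShortExact → f S.X₂ = f S.X₁ + f S.X₃) (X : A) :
    AbK0.lift f hf (AbK0.of X) = f X := by
  simp [AbK0.lift, AbK0.of]

theorem AbK0.hom_ext {A : Type u₁} [Category.{v₁} A] [HasZeroMorphisms A] {G : Type*}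
    [AddCommGroup G] {f g : AbK0 A →+ G} (h : ∀ X : A, f (AbK0.of X) = g (AbK0.of X)) :
    f = g := by
  apply QuotientAddGroup.addMonoidHom_ext
  apply FreeAbelianGroup.lift_ext
  exact h

variable (D : Type u₁) [Category.{v₁} D] [Preadditive D] [HasZeroObject D] [HasShift D ℤ]
  [∀ n : ℤ, (shiftFunctor D n).Additive] [Pretriangulated D]

/-- The relations `[Y] = [X] + [Z]` for the distinguished triangles `X → Y → Z → X[1]`. -/
def TriK0Rel : AddSubgroup (FreeAbelianGroup D) :=
  AddSubgroup.closure {x | ∃ T : Triangle D, T ∈ distTriang D ∧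
    x = FreeAbelianGroup.of T.obj₂ - (FreeAbelianGroup.of T.obj₁ + FreeAbelianGroup.of T.obj₃)}

/-- The Grothendieck group of a triangulated category. -/
abbrev TriK0 : Type u₁ := FreeAbelianGroup D ⧸ TriK0Rel D

variable {D}

/-- The class of an object in the Grothendieck group of a triangulated category. -/
def TriK0.of (X : D) : TriK0 D := QuotientAddGroup.mk (FreeAbelianGroup.of X)

theorem TriK0.of_distTriang (T : Triangle D) (hT : T ∈ distTriang D) :
    TriK0.of T.obj₂ = TriK0.of T.obj₁ + TriK0.of T.obj₃ := by
  have h : FreeAbelianGroup.of T.obj₂ -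
      (FreeAbelianGroup.of T.obj₁ + FreeAbelianGroup.of T.obj₃) ∈ TriK0Rel D :=
    AddSubgroup.subset_closure ⟨T, hT, rfl⟩
  have h2 := (QuotientAddGroup.eq_zero_iff _).2 h
  rw [QuotientAddGroup.mk_sub, sub_eq_zero, QuotientAddGroup.mk_add] at h2
  exact h2

/-- The homomorphism out of `TriK0 D` given by a function additive on distinguished triangles. -/
def TriK0.lift {G : Type*} [AddCommGroup G] (f : D → G)
    (hf : ∀ T : Triangle D, T ∈ distTriang D → f T.obj₂ = f T.obj₁ + f T.obj₃) :
    TriK0 D →+ G :=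
  QuotientAddGroup.lift (TriK0Rel D) (FreeAbelianGroup.lift f) (by
    rw [TriK0Rel, AddSubgroup.closure_le]
    rintro _ ⟨T, hT, rfl⟩
    simp [hf T hT])

@[simp]
theorem TriK0.lift_of {G : Type*} [AddCommGroup G] (f : D → G)
    (hf : ∀ T : Triangle D, T ∈ distTriang D → f T.obj₂ = f T.obj₁ + f T.obj₃) (X : D) :
    TriK0.lift f hf (TriK0.of X) = f X := by
  simp [TriK0.lift, TriK0.of]

theorem TriK0.hom_ext {G : Type*} [AddCommGroup G] {f g : TriK0 D →+ G}
    (h : ∀ X : D, f (TriK0.of X) = g (TriK0.of X)) : f = g := by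
  apply QuotientAddGroup.addMonoidHom_ext
  apply FreeAbelianGroup.lift_ext
  exact h

theorem TriK0.of_zero : TriK0.of (0 : D) = 0 := by
  have h := TriK0.of_distTriang _ (contractible_distinguished (0 : D))
  dsimp [contractibleTriangle] at h
  simpa using h

theorem TriK0.of_iso {X Y : D} (e : X ≅ Y) : TriK0.of X = TriK0.of Y := by
  have h := TriK0.of_distTriang (Triangle.mk e.hom (0 : Y ⟶ 0) 0)
    (isomorphic_distinguished _ (contractible_distinguished X) _
      (Triangle.isoMk _ _ (Iso.refl X) e.symm (Iso.refl (0 : D))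
        (e.hom_inv_id.trans (Category.comp_id _).symm)
        ((zero_comp (f := 𝟙 (0 : D))).trans (comp_zero (f := e.inv)).symm)
        ((zero_comp (f := (shiftFunctor D (1 : ℤ)).map (𝟙 X))).trans
          (comp_zero (f := 𝟙 (0 : D))).symm)))
  change TriK0.of Y = TriK0.of X + TriK0.of 0 at h
  rw [TriK0.of_zero, add_zero] at h
  exact h.symm

theorem TriK0.of_splitting (S : ShortComplex D) (s : S.Splitting) :
    TriK0.of S.X₂ = TriK0.of S.X₁ + TriK0.of S.X₃ := by
  have e : S.X₂ ≅ S.X₁ ⊞ S.X₃ :=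
    { hom := biprod.lift s.r S.g
      inv := biprod.desc S.f s.s
      hom_inv_id := by rw [biprod.lift_desc]; exact s.id
      inv_hom_id := by
        ext <;> simp [s.s_r] }
  rw [TriK0.of_iso e]
  exact TriK0.of_distTriang _ (binaryBiproductTriangle_distinguished S.X₁ S.X₃)

end GrothendieckGroups

/-! ### Fusion categories and Frobenius--Perron dimension -/

section Fusion

attribute [local instance] Abelian.hasFiniteBiproducts

variable (k : Type w) [Field k] (C : Type u₁) [Category.{v₁} C] [Abelian C] [Linear k C]
  [MonoidalCategory C] [MonoidalPreadditive C] [MonoidalLinear k C]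

/-- Isomorphism classes of simple objects. -/
def Irr (C : Type u₁) [Category.{v₁} C] [HasZeroMorphisms C] : Type u₁ :=
  {q : Quotient (isIsomorphicSetoid C) // Simple q.out}

/-- A representative of an isomorphism class of simple objects. -/
noncomputable def Irr.rep {C : Type u₁} [Category.{v₁} C] [HasZeroMorphisms C] (s : Irr C) : C :=
  s.1.out

/-- A `k`-linear abelian category with a bilinear monoidal structure is a fusion category if it is
hom-finite and semisimple with finitely many simple objects up to isomorphism, its unit is simple,
and every object has a left and a right dual. -/
class FusionCategory : Prop where
  finite_hom : ∀ X Y : C, Module.Finite k (X ⟶ Y)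
  simple_unit : Simple (𝟙_ C)
  semisimple : ∀ X : C, ∃ (n : ℕ) (S : Fin n → C), (∀ i, Simple (S i)) ∧ Nonempty (X ≅ ⨁ S)
  finite_irr : Finite (Irr C)
  left_dual : ∀ X : C, Nonempty (HasLeftDual X)
  right_dual : ∀ X : C, Nonempty (HasRightDual X)

variable {k C} in
theorem projective_of_simple (hC : FusionCategory k C) (S : C) [Simple S] : Projective S := by
  constructor
  intro E X f e he
  obtain ⟨n, T, hT, ⟨i⟩⟩ := hC.semisimple (pullback f e)
  have : ∃ j, biproduct.ι T j ≫ i.inv ≫ pullback.fst f e ≠ 0 := by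
    by_contra! h
    have h0 : i.inv ≫ pullback.fst f e = 0 := by
      apply biproduct.hom_ext'
      intro j
      rw [h j, comp_zero]
    have h1 : pullback.fst f e = 0 := by
      rw [← cancel_epi i.inv, h0, comp_zero]
    have h2 : Epi (0 : pullback f e ⟶ S) := h1 ▸ inferInstance
    have h3 : 𝟙 S = 0 := by
      rw [← cancel_epi (0 : pullback f e ⟶ S)]; simp
    exact id_nonzero S h3
  obtain ⟨j, hj⟩ := this
  have := hT j
  have hiso : IsIso (biproduct.ι T j ≫ i.inv ≫ pullback.fst f e) := isIso_of_hom_simple hj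
  refine ⟨inv (biproduct.ι T j ≫ i.inv ≫ pullback.fst f e) ≫
    biproduct.ι T j ≫ i.inv ≫ pullback.snd f e, ?_⟩
  have hc := pullback.condition (f := f) (g := e)
  have hi := IsIso.inv_hom_id (biproduct.ι T j ≫ i.inv ≫ pullback.fst f e)
  rw [Category.assoc, Category.assoc, Category.assoc, ← hc]
  calc _ = (inv (biproduct.ι T j ≫ i.inv ≫ pullback.fst f e) ≫
        (biproduct.ι T j ≫ i.inv ≫ pullback.fst f e)) ≫ f := by
          rw [Category.assoc, Category.assoc, Category.assoc]
    _ = f := by rw [hi, Category.id_comp]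

variable {k C} in
theorem nonempty_splitting (hC : FusionCategory k C) (S : ShortComplex C) (hS : S.ShortExact) : Nonempty S.Splitting := by
  obtain ⟨n, T, hT, ⟨i⟩⟩ := hC.semisimple S.X₃
  have h : ∀ j, Projective (T j) := fun j => by
    have := hT j
    exact projective_of_simple hC (T j)
  have h2 : Projective (⨁ T) := by
    constructor
    intro E X f e he
    refine ⟨biproduct.desc fun j => Projective.factorThru (biproduct.ι T j ≫ f) e, ?_⟩
    apply biproduct.hom_ext'
    intro j
    simp
  have : Projective S.X₃ := Projective.of_iso i.symm h2
  exact ⟨hS.splittingOfProjective⟩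

variable [FusionCategory k C]

/-- The set of isomorphism classes of simple objects of a fusion category is finite. -/
@[reducible]
noncomputable def irrFintype : Fintype (Irr C) :=
  have := FusionCategory.finite_irr (k := k) (C := C)
  Fintype.ofFinite _

variable {C}

/-- The multiplicity of the simple object `s` in `X`, computed as
`dim Hom(s, X) / dim End(s)`. -/
noncomputable def multiplicity (s : Irr C) (X : C) : ℝ :=
  (Module.finrank k (s.rep ⟶ X) : ℝ) / Module.finrank k (s.rep ⟶ s.rep)

/-- The matrix of left multiplication by the simple object `s` in the fusion ring, in the basis of
simple objects: the entry at `(i, j)` is the multiplicity of `j` in `s ⊗ i`. -/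
noncomputable def fusionMatrix (s : Irr C) : Matrix (Irr C) (Irr C) ℝ :=
  fun i j => multiplicity k j (s.rep ⊗ i.rep)

/-- The Frobenius--Perron eigenvalue of a simple object: the largest real eigenvalue of its
fusion matrix. -/
noncomputable def fpEigenvalue (s : Irr C) : ℝ :=
  letI := irrFintype k C
  letI := Classical.decEq (Irr C)
  sSup {r : ℝ | Module.End.HasEigenvalue (Matrix.toLin' (fusionMatrix k s)) r}

theorem multiplicity_add (s : Irr C) (S : ShortComplex C) (hS : S.ShortExact) :
    multiplicity k s S.X₂ = multiplicity k s S.X₁ + multiplicity k s S.X₃ := by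
  obtain ⟨σ⟩ := nonempty_splitting (show FusionCategory k C from inferInstance) S hS
  have h1 : ∀ X Y : C, Module.Finite k (X ⟶ Y) := FusionCategory.finite_hom
  let e : (s.rep ⟶ S.X₂) ≃ₗ[k] (s.rep ⟶ S.X₁) × (s.rep ⟶ S.X₃) :=
    { toFun := fun f => (f ≫ σ.r, f ≫ S.g)
      invFun := fun p => p.1 ≫ S.f + p.2 ≫ σ.s
      map_add' := fun f g => by simp
      map_smul' := fun a f => by simp
      left_inv := fun f => by
        simp only [Category.assoc, ← Preadditive.comp_add, σ.id, Category.comp_id]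
      right_inv := fun p => by
        ext <;> simp [σ.s_r] }
  have h2 := e.finrank_eq
  rw [Module.finrank_prod] at h2
  simp only [multiplicity, h2]
  push_cast
  ring

variable (C) in
/-- The Frobenius--Perron dimension: the additive extension to the Grothendieck group of the
Frobenius--Perron eigenvalues of the simple objects. -/
noncomputable def FPdim : AbK0 C →+ ℝ :=
  letI := irrFintype k C
  AbK0.lift (fun X => ∑ s : Irr C, multiplicity k s X * fpEigenvalue k s) (by
    intro S hS
    simp only [multiplicity_add k _ S hS, add_mul, Finset.sum_add_distrib])

end Fusion

/-! ### Module categories -/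

section ModuleCategories

variable (C : Type u₁) [Category.{v₁} C] [Preadditive C] [MonoidalCategory C]
  (M : Type u₂) [Category.{v₂} M] [Preadditive M] [MonoidalLeftAction C M]

/-- A left action of a preadditive monoidal category `C` on a preadditive category `M` makes `M` a
module category if the monoidal functor `C ⥤ (M ⥤ M)` is additive and takes values in additive
functors. -/
class ModuleCategory : Prop where
  add_actionHomLeft : ∀ {c c' : C} (f g : c ⟶ c') (X : M),
    (f + g) ⊵ₗ X = f ⊵ₗ X + g ⊵ₗ X
  actionHomRight_add : ∀ (c : C) {X Y : M} (f g : X ⟶ Y), c ⊴ₗ (f + g) = c ⊴ₗ f + c ⊴ₗ g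

/-- A module category that is triangulated, the action being by exact functors. -/
class TriangulatedModuleCategory [HasZeroObject M] [HasShift M ℤ]
    [∀ n : ℤ, (shiftFunctor M n).Additive] [Pretriangulated M] : Prop
    extends ModuleCategory C M where
  exact_action : ∀ c : C, ∃ _ : (MonoidalLeftAction.actionLeft M c).CommShift ℤ,
    (MonoidalLeftAction.actionLeft M c).IsTriangulated

variable {C} [ModuleCategory C M]

instance (c : C) : (MonoidalLeftAction.actionLeft M c).Additive where
  map_add := ModuleCategory.actionHomRight_add c _ _

variable (C) {M} in
theorem actionRight_additive (X : M) : (MonoidalLeftAction.actionRight C X).Additive where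
  map_add := ModuleCategory.add_actionHomLeft _ _ X

end ModuleCategories

section Adjunction

variable {C : Type u₁} [Category.{v₁} C] [MonoidalCategory C]
  (M : Type u₂) [Category.{v₂} M] [MonoidalLeftAction C M]

theorem actionUnit_naturality (X Y : C) [ExactPairing X Y] {d d' : M} (f : d ⟶ d') :
    f ≫ (λₗ[C] d').inv ≫ (ExactPairing.coevaluation X Y ⊵ₗ d') ≫ (αₗ X Y d').hom =
      ((λₗ[C] d).inv ≫ (ExactPairing.coevaluation X Y ⊵ₗ d) ≫ (αₗ X Y d).hom) ≫
        X ⊴ₗ Y ⊴ₗ f := by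
  rw [← MonoidalLeftAction.actionUnitIso_inv_naturality_assoc,
    MonoidalLeftAction.action_exchange_assoc]
  simp only [MonoidalLeftAction.tensor_actionHomRight, Category.assoc, Iso.inv_hom_id,
    Category.comp_id]

theorem actionCounit_naturality (X Y : C) [ExactPairing X Y] {d d' : M} (f : d ⟶ d') :
    (Y ⊴ₗ X ⊴ₗ f) ≫ (αₗ Y X d').inv ≫ (ExactPairing.evaluation X Y ⊵ₗ d') ≫ (λₗ[C] d').hom =
      ((αₗ Y X d).inv ≫ (ExactPairing.evaluation X Y ⊵ₗ d) ≫ (λₗ[C] d).hom) ≫ f := by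
  simp only [Category.assoc]
  rw [MonoidalLeftAction.actionUnitIso_hom_naturality,
    ← MonoidalLeftAction.action_exchange_assoc]
  simp only [MonoidalLeftAction.tensor_actionHomRight, Category.assoc, Iso.inv_hom_id_assoc]

theorem actionUnit_triangle (X Y : C) [ExactPairing X Y] (d : M) :
    Y ⊴ₗ ((λₗ[C] d).inv ≫ (ExactPairing.coevaluation X Y ⊵ₗ d) ≫ (αₗ X Y d).hom) ≫
      ((αₗ Y X (Y ⊙ₗ d)).inv ≫ (ExactPairing.evaluation X Y ⊵ₗ (Y ⊙ₗ d)) ≫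
        (λₗ[C] (Y ⊙ₗ d)).hom) = 𝟙 (Y ⊙ₗ d) := by
  have h := congrArg (fun t => t ⊵ₗ d) (ExactPairing.coevaluation_evaluation X Y)
  simp only [MonoidalLeftAction.comp_actionHomLeft] at h
  have e1 : Y ⊴ₗ (λₗ[C] d).inv = (ρ_ Y).inv ⊵ₗ d ≫ (αₗ Y (𝟙_ C) d).hom := by
    rw [← cancel_mono (Y ⊴ₗ (λₗ[C] d).hom), Category.assoc,
      ← MonoidalLeftAction.rightUnitor_actionHom, MonoidalLeftAction.actionHomRight_inv_hom,
      MonoidalLeftAction.inv_hom_actionHomLeft]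
  have e2 : Y ⊴ₗ ExactPairing.coevaluation X Y ⊵ₗ d =
      (αₗ Y (𝟙_ C) d).inv ≫ (Y ◁ ExactPairing.coevaluation X Y) ⊵ₗ d ≫
        (αₗ Y (X ⊗ Y) d).hom := by
    simp
  have e3 : Y ⊴ₗ (αₗ X Y d).hom ≫ (αₗ Y X (Y ⊙ₗ d)).inv ≫ (αₗ (Y ⊗ X) Y d).inv =
      (αₗ Y (X ⊗ Y) d).inv ≫ (α_ Y X Y).inv ⊵ₗ d := by
    rw [Iso.eq_inv_comp, ← cancel_epi ((α_ Y X Y).hom ⊵ₗ d),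
      MonoidalLeftAction.associator_actionHom_assoc]
    simp
  rw [MonoidalLeftAction.actionHomRight_comp, MonoidalLeftAction.actionHomRight_comp, e1, e2,
    MonoidalLeftAction.actionHomLeft_action]
  simp only [Category.assoc, reassoc_of% e3, Iso.hom_inv_id_assoc,
    ← MonoidalLeftAction.leftUnitor_actionHom, Iso.hom_inv_id_assoc]
  rw [reassoc_of% h]
  simp only [MonoidalLeftAction.inv_hom_actionHomLeft,
    MonoidalLeftAction.inv_hom_actionHomLeft_assoc]

theorem actionCounit_triangle (X Y : C) [ExactPairing X Y] (d : M) :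
    ((λₗ[C] (X ⊙ₗ d)).inv ≫ (ExactPairing.coevaluation X Y ⊵ₗ (X ⊙ₗ d)) ≫
        (αₗ X Y (X ⊙ₗ d)).hom) ≫
      X ⊴ₗ ((αₗ Y X d).inv ≫ (ExactPairing.evaluation X Y ⊵ₗ d) ≫ (λₗ[C] d).hom) =
    𝟙 (X ⊙ₗ d) := by
  have h := congrArg (fun t => t ⊵ₗ d) (ExactPairing.evaluation_coevaluation X Y)
  simp only [MonoidalLeftAction.comp_actionHomLeft] at h
  have e1 : (λₗ[C] (X ⊙ₗ d)).inv ≫ (αₗ (𝟙_ C) X d).inv = (λ_ X).inv ⊵ₗ d := by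
    rw [← cancel_mono ((λ_ X).hom ⊵ₗ d), MonoidalLeftAction.inv_hom_actionHomLeft,
      MonoidalLeftAction.leftUnitor_actionHom]
    simp only [Category.assoc, Iso.inv_hom_id_assoc, Iso.inv_hom_id]
  have e2 : X ⊴ₗ ExactPairing.evaluation X Y ⊵ₗ d =
      (αₗ X (Y ⊗ X) d).inv ≫ (X ◁ ExactPairing.evaluation X Y) ⊵ₗ d ≫
        (αₗ X (𝟙_ C) d).hom := by
    simp
  have e3 : (αₗ (X ⊗ Y) X d).hom ≫ (αₗ X Y (X ⊙ₗ d)).hom ≫ X ⊴ₗ (αₗ Y X d).inv =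
      (α_ X Y X).hom ⊵ₗ d ≫ (αₗ X (Y ⊗ X) d).hom := by
    rw [← MonoidalLeftAction.associator_actionHom_assoc]
    simp
  rw [MonoidalLeftAction.actionHomRight_comp, MonoidalLeftAction.actionHomRight_comp, e2,
    MonoidalLeftAction.actionHomLeft_action]
  simp only [Category.assoc, reassoc_of% e3, reassoc_of% e1, Iso.hom_inv_id_assoc,
    ← MonoidalLeftAction.rightUnitor_actionHom]
  rw [reassoc_of% h]
  simp only [MonoidalLeftAction.inv_hom_actionHomLeft,
    MonoidalLeftAction.inv_hom_actionHomLeft_assoc]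

/-- The action of a dual object is adjoint to the action of the object. -/
def actionAdjunction (X Y : C) [ExactPairing X Y] :
    MonoidalLeftAction.actionLeft M Y ⊣ MonoidalLeftAction.actionLeft M X :=
  Adjunction.mkOfUnitCounit
    { unit :=
        { app := fun d => (λₗ[C] d).inv ≫ (ExactPairing.coevaluation X Y ⊵ₗ d) ≫ (αₗ X Y d).hom
          naturality := fun _ _ f => actionUnit_naturality M X Y f }
      counit :=
        { app := fun d => (αₗ Y X d).inv ≫ (ExactPairing.evaluation X Y ⊵ₗ d) ≫ (λₗ[C] d).hom
          naturality := fun _ _ f => actionCounit_naturality M X Y f }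
      left_triangle := by
        ext d
        refine Eq.trans ?_ (actionUnit_triangle M X Y d)
        exact congrArg (_ ≫ ·) (Category.id_comp _)
      right_triangle := by
        ext d
        refine Eq.trans ?_ (actionCounit_triangle M X Y d)
        exact congrArg (_ ≫ ·) (Category.id_comp _) }

end Adjunction

/-! ### Module structures on Grothendieck groups -/

section K0Action

variable (k : Type w) [Field k] (C : Type u₁) [Category.{v₁} C] [Abelian C] [Linear k C]
  [MonoidalCategory C] [MonoidalPreadditive C] [MonoidalLinear k C] [FusionCategory k C]

section Abelian

variable (A : Type u₂) [Category.{v₂} A] [Preadditive A] [HasZeroObject A]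
  [MonoidalLeftAction C A] [ModuleCategory C A]

variable {k C} in
/-- By rigidity, the action of every object is automatically exact. -/
theorem shortExact_map_actionLeft (hC : FusionCategory k C) (c : C) (S : ShortComplex A) (hS : S.ShortExact) :
    (S.map (MonoidalLeftAction.actionLeft A c)).ShortExact := by
  obtain ⟨hl⟩ := hC.left_dual c
  obtain ⟨hr⟩ := hC.right_dual c
  have := (actionAdjunction A c (HasRightDual.rightDual c)).rightAdjoint_preservesLimits
  have := (actionAdjunction A (HasLeftDual.leftDual c) c).leftAdjoint_preservesColimits
  exact hS.map_of_exact _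

/-- The action of `K₀(C)` on `K₀(A)`, for an abelian module category `A` over `C`:
`[c] • [X] = [c ⊗ X]`. -/
noncomputable def AbK0.act : AbK0 C →+ AbK0 A →+ AbK0 A :=
  AbK0.lift
    (fun c => AbK0.lift (fun X => AbK0.of (c ⊙ₗ X : A)) (fun S hS =>
      AbK0.of_shortExact _ (shortExact_map_actionLeft A (show FusionCategory k C from inferInstance) c S hS)))
    (fun S hS => by
      apply AbK0.hom_ext
      intro X
      obtain ⟨σ⟩ := nonempty_splitting (show FusionCategory k C from inferInstance) S hS
      have := actionRight_additive C X
      exact AbK0.of_shortExact _ (σ.map (MonoidalLeftAction.actionRight C X)).shortExact)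

theorem AbK0.act_of (c : C) (X : A) :
    AbK0.act k C A (AbK0.of c) (AbK0.of X) = AbK0.of (c ⊙ₗ X : A) := rfl

end Abelian

section Triangulated

variable (D : Type u₂) [Category.{v₂} D] [Preadditive D] [HasZeroObject D] [HasShift D ℤ]
  [∀ n : ℤ, (shiftFunctor D n).Additive] [Pretriangulated D]
  [MonoidalLeftAction C D] [TriangulatedModuleCategory C D]

/-- The action of `K₀(C)` on `K₀(D)`, for a triangulated module category `D` over `C`:
`[c] • [X] = [c ⊗ X]`. -/
noncomputable def TriK0.act : AbK0 C →+ TriK0 D →+ TriK0 D :=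
  AbK0.lift
    (fun c => TriK0.lift (fun X => TriK0.of (c ⊙ₗ X : D)) (fun T hT => by
      obtain ⟨_, _⟩ := TriangulatedModuleCategory.exact_action (M := D) c
      exact TriK0.of_distTriang _
        ((MonoidalLeftAction.actionLeft D c).map_distinguished T hT)))
    (fun S hS => by
      apply TriK0.hom_ext
      intro X
      obtain ⟨σ⟩ := nonempty_splitting (show FusionCategory k C from inferInstance) S hS
      have := actionRight_additive C X
      exact TriK0.of_splitting _ (σ.map (MonoidalLeftAction.actionRight C X)))

theorem TriK0.act_of (c : C) (X : D) :
    TriK0.act k C D (AbK0.of c) (TriK0.of X) = TriK0.of (c ⊙ₗ X : D) := rfl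

end Triangulated

end K0Action

/-! ### Module subcategories -/

section Subcategories

variable (C : Type u₁) [Category.{v₁} C] [Preadditive C] [MonoidalCategory C]
  {D : Type u₂} [Category.{v₂} D] [Preadditive D] [MonoidalLeftAction C D]

/-- The full subcategory given by `H` is stable under the action of `C`. -/
class IsActionStable (H : ObjectProperty D) : Prop where
  action_mem : ∀ (c : C) (X : D), H X → H (c ⊙ₗ X)

/-- The restriction of the action of `C` to a stable full subcategory. -/
instance restrictedAction (H : ObjectProperty D) [IsActionStable C H] :
    MonoidalLeftAction C H.FullSubcategory where
  actionObj c X := ⟨c ⊙ₗ X.obj, IsActionStable.action_mem c X.obj X.property⟩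
  actionHomLeft f X := ObjectProperty.homMk (f ⊵ₗ X.obj)
  actionHomRight c _ _ f := ObjectProperty.homMk (c ⊴ₗ f.hom)
  actionHom f g := ObjectProperty.homMk (f ⊙ₗₘ g.hom)
  actionAssocIso c c' X := ObjectProperty.isoMk _ (αₗ c c' X.obj)
  actionUnitIso X := ObjectProperty.isoMk _ (λₗ[C] X.obj)
  actionHom_def f g :=
    ObjectProperty.hom_ext _ (MonoidalLeftAction.actionHom_def f g.hom)
  actionHomRight_id c X :=
    ObjectProperty.hom_ext _ (MonoidalLeftAction.actionHomRight_id c X.obj)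
  id_actionHomLeft c X :=
    ObjectProperty.hom_ext _ (MonoidalLeftAction.id_actionHomLeft c X.obj)
  actionHom_comp f₁ f₂ g₁ g₂ :=
    ObjectProperty.hom_ext _ (MonoidalLeftAction.actionHom_comp f₁ f₂ g₁.hom g₂.hom)
  actionAssocIso_hom_naturality f g h :=
    ObjectProperty.hom_ext _ (MonoidalLeftAction.actionAssocIso_hom_naturality f g h.hom)
  actionUnitIso_hom_naturality f :=
    ObjectProperty.hom_ext _ (MonoidalLeftAction.actionUnitIso_hom_naturality f.hom)
  whiskerLeft_actionHomLeft c _ _ f X :=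
    ObjectProperty.hom_ext _ (MonoidalLeftAction.whiskerLeft_actionHomLeft c f X.obj)
  whiskerRight_actionHomLeft c f X :=
    ObjectProperty.hom_ext _ (MonoidalLeftAction.whiskerRight_actionHomLeft c f X.obj)
  associator_actionHom c₁ c₂ c₃ X :=
    ObjectProperty.hom_ext _ (MonoidalLeftAction.associator_actionHom c₁ c₂ c₃ X.obj)
  leftUnitor_actionHom c X :=
    ObjectProperty.hom_ext _ (MonoidalLeftAction.leftUnitor_actionHom c X.obj)
  rightUnitor_actionHom c X :=
    ObjectProperty.hom_ext _ (MonoidalLeftAction.rightUnitor_actionHom c X.obj)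

instance (H : ObjectProperty D) [IsActionStable C H] [ModuleCategory C D] :
    ModuleCategory C H.FullSubcategory where
  add_actionHomLeft f g X := by
    apply ObjectProperty.hom_ext
    exact ModuleCategory.add_actionHomLeft f g X.obj
  actionHomRight_add c X Y f g := by
    apply ObjectProperty.hom_ext
    exact ModuleCategory.actionHomRight_add c f.hom g.hom

end Subcategories

/-! ### Stability functions on abelian categories -/

section StabilityFunctions

variable {A : Type u₂} [Category.{v₂} A] [Preadditive A]

variable (A) in
/-- A stability function: a homomorphism `K₀(A) → ℂ` that sends every nonzero object to the union
of the strict upper half plane and the negative real axis. -/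
structure StabilityFunction where
  hom : AbK0 A →+ ℂ
  mem_halfPlane : ∀ E : A, ¬ IsZero E →
    0 < (hom (AbK0.of E)).im ∨ ((hom (AbK0.of E)).im = 0 ∧ (hom (AbK0.of E)).re < 0)

namespace StabilityFunction

variable (Z : StabilityFunction A)

/-- The phase of a (nonzero) object, in the interval `(0, 1]`. -/
noncomputable def phase (E : A) : ℝ := Complex.arg (Z.hom (AbK0.of E)) / Real.pi

/-- A nonzero object is semistable if no nonzero subobject has larger phase. -/
def Semistable (E : A) : Prop :=
  ¬ IsZero E ∧ ∀ (B : A) (i : B ⟶ E), Mono i → ¬ IsZero B → Z.phase B ≤ Z.phase E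

/-- The Harder--Narasimhan property: every object has a finite filtration
`0 = F 0 ⊂ F 1 ⊂ ⋯ ⊂ F n = X` whose successive quotients are semistable of strictly decreasing
phases. -/
def HasHN : Prop :=
  ∀ X : A, ∃ (n : ℕ) (F : Fin (n + 1) → A) (E : Fin n → A),
    IsZero (F 0) ∧ Nonempty (F (Fin.last n) ≅ X) ∧
    (∀ i, Z.Semistable (E i)) ∧ StrictAnti (fun i => Z.phase (E i)) ∧
    ∀ i, ∃ (f : F i.castSucc ⟶ F i.succ) (g : F i.succ ⟶ E i) (h : f ≫ g = 0),
      (ShortComplex.mk f g h).ShortExact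

/-- A stability function on an abelian module category is `C`-equivariant if it is a homomorphism
of `K₀(C)`-modules, where `K₀(C)` acts on `ℂ` through the Frobenius--Perron dimension. -/
def IsEquivariant (k : Type w) [Field k] (C : Type u₁) [Category.{v₁} C] [Abelian C] [Linear k C]
    [MonoidalCategory C] [MonoidalPreadditive C] [MonoidalLinear k C] [FusionCategory k C]
    [HasZeroObject A] [MonoidalLeftAction C A] [ModuleCategory C A] : Prop :=
  ∀ (a : AbK0 C) (x : AbK0 A), Z.hom (AbK0.act k C A a x) = (FPdim k C a : ℂ) * Z.hom x

end StabilityFunction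

end StabilityFunctions

/-! ### Quasi-abelian categories of finite length -/

section QuasiAbelian

variable (A : Type u₂) [Category.{v₂} A] [Preadditive A]

/-- A strict monomorphism, that is, a kernel of some morphism. -/
def IsStrictMono {A : Type u₂} [Category.{v₂} A] [Preadditive A] {X Y : A} (f : X ⟶ Y) : Prop :=
  Nonempty (NormalMono f)

/-- A strict epimorphism, that is, a cokernel of some morphism. -/
def IsStrictEpi {A : Type u₂} [Category.{v₂} A] [Preadditive A] {X Y : A} (f : X ⟶ Y) : Prop :=
  Nonempty (NormalEpi f)

/-- A quasi-abelian category: an additive category with kernels and cokernels in which strict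
epimorphisms are stable under pullback and strict monomorphisms are stable under pushout. -/
structure IsQuasiAbelian : Prop where
  hasFiniteBiproducts : HasFiniteBiproducts A
  hasKernels : HasKernels A
  hasCokernels : HasCokernels A
  strictEpi_of_isPullback : ∀ {P X Y Z : A} {fst : P ⟶ X} {snd : P ⟶ Y} {f : X ⟶ Z} {g : Y ⟶ Z},
    IsPullback fst snd f g → IsStrictEpi g → IsStrictEpi fst
  strictMono_of_isPushout : ∀ {Z X Y P : A} {f : Z ⟶ X} {g : Z ⟶ Y} {inl : X ⟶ P} {inr : Y ⟶ P},
    IsPushout f g inl inr → IsStrictMono g → IsStrictMono inl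

/-- Every object satisfies the ascending and the descending chain condition for strict
subobjects. -/
def IsFiniteLength : Prop :=
  ∀ E : A, WellFoundedLT {S : Subobject E // IsStrictMono S.arrow} ∧
    WellFoundedGT {S : Subobject E // IsStrictMono S.arrow}

end QuasiAbelian

/-! ### Bounded hearts, slicings and stability conditions -/

section Triangulated

variable {D : Type u₂} [Category.{v₂} D] [Preadditive D] [HasZeroObject D] [HasShift D ℤ]
  [∀ n : ℤ, (shiftFunctor D n).Additive] [Pretriangulated D]

/-- `X` has a finite filtration `0 = F 0 → F 1 → ⋯ → F n ≅ X` by distinguished triangles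
`F i → F (i + 1) → E i → (F i)[1]`, where `E i` lies in `Q (t i)`, the indices `t i` lie in `I` and
`t 0 > t 1 > ⋯`. -/
def HasTower {ι : Type} [Preorder ι] (Q : ι → ObjectProperty D) (I : Set ι) (X : D) : Prop :=
  ∃ (n : ℕ) (F : Fin (n + 1) → D) (E : Fin n → D) (t : Fin n → ι),
    IsZero (F 0) ∧ Nonempty (F (Fin.last n) ≅ X) ∧ StrictAnti t ∧
    (∀ i, t i ∈ I) ∧ (∀ i, Q (t i) (E i)) ∧
    ∀ i, ∃ (f : F i.castSucc ⟶ F i.succ) (g : F i.succ ⟶ E i)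
      (h : E i ⟶ (F i.castSucc)⟦(1 : ℤ)⟧), Triangle.mk f g h ∈ distTriang D

/-- The objects isomorphic to `Y[n]` with `Y` in `H`. -/
def shiftedBy (H : ObjectProperty D) (n : ℤ) : ObjectProperty D :=
  fun X => ∃ Y : D, H Y ∧ Nonempty (X ≅ Y⟦n⟧)

/-- A (replete) full additive subcategory. -/
class IsAdditiveSubcategory (P : ObjectProperty D) : Prop extends
    P.IsClosedUnderIsomorphisms, P.ContainsZero where
  biprod_mem : ∀ X Y : D, P X → P Y → P (X ⊞ Y)

/-- The heart of a bounded t-structure on `D`. -/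
class IsBoundedHeart (H : ObjectProperty D) : Prop extends IsAdditiveSubcategory H where
  hom_eq_zero : ∀ (m n : ℤ), n < m → ∀ X Y : D, H X → H Y → ∀ f : X⟦m⟧ ⟶ Y⟦n⟧, f = 0
  tower : ∀ X : D, HasTower (shiftedBy H) Set.univ X

/-- A slicing of `D`. -/
structure IsSlicing (P : ℝ → ObjectProperty D) : Prop where
  additive : ∀ φ, IsAdditiveSubcategory (P φ)
  shift : ∀ φ, P (φ + 1) = shiftedBy (P φ) 1
  hom_eq_zero : ∀ φ₁ φ₂, φ₂ < φ₁ → ∀ X Y : D, P φ₁ X → P φ₂ Y → ∀ f : X ⟶ Y, f = 0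
  tower : ∀ X : D, HasTower P Set.univ X

variable (D) in
/-- A stability condition on `D`, without a local finiteness requirement. -/
structure StabilityCondition where
  slice : ℝ → ObjectProperty D
  isSlicing : IsSlicing slice
  charge : TriK0 D →+ ℂ
  charge_slice : ∀ (φ : ℝ) (E : D), slice φ E → ¬ IsZero E →
    ∃ m : ℝ, 0 < m ∧ charge (TriK0.of E) = m * Complex.exp (Complex.I * Real.pi * φ)

/-- The subcategory `P(I)` of the objects whose semistable pieces have phases in `I`. -/
def sliceInterval (P : ℝ → ObjectProperty D) (I : Set ℝ) : ObjectProperty D :=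
  fun X => HasTower P I X

/-- Local finiteness: for some `ε > 0`, every `P(φ - ε, φ + ε)` is quasi-abelian of finite
length. -/
def IsLocallyFinite (P : ℝ → ObjectProperty D) : Prop :=
  ∃ ε : ℝ, 0 < ε ∧ ∀ φ : ℝ,
    IsQuasiAbelian (sliceInterval P (Set.Ioo (φ - ε) (φ + ε))).FullSubcategory ∧
    IsFiniteLength (sliceInterval P (Set.Ioo (φ - ε) (φ + ε))).FullSubcategory

/-- For a stability function `Z` on a heart `H`, the subcategories `P(φ)` of `D`: if `0 < φ ≤ 1`
these are the zero objects and the `Z`-semistable objects of phase `φ` of `H`, and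
`P(φ + n) = P(φ)[n]` for every integer `n`. -/
def semistableSlice {H : ObjectProperty D} (Z : StabilityFunction H.FullSubcategory) (φ : ℝ) :
    ObjectProperty D :=
  fun X => ∃ (n : ℤ) (E : H.FullSubcategory), φ - n ∈ Set.Ioc (0 : ℝ) 1 ∧
    (IsZero E ∨ (Z.Semistable E ∧ Z.phase E = φ - n)) ∧ Nonempty (X ≅ E.obj⟦n⟧)

end Triangulated

/-! ### Equivariant stability conditions and equivariant hearts -/

section Equivariant

variable (k : Type w) [Field k] (C : Type u₁) [Category.{v₁} C] [Abelian C] [Linear k C]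
  [MonoidalCategory C] [MonoidalPreadditive C] [MonoidalLinear k C] [FusionCategory k C]
  (D : Type u₂) [Category.{v₂} D] [Preadditive D] [HasZeroObject D] [HasShift D ℤ]
  [∀ n : ℤ, (shiftFunctor D n).Additive] [Pretriangulated D]
  [MonoidalLeftAction C D] [TriangulatedModuleCategory C D]

/-- A `C`-equivariant stability condition on `D`. -/
structure EquivariantStabilityCondition extends StabilityCondition D where
  action_slice : ∀ (c : C) (φ : ℝ) (X : D), slice φ X → slice φ (c ⊙ₗ X)
  charge_equivariant : ∀ (a : AbK0 C) (x : TriK0 D),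
    charge (TriK0.act k C D a x) = (FPdim k C a : ℂ) * charge x

/-- The heart of a bounded t-structure that restricts to a module subcategory over `C`, with a
`C`-equivariant stability function satisfying the Harder--Narasimhan property. -/
structure EquivariantHeart where
  heart : ObjectProperty D
  [isBoundedHeart : IsBoundedHeart heart]
  [isActionStable : IsActionStable C heart]
  Z : StabilityFunction heart.FullSubcategory
  hasHN : Z.HasHN
  equivariant : Z.IsEquivariant k C

variable {k C D}

/-- `d` is the standard heart `P(0, 1]` of `σ` with the restriction of the central charge. -/
def Corresponds (σ : EquivariantStabilityCondition k C D) (d : EquivariantHeart k C D) : Prop :=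
  d.heart = sliceInterval σ.slice (Set.Ioc 0 1) ∧
    ∀ E : d.heart.FullSubcategory, d.Z.hom (AbK0.of E) = σ.charge (TriK0.of E.obj)

end Equivariant

end FusionStab

namespace FusionStab

set_option linter.unusedSectionVars false

/-! ### Towers indexed by lists -/

/-! A slicing and the shifts `H⟦n⟧` of a bounded heart are instances of one notion (`IsPreslicing`):
subcategories indexed by a linear order, without morphisms from a larger index to a smaller one,
such that every object has a finite filtration. Truncating filtrations by the octahedral axiom shows
that the objects with indices in an interval are exactly those orthogonal to the slices on either
side (`IsPreslicing.hasTower_iff_homZero`). They are therefore closed under extensions, and a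
preslicing contained in another one equals it (`IsPreslicing.eq_of_le`).

Given a slicing, `P(φ)` lies in the shift of `P((0,1])` by `⌈φ⌉ - 1`, so merging pieces with the
same shift makes `P((0,1])` a bounded heart. For `0 < φ ≤ 1` an object of `P(φ)` is semistable
there: a subobject receives no morphisms from `P(ψ)` with `ψ > φ`, so its phases are at most `φ`
(`semistable_of_slice`). Given a heart, Harder–Narasimhan filtrations refine the filtration by
shifts and produce the slicing `semistableSlice`. The original slicing is contained in this one,
hence equal to it.

Classes of heart objects generate `K₀(D)`, so a central charge is determined by its restriction to
the heart (`TriK0.hom_ext_of_heart`). Conversely, a charge on the heart extends by the alternating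
sum over the pieces of the filtration by shifts. Additivity on triangles is proved by sorting
filtrations: two neighbours in `H⟦m⟧` and `H⟦m + 1⟧` in the wrong order are given by a morphism of
the heart, and its kernel and cokernel put them in order (`HasCharge.insert`).

The substantial part of equivariance is that the action preserves semistability
(`StabilityFunction.Semistable.action`). Let `R` be the sum of the simple objects, so that every
object of `C` is a summand of a multiple of `R`. If `S` is the semistable subobject of largest phase
in `R ⊗ E`, then `R ⊗ S` is semistable of the same phase. Were that phase larger than the phase of
`E`, there would be no morphisms `R ⊗ S ⟶ E`, hence none from the dual of `R` tensored with `S`,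
hence by adjunction none from `S` to `R ⊗ E`. -/

/-- A finite filtration of an object, whose steps are given by a ternary relation `R` (to be thought
of as short exact sequences or distinguished triangles). The list records the indices of the
successive quotients, the index of the last quotient being the head of the list. -/
inductive ListTower {T ι : Type*} (N : T → Prop) (R : T → T → T → Prop) (Q : ι → T → Prop) :
    List ι → T → Prop
  | nil {X : T} : N X → ListTower N R Q [] X
  | cons {X' X E : T} {i : ι} {l : List ι} :
      ListTower N R Q l X' → R X' X E → Q i E → ListTower N R Q (i :: l) X

namespace ListTower

variable {T ι : Type*} {N : T → Prop} {R : T → T → T → Prop} {Q : ι → T → Prop}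

theorem congr (r : T → T → Prop) (hN : ∀ X Y, r X Y → N X → N Y)
    (hR : ∀ X Y Z Y', r Y Y' → R X Y Z → R X Y' Z)
    {l : List ι} {X Y : T} (h : ListTower N R Q l X) (hXY : r X Y) : ListTower N R Q l Y := by
  cases h with
  | nil h => exact nil (hN _ _ hXY h)
  | cons h hT hE => exact cons h (hR _ _ _ _ hXY hT) hE

theorem map {T' ι' : Type*} {N' : T' → Prop} {R' : T' → T' → T' → Prop} {Q' : ι' → T' → Prop}
    (F : T → T') (g : ι → ι') (hN : ∀ X, N X → N' (F X))
    (hR : ∀ X Y Z, R X Y Z → R' (F X) (F Y) (F Z)) {l : List ι}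
    (hQ : ∀ i ∈ l, ∀ X, Q i X → Q' (g i) (F X))
    {X : T} (h : ListTower N R Q l X) : ListTower N' R' Q' (l.map g) (F X) := by
  induction h with
  | nil h => exact nil (hN _ h)
  | cons h hT hE ih =>
    exact cons (ih fun i hi => hQ i (List.mem_cons_of_mem _ hi)) (hR _ _ _ hT)
      (hQ _ List.mem_cons_self _ hE)

/-- The head of the list belongs to the last step of the filtration, which has the smallest index;
this is why a decreasing family becomes an increasing list. -/
theorem of_fin [Preorder ι] (n : ℕ) (F : Fin (n + 1) → T) (E : Fin n → T) (t : Fin n → ι)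
    (h0 : N (F 0)) (ht : StrictAnti t) (hQ : ∀ i, Q (t i) (E i))
    (hR : ∀ i, R (F (Fin.castSucc i)) (F (Fin.succ i)) (E i)) :
    ∃ l : List ι, l.Pairwise (· < ·) ∧ (∀ i, i ∈ l ↔ ∃ j, t j = i) ∧
      ListTower N R Q l (F (Fin.last n)) := by
  induction n with
  | zero => exact ⟨[], List.Pairwise.nil, fun i => by simp, nil h0⟩
  | succ n ih =>
    obtain ⟨l, hl, hlt, h⟩ := ih (fun i => F i.castSucc) (fun i => E i.castSucc)
      (fun i => t i.castSucc) h0 (fun i j hij => ht (Fin.castSucc_lt_castSucc_iff.2 hij))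
      (fun i => hQ _) (fun i => hR _)
    refine ⟨t (Fin.last n) :: l, List.pairwise_cons.2 ⟨fun i hi => ?_, hl⟩, fun i => ?_,
      cons h (hR (Fin.last n)) (hQ _)⟩
    · obtain ⟨j, rfl⟩ := (hlt i).1 hi
      exact ht (Fin.castSucc_lt_last j)
    · rw [List.mem_cons, hlt]
      constructor
      · rintro (rfl | ⟨j, rfl⟩)
        exacts [⟨_, rfl⟩, ⟨_, rfl⟩]
      · rintro ⟨j, rfl⟩
        rcases Fin.eq_castSucc_or_eq_last j with ⟨j, rfl⟩ | rfl
        exacts [Or.inr ⟨j, rfl⟩, Or.inl rfl]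

theorem to_fin [Preorder ι] {l : List ι} {X : T} (h : ListTower N R Q l X)
    (hl : l.Pairwise (· < ·)) :
    ∃ (n : ℕ) (F : Fin (n + 1) → T) (E : Fin n → T) (t : Fin n → ι),
      N (F 0) ∧ F (Fin.last n) = X ∧ StrictAnti t ∧ (∀ i, t i ∈ l) ∧ (∀ i, Q (t i) (E i)) ∧
      ∀ i, R (F (Fin.castSucc i)) (F (Fin.succ i)) (E i) := by
  induction h with
  | @nil X h =>
    exact ⟨0, fun _ => X, Fin.elim0, Fin.elim0, h, rfl, fun i => i.elim0, fun i => i.elim0,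
      fun i => i.elim0, fun i => i.elim0⟩
  | @cons X' X E i l h hT hE ih =>
    obtain ⟨hi, hl⟩ := List.pairwise_cons.1 hl
    obtain ⟨n, F, G, t, h0, hlast, ht, htl, hQ, hR⟩ := ih hl
    refine ⟨n + 1, Fin.snoc (α := fun _ => T) F X, Fin.snoc (α := fun _ => T) G E,
      Fin.snoc (α := fun _ => ι) t i, ?_, by simp, ?_, ?_, ?_, ?_⟩
    · rw [← Fin.castSucc_zero, Fin.snoc_castSucc]
      exact h0
    · intro a b hab
      rcases Fin.eq_castSucc_or_eq_last b with ⟨b, rfl⟩ | rfl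
      · rcases Fin.eq_castSucc_or_eq_last a with ⟨a, rfl⟩ | rfl
        · simpa using ht (Fin.castSucc_lt_castSucc_iff.1 hab)
        · exact absurd hab (by simp [Fin.le_last])
      · rcases Fin.eq_castSucc_or_eq_last a with ⟨a, rfl⟩ | rfl
        · simpa using hi _ (htl a)
        · exact absurd hab (lt_irrefl _)
    · intro a
      rcases Fin.eq_castSucc_or_eq_last a with ⟨a, rfl⟩ | rfl
      · simpa using Or.inr (htl a)
      · simp
    · intro a
      rcases Fin.eq_castSucc_or_eq_last a with ⟨a, rfl⟩ | rfl
      · simpa using hQ a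
      · simpa using hE
    · intro a
      rcases Fin.eq_castSucc_or_eq_last a with ⟨a, rfl⟩ | rfl
      · rw [← Fin.castSucc_succ, Fin.snoc_castSucc, Fin.snoc_castSucc, Fin.snoc_castSucc]
        exact hR a
      · rw [Fin.succ_last, Fin.snoc_last, Fin.snoc_last, Fin.snoc_castSucc, hlast]
        exact hT

end ListTower

/-! ### Distinguished triangles as a relation on objects -/

section Triangles

variable {D : Type*} [Category* D] [Preadditive D] [HasZeroObject D] [HasShift D ℤ]
  [∀ n : ℤ, (shiftFunctor D n).Additive] [Pretriangulated D]

/-- There is a distinguished triangle `X ⟶ Y ⟶ Z ⟶ X⟦1⟧`. -/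
def IsExtension (X Y Z : D) : Prop :=
  ∃ (f : X ⟶ Y) (g : Y ⟶ Z) (h : Z ⟶ X⟦(1 : ℤ)⟧), Triangle.mk f g h ∈ distTriang D

/-- All morphisms `X ⟶ Y` are zero. -/
def HomZero {D : Type*} [Category* D] [HasZeroMorphisms D] (X Y : D) : Prop :=
  ∀ f : X ⟶ Y, f = 0

theorem HomZero.of_iso {D : Type*} [Category* D] [HasZeroMorphisms D] {X Y X' Y' : D}
    (h : HomZero X Y) (e : X' ≅ X) (e' : Y' ≅ Y) : HomZero X' Y' := fun f => by
  have := h (e.inv ≫ f ≫ e'.hom)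
  rw [← cancel_mono e'.hom, ← cancel_epi e.inv, this]
  simp

theorem HomZero.shift {X Y : D} (h : HomZero X Y) (n : ℤ) : HomZero (X⟦n⟧) (Y⟦n⟧) := fun f => by
  rw [← (shiftFunctor D n).map_preimage f, h ((shiftFunctor D n).preimage f), Functor.map_zero]

theorem homZero_of_isZero_left {D : Type*} [Category* D] [HasZeroMorphisms D] {X Y : D}
    (h : IsZero X) : HomZero X Y := fun _ => h.eq_of_src _ _

theorem homZero_of_isZero_right {D : Type*} [Category* D] [HasZeroMorphisms D] {X Y : D}
    (h : IsZero Y) : HomZero X Y := fun _ => h.eq_of_tgt _ _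

theorem isZero_shift_iff (X : D) (n : ℤ) : IsZero (X⟦n⟧) ↔ IsZero X := by
  rw [IsZero.iff_id_eq_zero, IsZero.iff_id_eq_zero, ← (shiftFunctor D n).map_id,
    (shiftFunctor D n).map_eq_zero_iff]

namespace IsExtension

theorem of_iso {X Y Z X' Y' Z' : D} (h : IsExtension X Y Z) (e₁ : X ≅ X') (e₂ : Y ≅ Y')
    (e₃ : Z ≅ Z') : IsExtension X' Y' Z' := by
  obtain ⟨f, g, h, hT⟩ := h
  refine ⟨e₁.inv ≫ f ≫ e₂.hom, e₂.inv ≫ g ≫ e₃.hom, e₃.inv ≫ h ≫ (e₁.hom)⟦(1 : ℤ)⟧',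
    isomorphic_distinguished _ hT _ ?_⟩
  exact Triangle.isoMk _ _ e₁.symm e₂.symm e₃.symm
    (show (e₁.inv ≫ f ≫ e₂.hom) ≫ e₂.inv = e₁.inv ≫ f by simp)
    (show (e₂.inv ≫ g ≫ e₃.hom) ≫ e₃.inv = e₂.inv ≫ g by simp)
    (show (e₃.inv ≫ h ≫ (e₁.hom)⟦(1 : ℤ)⟧') ≫ (e₁.inv)⟦(1 : ℤ)⟧' = e₃.inv ≫ h by
      rw [Category.assoc, Category.assoc, ← Functor.map_comp, e₁.hom_inv_id, CategoryTheory.Functor.map_id,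
        Category.comp_id])

theorem congr_mid {X Y Z Y' : D} (h : IsExtension X Y Z) (e : Y ≅ Y') : IsExtension X Y' Z :=
  h.of_iso (Iso.refl _) e (Iso.refl _)

theorem zero_left {Z X Y : D} (hZ : IsZero Z) (e : X ≅ Y) : IsExtension Z X Y :=
  IsExtension.of_iso (⟨_, _, _, contractible_distinguished₁ X⟩) ((isZero_zero D).iso hZ)
    (Iso.refl X) e

theorem zero_right {Z X Y : D} (hZ : IsZero Z) (e : X ≅ Y) : IsExtension X Y Z :=
  IsExtension.of_iso (⟨_, _, _, contractible_distinguished X⟩) (Iso.refl X) e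
    ((isZero_zero D).iso hZ)

theorem iso_of_left {X Y Z : D} (h : IsExtension X Y Z) (hX : IsZero X) : Nonempty (Y ≅ Z) := by
  obtain ⟨f, g, h, hT⟩ := h
  have : IsIso g := (Triangle.isZero₁_iff_isIso₂ _ hT).1 hX
  exact ⟨asIso g⟩

theorem iso_of_right {X Y Z : D} (h : IsExtension X Y Z) (hZ : IsZero Z) : Nonempty (X ≅ Y) := by
  obtain ⟨f, g, h, hT⟩ := h
  have : IsIso f := (Triangle.isZero₃_iff_isIso₁ _ hT).1 hZ
  exact ⟨asIso f⟩

theorem rotate {X Y Z : D} (h : IsExtension X Y Z) : IsExtension Y Z (X⟦(1 : ℤ)⟧) := by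
  obtain ⟨f, g, h, hT⟩ := h
  exact ⟨_, _, _, rot_of_distTriang _ hT⟩

theorem invRotate {X Y Z : D} (h : IsExtension X Y Z) : IsExtension (Z⟦(-1 : ℤ)⟧) X Y := by
  obtain ⟨f, g, h, hT⟩ := h
  exact ⟨_, _, _, inv_rot_of_distTriang _ hT⟩

theorem shift {X Y Z : D} (h : IsExtension X Y Z) (n : ℤ) :
    IsExtension (X⟦n⟧) (Y⟦n⟧) (Z⟦n⟧) := by
  obtain ⟨f, g, h, hT⟩ := h
  exact ⟨_, _, _, Triangle.shift_distinguished _ hT n⟩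

theorem biprod (X Y : D) : IsExtension X (X ⊞ Y) Y :=
  ⟨_, _, _, binaryBiproductTriangle_distinguished X Y⟩

theorem homZero_mid_left {X Y Z W : D} (h : IsExtension X Y Z) (hX : HomZero X W)
    (hZ : HomZero Z W) : HomZero Y W := fun u => by
  obtain ⟨f, g, h, hT⟩ := h
  obtain ⟨v, rfl⟩ : ∃ v : Z ⟶ W, u = g ≫ v := Triangle.yoneda_exact₂ _ hT u (hX _)
  rw [hZ v, comp_zero]

theorem homZero_mid_right {X Y Z W : D} (h : IsExtension X Y Z) (hX : HomZero W X)
    (hZ : HomZero W Z) : HomZero W Y := fun u => by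
  obtain ⟨f, g, h, hT⟩ := h
  obtain ⟨v, rfl⟩ : ∃ v : W ⟶ X, u = v ≫ f := Triangle.coyoneda_exact₂ _ hT u (hZ _)
  rw [hX v, zero_comp]

/-- The middle term of an extension without connecting morphisms. -/
theorem swap {X Y Z : D} (h : IsExtension X Y Z) (hZ : HomZero Z (X⟦(1 : ℤ)⟧)) :
    IsExtension Z Y X := by
  obtain ⟨f, g, h, hT⟩ := h
  have h0 : h = 0 := hZ h
  subst h0
  obtain ⟨e, -⟩ := exists_iso_binaryBiproduct_of_distTriang _ hT rfl
  exact (biprod Z X).congr_mid ((biprod.braiding Z X).trans e.symm)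

/-- The identity of `Z` restricts to zero on `Y`, so it factors through the connecting morphism and
a morphism `X⟦1⟧ ⟶ Z`. -/
theorem isZero_right {X Y Z : D} (h : IsExtension X Y Z) (h₁ : HomZero Y Z)
    (h₂ : HomZero (X⟦(1 : ℤ)⟧) Z) : IsZero Z := by
  obtain ⟨f, g, h, hT⟩ := h
  rw [IsZero.iff_id_eq_zero]
  obtain ⟨v, hv⟩ : ∃ v : X⟦(1 : ℤ)⟧ ⟶ Z, 𝟙 Z = h ≫ v :=
    Triangle.yoneda_exact₃ _ hT (𝟙 Z) (h₁ _)
  rw [hv, h₂ v, comp_zero]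

/-- Since `X ⟶ Y` is zero, the identity of `X⟦1⟧` factors through the connecting morphism by way of
`Z`. -/
theorem isZero_left {X Y Z : D} (h : IsExtension X Y Z) (h₁ : HomZero X Y)
    (h₂ : HomZero (X⟦(1 : ℤ)⟧) Z) : IsZero X := by
  obtain ⟨f, g, h, hT⟩ := h
  have h0 : f = 0 := h₁ f
  subst h0
  have hX : IsZero (X⟦(1 : ℤ)⟧) := by
    rw [IsZero.iff_id_eq_zero]
    obtain ⟨v, hv⟩ : ∃ v : X⟦(1 : ℤ)⟧ ⟶ Z, 𝟙 (X⟦(1 : ℤ)⟧) = v ≫ h :=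
      Triangle.coyoneda_exact₁ _ hT (𝟙 (X⟦(1 : ℤ)⟧))
        ((Category.id_comp _).trans ((shiftFunctor D (1 : ℤ)).map_zero X Y))
    rw [hv, h₂ v, zero_comp]
  exact (isZero_shift_iff X 1).1 hX

variable [IsTriangulated D]

/-- With `assoc_right`, this is the octahedral axiom, read as associativity of
`ObjectProperty.extensionProduct` on properties that single out one object. The pair rebrackets
two-step filtrations. -/
theorem assoc_left {X Y Z Z' E : D} (h : IsExtension X Y Z) (h' : IsExtension Z' Z E) :
    ∃ Y', IsExtension X Y' Z' ∧ IsExtension Y' Y E := by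
  have H : ObjectProperty.extensionProduct (fun W => W = X)
      (ObjectProperty.extensionProduct (fun W => W = Z') (fun W => W = E)) Y := by
    obtain ⟨f, g, k, hT⟩ := h
    obtain ⟨f', g', k', hT'⟩ := h'
    exact ⟨_, _, f, g, k, hT, rfl, _, _, f', g', k', hT', rfl, rfl⟩
  rw [← ObjectProperty.extensionProduct_assoc] at H
  obtain ⟨Y', _, f, g, k, hT, ⟨_, _, f', g', k', hT', rfl, rfl⟩, rfl⟩ := H
  exact ⟨Y', ⟨_, _, _, hT'⟩, ⟨_, _, _, hT⟩⟩

theorem assoc_right {X' X E' Y E : D} (h : IsExtension X' X E') (h' : IsExtension X Y E) :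
    ∃ W, IsExtension X' Y W ∧ IsExtension E' W E := by
  have H : ObjectProperty.extensionProduct (ObjectProperty.extensionProduct (fun W => W = X')
      (fun W => W = E')) (fun W => W = E) Y := by
    obtain ⟨f, g, k, hT⟩ := h
    obtain ⟨f', g', k', hT'⟩ := h'
    exact ⟨_, _, f', g', k', hT', ⟨_, _, f, g, k, hT, rfl, rfl⟩, rfl⟩
  rw [ObjectProperty.extensionProduct_assoc] at H
  obtain ⟨_, W, f, g, k, hT, rfl, ⟨_, _, f', g', k', hT', rfl, rfl⟩⟩ := H
  exact ⟨W, ⟨_, _, _, hT⟩, ⟨_, _, _, hT'⟩⟩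

end IsExtension

end Triangles

/-! ### Slicings indexed by a linear order -/

section Slicings

variable {D : Type*} [Category* D] [Preadditive D] [HasZeroObject D] [HasShift D ℤ]
  [∀ n : ℤ, (shiftFunctor D n).Additive] [Pretriangulated D]

/-- Towers of distinguished triangles. -/
abbrev TriTower {ι : Type*} (Q : ι → ObjectProperty D) (l : List ι) (X : D) : Prop :=
  ListTower IsZero IsExtension Q l X

namespace TriTower

variable {ι : Type*} {Q : ι → ObjectProperty D}

theorem of_iso {l : List ι} {X Y : D} (h : TriTower Q l X) (e : X ≅ Y) : TriTower Q l Y :=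
  h.congr (fun X Y => Nonempty (X ≅ Y)) (fun _ _ ⟨e⟩ h => h.of_iso e.symm)
    (fun _ _ _ _ ⟨e⟩ h => h.congr_mid e) ⟨e⟩

theorem singleton {i : ι} {X : D} (h : Q i X) : TriTower Q [i] X :=
  .cons (.nil (isZero_zero D)) (.zero_left (isZero_zero D) (Iso.refl X)) h

theorem iso_of_singleton {i : ι} {X : D} (h : TriTower Q [i] X) :
    ∃ E, Q i E ∧ Nonempty (E ≅ X) := by
  cases h with
  | cons h hT hE =>
    cases h with
    | nil h =>
      obtain ⟨e⟩ := hT.iso_of_left h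
      exact ⟨_, hE, ⟨e.symm⟩⟩

theorem homZero_left {l : List ι} {X Y : D} (h : TriTower Q l X)
    (hY : ∀ i ∈ l, ∀ E, Q i E → HomZero E Y) : HomZero X Y := by
  induction h with
  | nil h => exact homZero_of_isZero_left h
  | cons h hT hE ih =>
    exact hT.homZero_mid_left (ih fun i hi => hY i (List.mem_cons_of_mem _ hi))
      (hY _ List.mem_cons_self _ hE)

theorem homZero_right {l : List ι} {X Y : D} (h : TriTower Q l X)
    (hY : ∀ i ∈ l, ∀ E, Q i E → HomZero Y E) : HomZero Y X := by
  induction h with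
  | nil h => exact homZero_of_isZero_right h
  | cons h hT hE ih =>
    exact hT.homZero_mid_right (ih fun i hi => hY i (List.mem_cons_of_mem _ hi))
      (hY _ List.mem_cons_self _ hE)

theorem homZero_left_shift {l : List ι} {X Y : D} (h : TriTower Q l X)
    (hY : ∀ i ∈ l, ∀ E, Q i E → HomZero (E⟦(1 : ℤ)⟧) Y) : HomZero (X⟦(1 : ℤ)⟧) Y := by
  induction h with
  | nil h => exact homZero_of_isZero_left ((isZero_shift_iff _ 1).2 h)
  | cons h hT hE ih =>
    exact (hT.shift 1).homZero_mid_left (ih fun i hi => hY i (List.mem_cons_of_mem _ hi))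
      (hY _ List.mem_cons_self _ hE)

variable [IsTriangulated D]

theorem concat {l l' : List ι} {X Y Z : D} (hX : TriTower Q l X) (hZ : TriTower Q l' Z)
    (hT : IsExtension X Y Z) : TriTower Q (l' ++ l) Y := by
  induction hZ generalizing Y with
  | nil h =>
    obtain ⟨e⟩ := hT.iso_of_right h
    exact hX.of_iso e
  | cons h hT' hE ih =>
    obtain ⟨Y', h₁, h₂⟩ := hT.assoc_left hT'
    exact .cons (ih h₁) h₂ hE

theorem truncate [LinearOrder ι] {U : Set ι} (hU : IsUpperSet U) {l : List ι} {X : D}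
    (h : TriTower Q l X) (hl : l.Pairwise (· < ·)) :
    ∃ (A B : D) (a b : List ι), IsExtension A X B ∧ TriTower Q a A ∧ TriTower Q b B ∧
      a.Sublist l ∧ b.Sublist l ∧ (∀ i ∈ a, i ∈ U) ∧ (∀ i ∈ b, i ∉ U) := by
  classical
  induction h with
  | @nil X h =>
    exact ⟨X, X, [], [], .zero_left h (Iso.refl _), .nil h, .nil h, by simp⟩
  | @cons X' X E i l h hT hE ih =>
    obtain ⟨hi, hl⟩ := List.pairwise_cons.1 hl
    obtain ⟨A, B, a, b, hX', hA, hB, ha, hb, haU, hbU⟩ := ih hl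
    by_cases hiU : i ∈ U
    -- The head is the smallest index, so once it lies in the upper set all the others do, and
    -- nothing is cut off.
    · refine ⟨X, 0, i :: l, [], .zero_right (isZero_zero D) (Iso.refl _), .cons h hT hE,
        .nil (isZero_zero D), List.Sublist.refl _, by simp, ?_, by simp⟩
      intro j hj
      rcases List.mem_cons.1 hj with rfl | hj
      exacts [hiU, hU (hi j hj).le hiU]
    · obtain ⟨W, h₁, h₂⟩ := hX'.assoc_right hT
      refine ⟨A, W, a, i :: b, h₁, hA, .cons hB h₂ hE, ha.cons _, hb.cons_cons _, haU, ?_⟩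
      intro j hj
      rcases List.mem_cons.1 hj with rfl | hj
      exacts [hiU, hbU j hj]

end TriTower

theorem hasTower_iff {ι : Type} [Preorder ι] {Q : ι → ObjectProperty D} {I : Set ι} {X : D} :
    HasTower Q I X ↔ ∃ l : List ι, l.Pairwise (· < ·) ∧ (∀ i ∈ l, i ∈ I) ∧ TriTower Q l X := by
  constructor
  · rintro ⟨n, F, E, t, h0, ⟨e⟩, ht, htI, hQ, hT⟩
    obtain ⟨l, hl, hlt, h⟩ := ListTower.of_fin (N := IsZero) (R := IsExtension) (Q := Q)
      n F E t h0 ht hQ hT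
    refine ⟨l, hl, fun i hi => ?_, TriTower.of_iso h e⟩
    obtain ⟨j, rfl⟩ := (hlt i).1 hi
    exact htI j
  · rintro ⟨l, hl, hI, h⟩
    obtain ⟨n, F, E, t, h0, hlast, ht, htl, hQ, hT⟩ := h.to_fin hl
    exact ⟨n, F, E, t, h0, ⟨eqToIso hlast⟩, ht, fun i => hI _ (htl i), hQ, hT⟩

theorem HasTower.of_iso {ι : Type} [Preorder ι] {Q : ι → ObjectProperty D} {I : Set ι} {X Y : D}
    (h : HasTower Q I X) (e : X ≅ Y) : HasTower Q I Y := by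
  rw [hasTower_iff] at h ⊢
  obtain ⟨l, hl, hI, h⟩ := h
  exact ⟨l, hl, hI, h.of_iso e⟩

theorem HasTower.of_isZero {ι : Type} [Preorder ι] {Q : ι → ObjectProperty D} {I : Set ι} {X : D}
    (h : IsZero X) : HasTower Q I X :=
  hasTower_iff.2 ⟨[], .nil, by simp, .nil h⟩

theorem HasTower.mono {ι : Type} [Preorder ι] {Q : ι → ObjectProperty D} {I J : Set ι} {X : D}
    (h : HasTower Q I X) (hIJ : I ⊆ J) : HasTower Q J X := by
  rw [hasTower_iff] at h ⊢
  obtain ⟨l, hl, hI, h⟩ := h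
  exact ⟨l, hl, fun i hi => hIJ (hI i hi), h⟩

theorem HasTower.of_mem {ι : Type} [Preorder ι] {Q : ι → ObjectProperty D} {I : Set ι} {X : D}
    {i : ι} (hi : i ∈ I) (h : Q i X) : HasTower Q I X :=
  hasTower_iff.2 ⟨[i], by simp, by simpa using hi, .singleton h⟩

/-- A common generalization of the slicings of a triangulated category (indexed by `ℝ`) and of the
shifts of the heart of a bounded t-structure (indexed by `ℤ`). -/
structure IsPreslicing {ι : Type} [LinearOrder ι] (Q : ι → ObjectProperty D) : Prop where
  of_iso : ∀ i (X Y : D), (X ≅ Y) → Q i X → Q i Y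
  of_isZero : ∀ i (X : D), IsZero X → Q i X
  homZero : ∀ i j, i < j → ∀ X Y : D, Q j X → Q i Y → HomZero X Y
  homZero_shift : ∀ i j, i ≤ j → ∀ X Y : D, Q j X → Q i Y → HomZero (X⟦(1 : ℤ)⟧) Y
  tower : ∀ X : D, HasTower Q Set.univ X

namespace IsPreslicing

variable {ι : Type} [LinearOrder ι] {Q : ι → ObjectProperty D} (hQ : IsPreslicing Q)
include hQ

theorem mem_of_hasTower_singleton {i : ι} {X : D} (h : HasTower Q {i} X) : Q i X := by
  obtain ⟨l, hl, hI, h'⟩ := hasTower_iff.1 h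
  match l, hl, hI, h' with
  | [], _, _, .nil h => exact hQ.of_isZero _ _ h
  | [j], _, hI, h' =>
    obtain rfl : j = i := by simpa using hI
    obtain ⟨E, hE, ⟨e⟩⟩ := TriTower.iso_of_singleton h'
    exact hQ.of_iso _ _ _ e hE
  | j :: j' :: l, hl, hI, _ =>
    have h₁ : j = i := hI j (by simp)
    have h₂ : j' = i := hI j' (by simp)
    have h₃ : j < j' := (List.pairwise_cons.1 hl).1 j' (by simp)
    exact absurd (h₁.trans h₂.symm) h₃.ne

theorem homZero_of_hasTower {I J : Set ι} (hIJ : ∀ i ∈ I, ∀ j ∈ J, j < i) {X Y : D}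
    (hX : HasTower Q I X) (hY : HasTower Q J Y) : HomZero X Y := by
  obtain ⟨l, -, hl, hX⟩ := hasTower_iff.1 hX
  obtain ⟨l', -, hl', hY⟩ := hasTower_iff.1 hY
  exact hX.homZero_left fun i hi E hE => hY.homZero_right fun j hj E' hE' =>
    hQ.homZero _ _ (hIJ i (hl i hi) j (hl' j hj)) _ _ hE hE'

theorem homZero_shift_of_hasTower {I J : Set ι} (hIJ : ∀ i ∈ I, ∀ j ∈ J, j ≤ i) {X Y : D}
    (hX : HasTower Q I X) (hY : HasTower Q J Y) : HomZero (X⟦(1 : ℤ)⟧) Y := by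
  obtain ⟨l, -, hl, hX⟩ := hasTower_iff.1 hX
  obtain ⟨l', -, hl', hY⟩ := hasTower_iff.1 hY
  exact hX.homZero_left_shift fun i hi E hE => hY.homZero_right fun j hj E' hE' =>
    hQ.homZero_shift _ _ (hIJ i (hl i hi) j (hl' j hj)) _ _ hE hE'

variable [IsTriangulated D]

omit hQ in
theorem truncate {U I : Set ι} (hU : IsUpperSet U) {X : D} (h : HasTower Q I X) :
    ∃ A B : D, IsExtension A X B ∧ HasTower Q (I ∩ U) A ∧ HasTower Q (I ∩ Uᶜ) B := by
  obtain ⟨l, hl, hI, h⟩ := hasTower_iff.1 h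
  obtain ⟨A, B, a, b, hT, hA, hB, ha, hb, haU, hbU⟩ := h.truncate hU hl
  exact ⟨A, B, hT,
    hasTower_iff.2 ⟨a, hl.sublist ha, fun i hi => ⟨hI i (ha.subset hi), haU i hi⟩, hA⟩,
    hasTower_iff.2 ⟨b, hl.sublist hb, fun i hi => ⟨hI i (hb.subset hi), hbU i hi⟩, hB⟩⟩

omit hQ in
theorem lt_of_mem_of_notMem {U : Set ι} (hU : IsUpperSet U) {i j : ι} (hi : i ∈ U) (hj : j ∉ U) :
    j < i :=
  lt_of_not_ge fun h => hj (hU h hi)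

/-- Cut at `U`: the lower part `B` receives nothing from `X` or from `A⟦1⟧`, so it vanishes. Cut
what remains at the complement of `L`: the upper part vanishes for the dual reason. -/
theorem hasTower_of_homZero {U L : Set ι} (hU : IsUpperSet U) (hL : IsLowerSet L) {X : D}
    (hXU : ∀ j ∉ U, ∀ Y, Q j Y → HomZero X Y) (hXL : ∀ j ∉ L, ∀ Y, Q j Y → HomZero Y X) :
    HasTower Q (U ∩ L) X := by
  obtain ⟨A, B, hT, hA, hB⟩ := truncate hU (hQ.tower X)
  have hB0 : IsZero B := hT.isZero_right
    (by
      obtain ⟨l, -, hl, hB⟩ := hasTower_iff.1 hB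
      exact hB.homZero_right fun j hj E hE => hXU j (hl j hj).2 E hE)
    (hQ.homZero_shift_of_hasTower
      (fun i hi j hj => (lt_of_mem_of_notMem hU hi.2 hj.2).le) hA hB)
  obtain ⟨e⟩ := hT.iso_of_right hB0
  obtain ⟨A', B', hT', hA', hB'⟩ := truncate (U := Lᶜ) hL.compl (hA.of_iso e)
  have hA0 : IsZero A' := hT'.isZero_left
    (by
      obtain ⟨l, -, hl, hA'⟩ := hasTower_iff.1 hA'
      exact hA'.homZero_left fun j hj E hE => hXL j (hl j hj).2 E hE)
    (hQ.homZero_shift_of_hasTower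
      (fun i hi j hj => (lt_of_mem_of_notMem hL.compl hi.2 hj.2).le) hA' hB')
  obtain ⟨e'⟩ := hT'.iso_of_left hA0
  exact (hB'.of_iso e'.symm).mono fun i hi => ⟨hi.1.2, not_not.1 hi.2⟩

theorem hasTower_iff_homZero {U L : Set ι} (hU : IsUpperSet U) (hL : IsLowerSet L) {X : D} :
    HasTower Q (U ∩ L) X ↔
      (∀ j ∉ U, ∀ Y, Q j Y → HomZero X Y) ∧ (∀ j ∉ L, ∀ Y, Q j Y → HomZero Y X) := by
  refine ⟨fun h => ⟨fun j hj Y hY => ?_, fun j hj Y hY => ?_⟩,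
    fun h => hQ.hasTower_of_homZero hU hL h.1 h.2⟩
  · exact hQ.homZero_of_hasTower (J := {j})
      (fun i hi j' hj' => by
        rw [Set.mem_singleton_iff.1 hj']; exact lt_of_mem_of_notMem hU hi.1 hj)
      h (.of_mem rfl hY)
  · exact hQ.homZero_of_hasTower (I := {j})
      (fun j' hj' i hi => by
        rw [Set.mem_singleton_iff.1 hj']; exact lt_of_mem_of_notMem hL.compl hj (not_not.2 hi.2))
      (.of_mem rfl hY) h

/-- Orthogonality to a fixed object passes to the middle term of a triangle. -/
theorem hasTower_extension {U L : Set ι} (hU : IsUpperSet U) (hL : IsLowerSet L) {X Y Z : D}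
    (hT : IsExtension X Y Z) (hX : HasTower Q (U ∩ L) X) (hZ : HasTower Q (U ∩ L) Z) :
    HasTower Q (U ∩ L) Y := by
  rw [hQ.hasTower_iff_homZero hU hL] at hX hZ ⊢
  exact ⟨fun j hj W hW => hT.homZero_mid_left (hX.1 j hj W hW) (hZ.1 j hj W hW),
    fun j hj W hW => hT.homZero_mid_right (hX.2 j hj W hW) (hZ.2 j hj W hW)⟩

theorem mem_iff_homZero {i : ι} {X : D} :
    Q i X ↔ (∀ j < i, ∀ Y, Q j Y → HomZero X Y) ∧ (∀ j, i < j → ∀ Y, Q j Y → HomZero Y X) := by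
  have hU : IsUpperSet (Set.Ici i) := isUpperSet_Ici i
  have hL : IsLowerSet (Set.Iic i) := isLowerSet_Iic i
  have h := hQ.hasTower_iff_homZero hU hL (X := X)
  simp only [Set.mem_Ici, Set.mem_Iic, not_le] at h
  refine Iff.trans ?_ h
  rw [Set.Ici_inter_Iic, Set.Icc_self]
  exact ⟨fun h => .of_mem rfl h, hQ.mem_of_hasTower_singleton⟩

theorem mem_extension {i : ι} {X Y Z : D} (hT : IsExtension X Y Z) (hX : Q i X) (hZ : Q i Z) :
    Q i Y := by
  rw [hQ.mem_iff_homZero] at hX hZ ⊢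
  exact ⟨fun j hj W hW => hT.homZero_mid_left (hX.1 j hj W hW) (hZ.1 j hj W hW),
    fun j hj W hW => hT.homZero_mid_right (hX.2 j hj W hW) (hZ.2 j hj W hW)⟩

/-- A preslicing contained in another one is equal to it. -/
theorem eq_of_le {Q' : ι → ObjectProperty D} (hQ' : IsPreslicing Q') (h : ∀ i, Q i ≤ Q' i) :
    Q = Q' := by
  funext i
  refine le_antisymm (h i) fun X hX => ?_
  -- The larger family imposes more orthogonality conditions, so its members satisfy those of the
  -- smaller one.
  rw [hQ'.mem_iff_homZero] at hX
  rw [hQ.mem_iff_homZero]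
  exact ⟨fun j hj W hW => hX.1 j hj W (h j W hW), fun j hj W hW => hX.2 j hj W (h j W hW)⟩

end IsPreslicing

/-- Towers whose indices are only weakly ordered can be made strictly ordered, by merging the
pieces with the same index. -/
theorem TriTower.merge [IsTriangulated D] {ι : Type} [LinearOrder ι] {Q : ι → ObjectProperty D}
    (hQ : ∀ i (X Y Z : D), IsExtension X Y Z → Q i X → Q i Z → Q i Y) {l : List ι} {X : D}
    (h : TriTower Q l X) (hl : l.Pairwise (· ≤ ·)) :
    ∃ l' : List ι, l'.Pairwise (· < ·) ∧ (∀ i, i ∈ l' → i ∈ l) ∧ TriTower Q l' X := by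
  induction h with
  | nil h => exact ⟨[], .nil, by simp, .nil h⟩
  | @cons X' X E i l h hT hE ih =>
    obtain ⟨hi, hl⟩ := List.pairwise_cons.1 hl
    obtain ⟨l', hl', hll', h'⟩ := ih hl
    by_cases hil : ∀ j ∈ l', i < j
    · refine ⟨i :: l', List.pairwise_cons.2 ⟨hil, hl'⟩, fun j hj => ?_, .cons h' hT hE⟩
      rcases List.mem_cons.1 hj with rfl | hj
      exacts [List.mem_cons_self, List.mem_cons_of_mem _ (hll' j hj)]
    · push Not at hil
      obtain ⟨j, hj, hji⟩ := hil
      -- The list is weakly increasing, so strictness can only fail through equality, and then with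
      -- the head of the merged list.
      obtain rfl : j = i := le_antisymm hji (hi j (hll' j hj))
      cases h' with
      | nil => simp at hj
      | @cons X'' _ E' i' l' h'' hT' hE' =>
        obtain ⟨hi', hl''⟩ := List.pairwise_cons.1 hl'
        obtain rfl : i' = j := by
          rcases List.mem_cons.1 hj with rfl | hj'
          · rfl
          · exact absurd (hi' j hj') (not_lt.2 (hi i' (hll' i' List.mem_cons_self)))
        -- The two top quotients have the same index; the octahedron replaces them by the single
        -- quotient `W`, an extension of one by the other.
        obtain ⟨W, h₁, h₂⟩ := hT'.assoc_right hT
        exact ⟨i' :: l', hl', fun k hk => List.mem_cons_of_mem _ (hll' k hk),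
          .cons h'' h₁ (hQ _ _ _ _ h₂ hE' hE)⟩

end Slicings

/-! ### Bounded hearts -/

section Hearts

variable {D : Type*} [Category* D] [Preadditive D] [HasZeroObject D] [HasShift D ℤ]
  [∀ n : ℤ, (shiftFunctor D n).Additive] [Pretriangulated D]

/-- The isomorphism `X⟦a⟧⟦b⟧ ≅ X⟦c⟧` for `a + b = c`. -/
noncomputable def shiftShiftIso (X : D) (a b c : ℤ) (h : a + b = c) : X⟦a⟧⟦b⟧ ≅ X⟦c⟧ :=
  ((shiftFunctorAdd' D a b c h).app X).symm

/-- The isomorphism `X⟦0⟧ ≅ X`. -/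
noncomputable def shiftZeroIso (X : D) : X⟦(0 : ℤ)⟧ ≅ X := (shiftFunctorZero D ℤ).app X

/-- The isomorphism `X⟦a⟧⟦b⟧ ≅ X` for `a + b = 0`. -/
noncomputable def shiftCancelIso (X : D) (a b : ℤ) (h : a + b = 0) : X⟦a⟧⟦b⟧ ≅ X :=
  shiftShiftIso X a b 0 h ≪≫ shiftZeroIso X

theorem shiftedBy_of_iso {H : ObjectProperty D} {n : ℤ} {X Y : D} (h : shiftedBy H n X)
    (e : X ≅ Y) : shiftedBy H n Y := by
  obtain ⟨X', hX, ⟨i⟩⟩ := h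
  exact ⟨X', hX, ⟨e.symm ≪≫ i⟩⟩

theorem shiftedBy_shift {H : ObjectProperty D} {n : ℤ} {X : D} (h : shiftedBy H n X) (a b : ℤ)
    (hab : n + a = b) : shiftedBy H b (X⟦a⟧) := by
  obtain ⟨X', hX, ⟨i⟩⟩ := h
  exact ⟨X', hX, ⟨(shiftFunctor D a).mapIso i ≪≫ shiftShiftIso X' n a b hab⟩⟩

theorem shiftedBy_zero (H : ObjectProperty D) [H.IsClosedUnderIsomorphisms] :
    shiftedBy H 0 = H := by
  ext X
  constructor
  · rintro ⟨X', hX, ⟨i⟩⟩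
    exact H.prop_of_iso (i ≪≫ shiftZeroIso X').symm hX
  · exact fun h => ⟨X, h, ⟨(shiftZeroIso X).symm⟩⟩

theorem isAdditiveSubcategory_of_extension {P : ObjectProperty D}
    (hi : ∀ X Y : D, (X ≅ Y) → P X → P Y) (h0 : ∀ X : D, IsZero X → P X)
    (he : ∀ X Y Z : D, IsExtension X Y Z → P X → P Z → P Y) : IsAdditiveSubcategory P where
  of_iso e h := hi _ _ e h
  exists_zero := ⟨0, isZero_zero D, h0 0 (isZero_zero D)⟩
  biprod_mem X Y hX hY := he _ _ _ (IsExtension.biprod X Y) hX hY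

variable (H : ObjectProperty D)

theorem IsBoundedHeart.homZero [IsBoundedHeart H] {i j : ℤ} (hij : i < j) {X Y : D}
    (hX : shiftedBy H j X) (hY : shiftedBy H i Y) : HomZero X Y := by
  obtain ⟨X', hX', ⟨eX⟩⟩ := hX
  obtain ⟨Y', hY', ⟨eY⟩⟩ := hY
  exact HomZero.of_iso (IsBoundedHeart.hom_eq_zero j i hij X' Y' hX' hY') eX eY

/-- Truncation and orthogonality for preslicings thereby yield truncation for the t-structure, with
`H⟦n⟧` as the slice of index `n`. -/
theorem IsBoundedHeart.isPreslicing [IsBoundedHeart H] : IsPreslicing (shiftedBy H) where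
  of_iso _ _ _ e h := shiftedBy_of_iso h e
  of_isZero i X h := ⟨0, H.prop_zero, ⟨h.iso ((isZero_shift_iff _ i).2 (isZero_zero D))⟩⟩
  homZero _ _ hij _ _ hX hY := IsBoundedHeart.homZero H hij hX hY
  homZero_shift i j hij _ _ hX hY :=
    IsBoundedHeart.homZero H (by lia) (shiftedBy_shift hX 1 (j + 1) rfl) hY
  tower := IsBoundedHeart.tower

theorem IsBoundedHeart.mem_extension [IsBoundedHeart H] [IsTriangulated D] {X Y Z : D}
    (hT : IsExtension X Y Z) (hX : H X) (hZ : H Z) : H Y := by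
  rw [← shiftedBy_zero H] at hX hZ ⊢
  exact (IsBoundedHeart.isPreslicing H).mem_extension hT hX hZ

theorem IsAdditiveSubcategory.isClosedUnderFiniteProducts [IsAdditiveSubcategory H] :
    H.IsClosedUnderFiniteProducts := by
  have : H.IsClosedUnderBinaryProducts := by
    constructor
    rintro X ⟨p⟩
    refine H.prop_of_iso ?_ (IsAdditiveSubcategory.biprod_mem _ _
      (p.prop_diag_obj ⟨.left⟩) (p.prop_diag_obj ⟨.right⟩))
    refine (biprod.isoProd _ _) ≪≫ (limit.isLimit _).conePointsIsoOfNatIso p.isLimit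
      (diagramIsoPair p.diag).symm
  exact ObjectProperty.IsClosedUnderFiniteProducts.mk'

namespace IsBoundedHeart

variable [IsBoundedHeart H]

theorem hasFiniteProducts : HasFiniteProducts H.FullSubcategory :=
  have := IsAdditiveSubcategory.isClosedUnderFiniteProducts H
  inferInstance

theorem ι_hom_eq_zero ⦃X Y : H.FullSubcategory⦄ ⦃n : ℤ⦄ (f : H.ι.obj X ⟶ (H.ι.obj Y)⟦n⟧)
    (hn : n < 0) : f = 0 :=
  IsBoundedHeart.homZero H hn (X := X.obj) (Y := (Y.obj)⟦n⟧)
    (by rw [shiftedBy_zero]; exact X.property) ⟨Y.obj, Y.property, ⟨Iso.refl _⟩⟩ f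

variable [IsTriangulated D]

/-- The cone `Z` is an extension of `X⟦1⟧` by `Y`, so only the shifts 0 and 1 of the heart occur in
it. Truncating between them separates the future kernel `K` from the cokernel `Q` of `X ⟶ Y`. -/
theorem exists_extension_of_hom {X Y : D} (hX : H X) (hY : H Y) {Z : D}
    (hT : IsExtension X Y Z) : ∃ K Q : D, H K ∧ H Q ∧ IsExtension (K⟦(1 : ℤ)⟧) Z Q := by
  have hP := IsBoundedHeart.isPreslicing H
  have h01 : HasTower (shiftedBy H) (Set.Ici 0 ∩ Set.Iic 1) Z := by
    refine hP.hasTower_extension (isUpperSet_Ici 0) (isLowerSet_Iic 1) hT.rotate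
      (.of_mem (i := 0) (by simp) (by rwa [shiftedBy_zero]))
      (.of_mem (i := 1) (by simp) ⟨X, hX, ⟨Iso.refl _⟩⟩)
  obtain ⟨A, B, hAB, hA, hB⟩ := IsPreslicing.truncate (isUpperSet_Ici (1 : ℤ)) h01
  have h1 : (Set.Ici (0 : ℤ) ∩ Set.Iic 1) ∩ Set.Ici 1 = {1} := by
    ext x; simp only [Set.mem_inter_iff, Set.mem_Ici, Set.mem_Iic, Set.mem_singleton_iff]; lia
  have h0 : (Set.Ici (0 : ℤ) ∩ Set.Iic 1) ∩ (Set.Ici 1)ᶜ = {0} := by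
    ext x
    simp only [Set.mem_inter_iff, Set.mem_Ici, Set.mem_Iic, Set.mem_singleton_iff,
      Set.mem_compl_iff]
    lia
  rw [h1] at hA
  rw [h0] at hB
  obtain ⟨K, hK, ⟨e⟩⟩ := hP.mem_of_hasTower_singleton hA
  have hB' := hP.mem_of_hasTower_singleton hB
  rw [shiftedBy_zero] at hB'
  exact ⟨K, B, hK, hB', hAB.of_iso e (Iso.refl _) (Iso.refl _)⟩

theorem admissibleMorphism_eq_top :
    Triangulated.AbelianSubcategory.admissibleMorphism H.ι = ⊤ := by
  ext X₁ X₂ f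
  simp only [MorphismProperty.top_apply, iff_true]
  intro X₃ f₂ f₃ hT
  obtain ⟨K, Q, hK, hQ, α, β, γ, h⟩ := exists_extension_of_hom H X₁.property X₂.property
    ⟨_, _, _, hT⟩
  exact ⟨⟨K, hK⟩, ⟨Q, hQ⟩, α, β, γ, h⟩

/-- The heart of a bounded t-structure is an abelian category. -/
@[reducible]
noncomputable def abelian : Abelian H.FullSubcategory :=
  have := hasFiniteProducts H
  Triangulated.AbelianSubcategory.abelian H.ι (ι_hom_eq_zero H) (admissibleMorphism_eq_top H)

theorem shortExact_of_distTriang {X Y Z : H.FullSubcategory} (f : X ⟶ Y) (g : Y ⟶ Z)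
    (h : Z.obj ⟶ X.obj⟦(1 : ℤ)⟧) (hT : Triangle.mk f.hom g.hom h ∈ distTriang D) :
    ∃ w : f ≫ g = 0, (ShortComplex.mk f g w).ShortExact := by
  have := hasFiniteProducts H
  let := abelian H
  have w : f ≫ g = 0 := H.ι.map_injective (by
    simpa using! comp_distTriang_mor_zero₁₂ _ hT)
  refine ⟨w, ?_⟩
  have hk := Triangulated.AbelianSubcategory.isLimitKernelForkOfDistTriang
    (ι_hom_eq_zero H) f g h hT
  have hc := Triangulated.AbelianSubcategory.isColimitCokernelCoforkOfDistTriang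
    (ι_hom_eq_zero H) f g h hT
  exact { exact := ShortComplex.exact_of_f_is_kernel _ hk
          mono_f := Fork.IsLimit.mono hk
          epi_g := Cofork.IsColimit.epi hc }

theorem shortExact_of_isExtension {X Y Z : H.FullSubcategory}
    (hT : IsExtension X.obj Y.obj Z.obj) :
    ∃ (f : X ⟶ Y) (g : Y ⟶ Z) (w : f ≫ g = 0), (ShortComplex.mk f g w).ShortExact := by
  obtain ⟨f, g, h, hT⟩ := hT
  exact ⟨ObjectProperty.homMk f, ObjectProperty.homMk g,
    shortExact_of_distTriang H (ObjectProperty.homMk f) (ObjectProperty.homMk g) h hT⟩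

/-- An epimorphism of the heart fits in a triangle whose first term is a kernel of it. Uniqueness of
kernels identifies that term with `S.X₁`, and the connecting morphism is transported along this
isomorphism. -/
theorem exists_distTriang_of_shortExact (S : ShortComplex H.FullSubcategory) (hS : S.ShortExact) :
    ∃ h : S.X₃.obj ⟶ S.X₁.obj⟦(1 : ℤ)⟧, Triangle.mk S.f.hom S.g.hom h ∈ distTriang D := by
  have := hasFiniteProducts H
  let := abelian H
  have := hS.epi_g
  have := hS.mono_f
  obtain ⟨X, i, δ, hT⟩ := Triangulated.AbelianSubcategory.exists_distinguished_triangle_of_epi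
    (ι_hom_eq_zero H) (admissibleMorphism_eq_top H) S.g
  have hk := Triangulated.AbelianSubcategory.isLimitKernelForkOfDistTriang
    (ι_hom_eq_zero H) i S.g δ hT
  let e : S.X₁ ≅ X := hS.fIsKernel.conePointUniqueUpToIso hk
  have he : e.hom ≫ i = S.f := hS.fIsKernel.conePointUniqueUpToIso_hom_comp hk .zero
  refine ⟨δ ≫ (H.ι.map e.inv)⟦(1 : ℤ)⟧', isomorphic_distinguished _ hT _ ?_⟩
  refine Triangle.isoMk _ _ (H.ι.mapIso e) (Iso.refl _) (Iso.refl _) ?_ ?_ ?_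
  · exact (Category.comp_id _).trans (congrArg (fun t => t.hom) he.symm)
  · exact (Category.comp_id _).trans (Category.id_comp _).symm
  · change (δ ≫ (H.ι.map e.inv)⟦(1 : ℤ)⟧') ≫ (H.ι.map e.hom)⟦(1 : ℤ)⟧' = 𝟙 _ ≫ δ
    rw [Category.assoc, ← Functor.map_comp, ← Functor.map_comp, e.inv_hom_id,
      CategoryTheory.Functor.map_id, CategoryTheory.Functor.map_id, Category.comp_id,
      Category.id_comp]

theorem isExtension_of_shortExact (S : ShortComplex H.FullSubcategory) (hS : S.ShortExact) :
    IsExtension S.X₁.obj S.X₂.obj S.X₃.obj := by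
  obtain ⟨h, hT⟩ := exists_distTriang_of_shortExact H S hS
  exact ⟨_, _, _, hT⟩

end IsBoundedHeart

end Hearts

/-! ### Extension of a central charge from the heart to the triangulated category -/

theorem AbK0.of_iso {A : Type*} [Category* A] [Abelian A] {X Y : A} (e : X ≅ Y) :
    AbK0.of X = AbK0.of Y := by
  have h0 : AbK0.of (0 : A) = 0 := by
    have h := AbK0.of_shortExact (ShortComplex.mk (0 : (0 : A) ⟶ 0) (0 : (0 : A) ⟶ 0) (by simp))
      { exact := ShortComplex.exact_of_isZero_X₂ _ (isZero_zero A)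
        mono_f := ⟨fun _ _ _ => (isZero_zero A).eq_of_tgt _ _⟩
        epi_g := ⟨fun _ _ _ => (isZero_zero A).eq_of_src _ _⟩ }
    simpa using h
  have h := AbK0.of_shortExact (ShortComplex.mk e.hom (0 : Y ⟶ 0) (by simp))
    { exact := (ShortComplex.exact_iff_epi _ (by rfl)).2 inferInstance
      mono_f := inferInstance
      epi_g := ⟨fun _ _ _ => (isZero_zero A).eq_of_src _ _⟩ }
  simpa [h0] using h.symm

section Charge

variable {D : Type*} [Category* D] [Preadditive D] [HasZeroObject D] [HasShift D ℤ]
  [∀ n : ℤ, (shiftFunctor D n).Additive] [Pretriangulated D] [IsTriangulated D]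
  {H : ObjectProperty D} [IsBoundedHeart H] (z : AbK0 H.FullSubcategory →+ ℂ)

theorem heart_of_extension {X Y Z : H.FullSubcategory} (hT : IsExtension X.obj Y.obj Z.obj) :
    AbK0.of Y = AbK0.of X + AbK0.of Z := by
  obtain ⟨f, g, w, h⟩ := IsBoundedHeart.shortExact_of_isExtension H hT
  exact AbK0.of_shortExact _ h

theorem heart_of_iso {X Y : H.FullSubcategory} (e : X.obj ≅ Y.obj) : AbK0.of X = AbK0.of Y :=
  let := IsBoundedHeart.abelian H
  AbK0.of_iso (H.isoMk e)

theorem heart_of_isZero {X : H.FullSubcategory} (h : IsZero X.obj) : AbK0.of X = 0 := by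
  have := heart_of_extension (X := X) (Y := X) (Z := X) (.zero_left h (Iso.refl _))
  simpa using this

/-- The kernel and the cokernel of a morphism of the heart, extracted from its cone. -/
theorem exists_extension_of_cone {A B : H.FullSubcategory} {E : D}
    (hT : IsExtension B.obj E (A.obj⟦(1 : ℤ)⟧)) :
    ∃ K Q : H.FullSubcategory, IsExtension (K.obj⟦(1 : ℤ)⟧) E Q.obj ∧
      AbK0.of B - AbK0.of A = AbK0.of Q - AbK0.of K := by
  let := IsBoundedHeart.abelian H
  obtain ⟨f', v, w, hT⟩ : IsExtension A.obj B.obj E :=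
    hT.invRotate.of_iso (shiftCancelIso A.obj 1 (-1) rfl) (Iso.refl _) (Iso.refl _)
  let f : A ⟶ B := ObjectProperty.homMk f'
  let p : A ⟶ Abelian.image f := Abelian.factorThruImage f
  let i : Abelian.image f ⟶ B := Abelian.image.ι f
  have hpi : p ≫ i = f := Abelian.image.fac f
  have h1 : (ShortComplex.mk (kernel.ι p) p (kernel.condition p)).ShortExact :=
    { exact := ShortComplex.exact_of_f_is_kernel _ (kernelIsKernel p)
      mono_f := inferInstance
      epi_g := inferInstance }
  have h2 : (ShortComplex.mk i (cokernel.π i) (cokernel.condition i)).ShortExact :=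
    { exact := ShortComplex.exact_of_g_is_cokernel _ (cokernelIsCokernel i)
      mono_f := inferInstance
      epi_g := inferInstance }
  have e1 := AbK0.of_shortExact _ h1
  have e2 := AbK0.of_shortExact _ h2
  obtain ⟨δ₁, hT₁⟩ := IsBoundedHeart.exists_distTriang_of_shortExact H _ h1
  obtain ⟨δ₂, hT₂⟩ := IsBoundedHeart.exists_distTriang_of_shortExact H _ h2
  -- Octahedron for `f = p ≫ i`: the cones of `p`, `i` and `f` are `(kernel p)⟦1⟧`, `cokernel i` and
  -- `E`. In `K₀` the class of the image cancels from the difference.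
  have o := Triangulated.someOctahedron (u₁₂ := p.hom) (u₂₃ := i.hom) (u₁₃ := f')
    (congrArg (fun t => t.hom) hpi) (rot_of_distTriang _ hT₁) hT₂ hT
  refine ⟨kernel p, cokernel i, ⟨_, _, _, o.mem⟩, ?_⟩
  dsimp only at e1 e2
  rw [e1, e2]
  abel

/-- `E` is isomorphic to `A⟦m⟧` with `A` in the heart, and `g` is the charge of `A⟦m⟧`. -/
def IsPiece (m : ℤ) (E : D) (g : ℂ) : Prop :=
  ∃ A : H.FullSubcategory, Nonempty (E ≅ A.obj⟦m⟧) ∧ g = (-1) ^ m * z (AbK0.of A)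

namespace IsPiece

variable {z}

theorem shiftedBy {m : ℤ} {E : D} {g : ℂ} (h : IsPiece z m E g) : shiftedBy H m E := by
  obtain ⟨A, e, -⟩ := h
  exact ⟨A.obj, A.property, e⟩

theorem of_iso {m : ℤ} {E E' : D} {g : ℂ} (h : IsPiece z m E g) (e : E ≅ E') :
    IsPiece z m E' g := by
  obtain ⟨A, ⟨i⟩, rfl⟩ := h
  exact ⟨A, ⟨e.symm ≪≫ i⟩, rfl⟩

theorem of_isZero {m : ℤ} {E : D} (h : IsZero E) : IsPiece z m E 0 :=
  ⟨⟨0, H.prop_zero⟩, ⟨h.iso ((isZero_shift_iff _ m).2 (isZero_zero D))⟩, by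
    rw [heart_of_isZero (isZero_zero D)]; simp⟩

theorem unique {m : ℤ} {E : D} {g g' : ℂ} (h : IsPiece z m E g) (h' : IsPiece z m E g') :
    g = g' := by
  obtain ⟨A, ⟨i⟩, rfl⟩ := h
  obtain ⟨A', ⟨i'⟩, rfl⟩ := h'
  rw [heart_of_iso ((shiftFunctor D m).preimageIso (i.symm ≪≫ i'))]

theorem extension {m : ℤ} {E₁ E E₂ : D} {g₁ g₂ : ℂ} (hT : IsExtension E₁ E E₂)
    (h₁ : IsPiece z m E₁ g₁) (h₂ : IsPiece z m E₂ g₂) : IsPiece z m E (g₁ + g₂) := by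
  obtain ⟨A, hA, ⟨e⟩⟩ :=
    (IsBoundedHeart.isPreslicing H).mem_extension hT h₁.shiftedBy h₂.shiftedBy
  obtain ⟨A₁, ⟨i₁⟩, rfl⟩ := h₁
  obtain ⟨A₂, ⟨i₂⟩, rfl⟩ := h₂
  refine ⟨⟨A, hA⟩, ⟨e⟩, ?_⟩
  rw [← mul_add, ← map_add, heart_of_extension (X := A₁) (Y := ⟨A, hA⟩) (Z := A₂)]
  exact ((hT.of_iso i₁ e i₂).shift (-m)).of_iso (shiftCancelIso _ m (-m) (by simp))
    (shiftCancelIso _ m (-m) (by simp)) (shiftCancelIso _ m (-m) (by simp))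

/-- The connecting morphism `E₂ ⟶ E₁⟦1⟧` is, up to shift, a morphism of the heart with cone `E`; its
kernel and cokernel give the filtration of `E` in the right order. The sign change between `m` and
`m + 1` turns the identity of differences in `K₀` into one of sums. -/
theorem exchange {m : ℤ} {E₁ E E₂ : D} {g₁ g₂ : ℂ} (hT : IsExtension E₁ E E₂)
    (h₁ : IsPiece z m E₁ g₁) (h₂ : IsPiece z (m + 1) E₂ g₂) :
    ∃ (K Q : D) (k q : ℂ), IsExtension K E Q ∧ IsPiece z (m + 1) K k ∧ IsPiece z m Q q ∧
      k + q = g₁ + g₂ := by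
  obtain ⟨B, ⟨i₁⟩, rfl⟩ := h₁
  obtain ⟨A, ⟨i₂⟩, rfl⟩ := h₂
  have hT' := (hT.of_iso i₁ (Iso.refl _) i₂).shift (-m)
  obtain ⟨K, Q, hKQ, h⟩ := exists_extension_of_cone (A := A) (B := B)
    (hT'.of_iso (shiftCancelIso _ m (-m) (by simp)) (Iso.refl _)
      (shiftShiftIso _ (m + 1) (-m) 1 (by lia)))
  refine ⟨_, _, _, _, (hKQ.shift m).of_iso (Iso.refl _) (shiftCancelIso _ (-m) m (by simp))
    (Iso.refl _), ⟨K, ⟨shiftShiftIso _ 1 m (m + 1) (by lia)⟩, rfl⟩, ⟨Q, ⟨Iso.refl _⟩, rfl⟩, ?_⟩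
  have h' := congrArg z h
  rw [map_sub, map_sub] at h'
  rw [zpow_add₀ (by norm_num), zpow_one]
  linear_combination -(-1) ^ m * h'

end IsPiece

/-- `X` has a filtration with successive quotients in `H⟦n⟧`, for `n` decreasing to `m` in unit
steps, and the sum of the charges of the quotients is `g`. -/
inductive HasCharge : ℤ → D → ℂ → Prop
  | zero {m : ℤ} {X : D} : IsZero X → HasCharge m X 0
  | step {m : ℤ} {X' X E : D} {g e : ℂ} :
      HasCharge (m + 1) X' g → IsExtension X' X E → IsPiece z m E e → HasCharge m X (g + e)

namespace HasCharge

variable {z}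

theorem of_iso {m : ℤ} {X Y : D} {g : ℂ} (h : HasCharge z m X g) (e : X ≅ Y) :
    HasCharge z m Y g := by
  cases h with
  | zero h => exact .zero (h.of_iso e.symm)
  | step h hT hE => exact .step h (hT.congr_mid e) hE

theorem homZero {m : ℤ} {X : D} {g : ℂ} (h : HasCharge z m X g) {Y : D} {j : ℤ} (hj : j < m)
    (hY : shiftedBy H j Y) : HomZero X Y := by
  induction h with
  | zero h => exact homZero_of_isZero_left h
  | step h hT hE ih =>
    exact hT.homZero_mid_left (ih (by lia)) (IsBoundedHeart.homZero H hj hE.shiftedBy hY)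

theorem homZero_shift {m : ℤ} {X : D} {g : ℂ} (h : HasCharge z m X g) {Y : D} {j : ℤ}
    (hj : j ≤ m) (hY : shiftedBy H j Y) : HomZero (X⟦(1 : ℤ)⟧) Y := by
  have := h.homZero (j := j - 1) (by lia) (shiftedBy_shift hY (-1) (j - 1) rfl)
  exact (this.shift 1).of_iso (Iso.refl _) (shiftCancelIso Y (-1) 1 (by simp)).symm

theorem pred {m : ℤ} {X : D} {g : ℂ} (h : HasCharge z (m + 1) X g) : HasCharge z m X g := by
  have := HasCharge.step h (.zero_right (isZero_zero D) (Iso.refl X))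
    (IsPiece.of_isZero (isZero_zero D))
  rwa [add_zero] at this

theorem mono {m n : ℤ} (hmn : n ≤ m) {X : D} {g : ℂ} (h : HasCharge z m X g) :
    HasCharge z n X g := by
  induction n, hmn using Int.leInductionDown with
  | base => exact h
  | pred n _ ih =>
    apply pred
    rwa [sub_add_cancel]

theorem of_isPiece {m : ℤ} {X : D} {g : ℂ} (h : IsPiece z m X g) : HasCharge z m X g := by
  have := HasCharge.step (.zero (isZero_zero D)) (.zero_left (isZero_zero D) (Iso.refl X)) h
  rwa [zero_add] at this

/-- A filtration of a zero object may have several steps, but orthogonality forces each quotient to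
vanish. -/
theorem eq_zero {m : ℤ} {X : D} {g : ℂ} (h : HasCharge z m X g) (hX : IsZero X) : g = 0 := by
  induction h with
  | zero _ => rfl
  | step h hT hE ih =>
    have h0 := hT.isZero_right (homZero_of_isZero_left hX) (h.homZero_shift (by lia) hE.shiftedBy)
    obtain ⟨e⟩ := hT.iso_of_right h0
    rw [ih (hX.of_iso e), hE.unique (IsPiece.of_isZero h0), add_zero]

/-- Truncation triangles are unique: `X'` and `X'⟦1⟧` have no morphisms to a piece in `H⟦m⟧`, so
both top quotients have the same universal property under `X`. Comparing cones then identifies the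
lower steps, and induction applies. -/
theorem unique_aux {m : ℤ} {X : D} {g g' : ℂ} (h : HasCharge z m X g) (h' : HasCharge z m X g') :
    g = g' := by
  induction h generalizing g' with
  | zero h => exact (h'.eq_zero h).symm
  | @step m X' X E g e h hT hE ih =>
    cases h' with
    | zero h' => exact (HasCharge.step h hT hE).eq_zero h'
    | @step _ X'' _ E' g' e' h' hT' hE' =>
      obtain ⟨a, b, c, hT⟩ := hT
      obtain ⟨a', b', c', hT'⟩ := hT'
      have h0 : HomZero X' E' := h.homZero (by lia) hE'.shiftedBy
      have h0' : HomZero X'' E := h'.homZero (by lia) hE.shiftedBy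
      have h1 : HomZero (X'⟦(1 : ℤ)⟧) E := h.homZero_shift (by lia) hE.shiftedBy
      have h1' : HomZero (X''⟦(1 : ℤ)⟧) E' := h'.homZero_shift (by lia) hE'.shiftedBy
      obtain ⟨u, hu⟩ : ∃ u : E ⟶ E', b' = b ≫ u := Triangle.yoneda_exact₂ _ hT b' (h0 _)
      obtain ⟨v, hv⟩ : ∃ v : E' ⟶ E, b = b' ≫ v := Triangle.yoneda_exact₂ _ hT' b (h0' _)
      -- An endomorphism of the quotient is determined by its restriction to the middle term, since
      -- the difference of two choices factors through `A⟦1⟧`.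
      have key : ∀ {A B C : D} (a : A ⟶ B) (b : B ⟶ C) (c : C ⟶ A⟦(1 : ℤ)⟧)
          (_ : Triangle.mk a b c ∈ distTriang D) (_ : HomZero (A⟦(1 : ℤ)⟧) C) (w : C ⟶ C),
          b ≫ w = b → w = 𝟙 C := by
        intro A B C a b c hT h w hw
        obtain ⟨t, ht⟩ : ∃ t : A⟦(1 : ℤ)⟧ ⟶ C, w - 𝟙 C = c ≫ t :=
          Triangle.yoneda_exact₃ _ hT (w - 𝟙 C) (show b ≫ (w - 𝟙 C) = 0 by simp [hw])
        rw [h t, comp_zero, sub_eq_zero] at ht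
        exact ht
      let eE : E ≅ E' :=
        { hom := u
          inv := v
          hom_inv_id := key a b c hT h1 _ (by rw [← Category.assoc, ← hu, ← hv])
          inv_hom_id := key a' b' c' hT' h1' _ (by rw [← Category.assoc, ← hv, ← hu]) }
      have eX : X' ≅ X'' := by
        have hE1 : Triangle.mk a (b ≫ eE.hom) (eE.inv ≫ c) ∈ distTriang D := by
          refine isomorphic_distinguished _ hT _ ?_
          exact Triangle.isoMk _ _ (Iso.refl _) (Iso.refl _) eE.symm
            ((Category.comp_id _).trans (Category.id_comp _).symm)
            (show (b ≫ eE.hom) ≫ eE.inv = 𝟙 _ ≫ b by simp)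
            (show (eE.inv ≫ c) ≫ (𝟙 X')⟦(1 : ℤ)⟧' = eE.inv ≫ c by simp)
        have hu' : b ≫ eE.hom = b' := hu.symm
        rw [hu'] at hE1
        have t := isoTriangleOfIso₁₂ _ _ (rot_of_distTriang _ hE1) (rot_of_distTriang _ hT')
          (Iso.refl _) (Iso.refl _) ((Category.comp_id _).trans (Category.id_comp _).symm)
        exact (shiftFunctor D (1 : ℤ)).preimageIso (Triangle.π₃.mapIso t)
      rw [ih (h'.of_iso eX.symm), (hE.of_iso eE).unique hE']

theorem unique {m m' : ℤ} {X : D} {g g' : ℂ} (h : HasCharge z m X g) (h' : HasCharge z m' X g') :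
    g = g' :=
  (h.mono (min_le_left m m')).unique_aux (h'.mono (min_le_right m m'))

/-- One step of insertion sort: the new top piece `E`, in `H⟦n⟧`, is moved below the current last
piece `B`, in `H⟦m⟧`, whenever `m < n`. -/
theorem insert {m n : ℤ} (hmn : m ≤ n) {X Y E : D} {g e : ℂ} (h : HasCharge z m X g)
    (hT : IsExtension X Y E) (hE : IsPiece z n E e) : HasCharge z m Y (g + e) := by
  induction h generalizing n Y E e with
  | zero h =>
    obtain ⟨i⟩ := hT.iso_of_left h
    rw [zero_add]
    exact ((of_isPiece hE).mono hmn).of_iso i.symm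
  | @step m X' X B g b h hT' hB ih =>
    obtain ⟨W, h₁, h₂⟩ := hT'.assoc_right hT
    rcases hmn.eq_or_lt with rfl | hmn
    -- Same shift: the two pieces are merged.
    · rw [add_assoc]
      exact .step h h₁ (IsPiece.extension h₂ hB hE)
    · rcases (show m + 1 ≤ n from hmn).eq_or_lt with rfl | hmn'
      -- Adjacent shifts: `E` and `B` may be linked by a morphism of the heart, so its kernel is
      -- inserted further down and its cokernel becomes the last piece.
      · obtain ⟨K, Q, k, q, hKQ, hK, hQ, hkq⟩ := IsPiece.exchange h₂ hB hE
        obtain ⟨Y', h₃, h₄⟩ := h₁.assoc_left hKQ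
        rw [add_assoc, ← hkq, ← add_assoc]
        exact .step (ih le_rfl h₃ hK) h₄ hQ
      -- Shifts at least two apart: there is no morphism `E ⟶ B⟦1⟧`, so the extension splits and the
      -- pieces commute.
      · have h₂' := h₂.swap (IsBoundedHeart.homZero H hmn' hE.shiftedBy
          (shiftedBy_shift hB.shiftedBy 1 (m + 1) rfl))
        obtain ⟨Y', h₃, h₄⟩ := h₁.assoc_left h₂'
        rw [add_assoc, add_comm b e, ← add_assoc]
        exact .step (ih hmn'.le h₃ hE) h₄ hB

/-- The pieces of `Z` are inserted one at a time above `X`. Lowering the bound to the minimum keeps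
each inserted shift admissible. -/
theorem extension {m n : ℤ} {X Y Z : D} {g h : ℂ} (hX : HasCharge z m X g)
    (hZ : HasCharge z n Z h) (hT : IsExtension X Y Z) : ∃ l, HasCharge z l Y (g + h) := by
  induction hZ generalizing Y with
  | zero h =>
    obtain ⟨e⟩ := hT.iso_of_right h
    exact ⟨m, by rw [add_zero]; exact hX.of_iso e⟩
  | @step n _ _ _ _ _ h hT' hE ih =>
    obtain ⟨Y', h₁, h₂⟩ := hT.assoc_left hT'
    obtain ⟨l, hl⟩ := ih h₁
    refine ⟨min l n, ?_⟩
    rw [← add_assoc]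
    exact insert (min_le_right _ _) (hl.mono (min_le_left _ _)) h₂ hE

variable (z) in
theorem exists_of_triTower {l : List ℤ} {X : D} (h : TriTower (shiftedBy H) l X) :
    ∃ m g, HasCharge z m X g := by
  induction h with
  | nil h => exact ⟨0, 0, .zero h⟩
  | cons h hT hE ih =>
    obtain ⟨m, g, hg⟩ := ih
    obtain ⟨A, hA, e⟩ := hE
    obtain ⟨l, hl⟩ := hg.extension (of_isPiece ⟨⟨A, hA⟩, e, rfl⟩) hT
    exact ⟨l, _, hl⟩

variable (z) in
theorem exists_hasCharge (X : D) : ∃ g m, HasCharge z m X g := by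
  obtain ⟨l, -, -, h⟩ := hasTower_iff.1 (IsBoundedHeart.tower (H := H) X)
  obtain ⟨m, g, h⟩ := exists_of_triTower z h
  exact ⟨g, m, h⟩

end HasCharge

/-- The extension to `K₀(D)` of a homomorphism defined on `K₀(H)`, for the heart `H` of a bounded
t-structure. -/
noncomputable def chargeOfHeart : TriK0 D →+ ℂ :=
  TriK0.lift (fun X => (HasCharge.exists_hasCharge z X).choose) fun T hT => by
    obtain ⟨m₁, h₁⟩ := (HasCharge.exists_hasCharge z T.obj₁).choose_spec
    obtain ⟨m₂, h₂⟩ := (HasCharge.exists_hasCharge z T.obj₂).choose_spec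
    obtain ⟨m₃, h₃⟩ := (HasCharge.exists_hasCharge z T.obj₃).choose_spec
    obtain ⟨l, h⟩ := h₁.extension h₃ ⟨_, _, _, hT⟩
    exact h₂.unique h

theorem chargeOfHeart_of (E : H.FullSubcategory) :
    chargeOfHeart z (TriK0.of E.obj) = z (AbK0.of E) := by
  obtain ⟨m, h⟩ := (HasCharge.exists_hasCharge z E.obj).choose_spec
  have h' : HasCharge z 0 E.obj (z (AbK0.of E)) :=
    .of_isPiece ⟨E, ⟨(shiftZeroIso E.obj).symm⟩, by simp⟩
  rw [chargeOfHeart, TriK0.lift_of]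
  exact h.unique h'

end Charge

/-! ### Classes of shifts, and generation of the Grothendieck group by a heart. -/

section K0

variable {D : Type*} [Category* D] [Preadditive D] [HasZeroObject D] [HasShift D ℤ]
  [∀ n : ℤ, (shiftFunctor D n).Additive] [Pretriangulated D]

theorem TriK0.of_isExtension {X Y Z : D} (h : IsExtension X Y Z) :
    TriK0.of Y = TriK0.of X + TriK0.of Z := by
  obtain ⟨f, g, h, hT⟩ := h
  exact TriK0.of_distTriang _ hT

theorem TriK0.of_isZero {X : D} (h : IsZero X) : TriK0.of X = 0 := by
  rw [TriK0.of_iso (h.iso (isZero_zero D)), TriK0.of_zero]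

theorem TriK0.of_shift_one (X : D) : TriK0.of (X⟦(1 : ℤ)⟧) = -TriK0.of X := by
  have h := TriK0.of_isExtension (IsExtension.zero_right (isZero_zero D) (Iso.refl X)).rotate
  rw [TriK0.of_zero] at h
  exact (neg_eq_of_add_eq_zero_right h.symm).symm

theorem TriK0.of_shift (X : D) (n : ℤ) : TriK0.of (X⟦n⟧) = n.negOnePow • TriK0.of X := by
  induction n using Int.induction_on with
  | zero => rw [TriK0.of_iso (shiftZeroIso X), Int.negOnePow_zero, one_smul]
  | succ n ih =>
    rw [TriK0.of_iso (shiftShiftIso X n 1 (n + 1) rfl).symm, TriK0.of_shift_one, ih,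
      Int.negOnePow_succ, Units.neg_smul]
  | pred n ih =>
    have h := TriK0.of_shift_one (X⟦(-(n : ℤ) - 1)⟧)
    rw [TriK0.of_iso (shiftShiftIso X (-n - 1) 1 (-n) (by lia)), ih] at h
    rw [Int.negOnePow_sub, Int.negOnePow_one, mul_neg, mul_one, Units.neg_smul, h, neg_neg]

theorem TriK0.map_of_shift (f : TriK0 D →+ ℂ) (X : D) (n : ℤ) :
    f (TriK0.of (X⟦n⟧)) = (-1) ^ n * f (TriK0.of X) := by
  rw [TriK0.of_shift]
  rcases Int.even_or_odd n with h | h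
  · rw [Int.negOnePow_even n h, one_smul, h.neg_one_zpow, one_mul]
  · rw [Int.negOnePow_odd n h, Units.neg_smul, one_smul, map_neg, h.neg_one_zpow, neg_one_mul]

/-- Homomorphisms out of `K₀(D)` that agree on the heart of a bounded t-structure are equal. -/
theorem TriK0.hom_ext_of_heart (H : ObjectProperty D) [IsBoundedHeart H] {f g : TriK0 D →+ ℂ}
    (h : ∀ E, H E → f (TriK0.of E) = g (TriK0.of E)) : f = g := by
  apply TriK0.hom_ext
  intro X
  obtain ⟨l, -, -, hX⟩ := hasTower_iff.1 (IsBoundedHeart.tower (H := H) X)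
  induction hX with
  | nil h => rw [TriK0.of_isZero h, map_zero, map_zero]
  | cons _ hT hE ih =>
    obtain ⟨A, hA, ⟨e⟩⟩ := hE
    rw [TriK0.of_isExtension hT, map_add, map_add, ih, TriK0.of_iso e, map_of_shift,
      map_of_shift, h A hA]

end K0

/-! ### Phases of complex numbers -/

section Phases

/-- The union of the strict upper half plane and the negative real axis. -/
def InHalfPlane (w : ℂ) : Prop := 0 < w.im ∨ (w.im = 0 ∧ w.re < 0)

/-- The additive function `w ↦ Im (w e^{-iπφ})`, whose sign compares the phase of `w` with `φ`. -/
noncomputable def imRotate (φ : ℝ) : ℂ →+ ℝ :=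
  Complex.imAddGroupHom.comp (AddMonoidHom.mulRight (Complex.exp (-(Complex.I * Real.pi * φ))))

theorem imRotate_eq (φ : ℝ) (w : ℂ) :
    imRotate φ w = ‖w‖ * Real.sin (Complex.arg w - Real.pi * φ) := by
  have h : w * Complex.exp (-(Complex.I * Real.pi * φ)) =
      (‖w‖ : ℂ) * Complex.exp ((Complex.arg w - Real.pi * φ : ℝ) * Complex.I) := by
    conv_lhs => rw [← Complex.norm_mul_exp_arg_mul_I w]
    rw [mul_assoc, ← Complex.exp_add]
    congr 2
    push_cast
    ring
  change (w * _).im = _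
  rw [h, Complex.im_ofReal_mul, Complex.exp_ofReal_mul_I_im]

namespace InHalfPlane

theorem ne_zero {w : ℂ} (h : InHalfPlane w) : w ≠ 0 := by
  rintro rfl
  simp [InHalfPlane] at h

theorem arg_pos {w : ℂ} (h : InHalfPlane w) : 0 < Complex.arg w := by
  have h0 : 0 ≤ Complex.arg w := by
    rw [Complex.arg_nonneg_iff]
    rcases h with h | h
    exacts [h.le, h.1.ge]
  refine h0.lt_of_ne fun h' => ?_
  obtain ⟨h1, h2⟩ := Complex.arg_eq_zero_iff.1 h'.symm
  rcases h with h | h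
  · exact h.ne' h2
  · exact absurd h.2 (not_lt.2 h1)

theorem phase_mem {w : ℂ} (h : InHalfPlane w) : Complex.arg w / Real.pi ∈ Set.Ioc (0 : ℝ) 1 :=
  ⟨div_pos h.arg_pos Real.pi_pos, (div_le_one Real.pi_pos).2 (Complex.arg_le_pi w)⟩

/-- Both angles lie in `(0, π]`, so their difference lies strictly between `-π` and `π`, where the
sine has the sign of its argument. Phase comparisons thereby become additive inequalities. -/
theorem imRotate_neg_iff {w : ℂ} (h : InHalfPlane w) {φ : ℝ} (hφ : φ ∈ Set.Ioc (0 : ℝ) 1) :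
    imRotate φ w < 0 ↔ Complex.arg w / Real.pi < φ := by
  have hn : 0 < ‖w‖ := norm_pos_iff.2 h.ne_zero
  have hp := Real.pi_pos
  have h1 := h.arg_pos
  have h2 := Complex.arg_le_pi w
  have h3 : 0 < Real.pi * φ := mul_pos hp hφ.1
  have h4 : Real.pi * φ ≤ Real.pi := by nlinarith [hφ.2]
  rw [imRotate_eq, div_lt_iff₀ hp]
  constructor
  · intro h
    by_contra! h'
    have := Real.sin_nonneg_of_nonneg_of_le_pi (x := Complex.arg w - Real.pi * φ)
      (by linarith) (by linarith)
    exact absurd h (not_lt.2 (mul_nonneg hn.le this))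
  · intro h
    exact mul_neg_of_pos_of_neg hn (Real.sin_neg_of_neg_of_neg_pi_lt (by linarith) (by linarith))

theorem imRotate_pos_iff {w : ℂ} (h : InHalfPlane w) {φ : ℝ} (hφ : φ ∈ Set.Ioc (0 : ℝ) 1) :
    0 < imRotate φ w ↔ φ < Complex.arg w / Real.pi := by
  have hn : 0 < ‖w‖ := norm_pos_iff.2 h.ne_zero
  have hp := Real.pi_pos
  have h1 := h.arg_pos
  have h2 := Complex.arg_le_pi w
  have h3 : 0 < Real.pi * φ := mul_pos hp hφ.1
  have h4 : Real.pi * φ ≤ Real.pi := by nlinarith [hφ.2]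
  rw [imRotate_eq, lt_div_iff₀ hp]
  constructor
  · intro h
    by_contra! h'
    have := Real.sin_nonpos_of_nonpos_of_neg_pi_le (x := Complex.arg w - Real.pi * φ)
      (by linarith) (by linarith)
    exact absurd h (not_lt.2 (mul_nonpos_of_nonneg_of_nonpos hn.le this))
  · intro h
    exact mul_pos hn (Real.sin_pos_of_pos_of_lt_pi (by linarith) (by linarith))

/-- Applied to an equivariant charge, this yields the positivity of those Frobenius–Perron
dimensions that matter, with no appeal to Perron–Frobenius theory. -/
theorem pos_of_mul {w : ℂ} (h : InHalfPlane w) {r : ℝ} (hr : InHalfPlane (r * w)) : 0 < r := by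
  by_contra! h'
  simp only [InHalfPlane, Complex.im_ofReal_mul, Complex.re_ofReal_mul] at h hr
  rcases h with h | h <;> rcases hr with hr | hr
  · nlinarith
  · rcases mul_eq_zero.1 hr.1 with h0 | h0
    · simp [h0] at hr
    · exact h.ne' h0
  · simp [h.1] at hr
  · nlinarith

end InHalfPlane

theorem mul_exp_eq (m φ : ℝ) :
    (m : ℂ) * Complex.exp (Complex.I * Real.pi * φ) =
      m * (Complex.cos ((Real.pi * φ : ℝ) : ℂ) + Complex.sin ((Real.pi * φ : ℝ) : ℂ) *
        Complex.I) := by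
  rw [← Complex.exp_mul_I]
  congr 2
  push_cast
  ring

theorem arg_mul_exp {m φ : ℝ} (hm : 0 < m) (hφ : φ ∈ Set.Ioc (0 : ℝ) 1) :
    Complex.arg (m * Complex.exp (Complex.I * Real.pi * φ)) / Real.pi = φ := by
  have hp := Real.pi_pos
  rw [mul_exp_eq, Complex.arg_mul_cos_add_sin_mul_I hm
    ⟨by nlinarith [hφ.1], by nlinarith [hφ.2]⟩]
  field_simp

theorem inHalfPlane_mul_exp {m φ : ℝ} (hm : 0 < m) (hφ : φ ∈ Set.Ioc (0 : ℝ) 1) :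
    InHalfPlane (m * Complex.exp (Complex.I * Real.pi * φ)) := by
  have hp := Real.pi_pos
  rw [mul_exp_eq, ← Complex.ofReal_cos, ← Complex.ofReal_sin]
  rcases hφ.2.lt_or_eq with h | rfl
  · left
    have h1 := mul_pos hm (Real.sin_pos_of_pos_of_lt_pi (mul_pos hp hφ.1) (by nlinarith))
    rw [Complex.im_ofReal_mul, Complex.add_im, Complex.ofReal_im, Complex.im_ofReal_mul,
      Complex.I_im]
    linarith
  · right
    rw [mul_one, Complex.im_ofReal_mul, Complex.re_ofReal_mul, Complex.add_im, Complex.add_re,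
      Complex.ofReal_im, Complex.ofReal_re, Complex.im_ofReal_mul, Complex.re_ofReal_mul,
      Complex.I_im, Complex.I_re, Real.sin_pi, Real.cos_pi]
    constructor <;> linarith

theorem InHalfPlane.exists_eq {w : ℂ} (h : InHalfPlane w) :
    ∃ m : ℝ, 0 < m ∧
      w = m * Complex.exp (Complex.I * Real.pi * ((Complex.arg w / Real.pi : ℝ) : ℂ)) := by
  refine ⟨‖w‖, norm_pos_iff.2 h.ne_zero, ?_⟩
  conv_lhs => rw [← Complex.norm_mul_exp_arg_mul_I w]
  congr 2
  have : (Real.pi : ℂ) ≠ 0 := by exact_mod_cast Real.pi_ne_zero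
  push_cast
  field_simp

end Phases

/-! ### Semistable objects of an abelian category -/

/-- There is a short exact sequence `0 ⟶ X ⟶ Y ⟶ Z ⟶ 0`. -/
def IsSES {A : Type*} [Category* A] [HasZeroMorphisms A] (X Y Z : A) : Prop :=
  ∃ (f : X ⟶ Y) (g : Y ⟶ Z) (w : f ≫ g = 0), (ShortComplex.mk f g w).ShortExact

theorem IsSES.congr_mid {A : Type*} [Category* A] [HasZeroMorphisms A] {X Y Z Y' : A}
    (h : IsSES X Y Z) (e : Y ≅ Y') : IsSES X Y' Z := by
  obtain ⟨f, g, w, h⟩ := h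
  exact ⟨f ≫ e.hom, e.inv ≫ g, by simpa using w, ShortComplex.shortExact_of_iso
    (ShortComplex.isoMk (S₁ := ShortComplex.mk f g w) (Iso.refl X) e (Iso.refl Z)
      (Category.id_comp _) (by simp)) h⟩

namespace StabilityFunction

section HN

variable {A : Type*} [Category* A] [Preadditive A] (Z : StabilityFunction A)

/-- Harder--Narasimhan filtrations. -/
abbrev HNTower (l : List ℝ) (X : A) : Prop :=
  ListTower IsZero IsSES (fun φ E => Z.Semistable E ∧ Z.phase E = φ) l X

theorem hasHN_iff : Z.HasHN ↔ ∀ X : A, ∃ l : List ℝ, l.Pairwise (· < ·) ∧ Z.HNTower l X := by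
  refine forall_congr' fun X => ?_
  constructor
  · rintro ⟨n, F, E, h0, ⟨e⟩, hE, hφ, hF⟩
    obtain ⟨l, hl, -, h⟩ := ListTower.of_fin (N := IsZero) (R := IsSES)
      (Q := fun φ E => Z.Semistable E ∧ Z.phase E = φ) n F E (fun i => Z.phase (E i)) h0 hφ
      (fun i => ⟨hE i, rfl⟩) hF
    exact ⟨l, hl, h.congr (fun X Y => Nonempty (X ≅ Y)) (fun _ _ ⟨e⟩ h => h.of_iso e.symm)
      (fun _ _ _ _ ⟨e⟩ h => h.congr_mid e) ⟨e⟩⟩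
  · rintro ⟨l, hl, h⟩
    obtain ⟨n, F, E, t, h0, hlast, ht, -, hE, hF⟩ := h.to_fin hl
    refine ⟨n, F, E, h0, ⟨eqToIso hlast⟩, fun i => (hE i).1, ?_, hF⟩
    have : (fun i => Z.phase (E i)) = t := funext fun i => (hE i).2
    rwa [this]

end HN

variable {A : Type*} [Category* A] [Abelian A] (Z : StabilityFunction A)

theorem hom_of_isZero {X : A} (h : IsZero X) : Z.hom (AbK0.of X) = 0 := by
  have := AbK0.of_shortExact (ShortComplex.mk (𝟙 X) (0 : X ⟶ X) (by simp))
    { exact := ShortComplex.exact_of_isZero_X₂ _ h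
      mono_f := ⟨fun _ _ _ => h.eq_of_tgt _ _⟩
      epi_g := ⟨fun _ _ _ => h.eq_of_src _ _⟩ }
  have h0 : AbK0.of X = 0 := by simpa using this
  rw [h0, map_zero]

variable {Z} in
theorem hom_of_isSES {X Y W : A} (h : IsSES X Y W) :
    Z.hom (AbK0.of Y) = Z.hom (AbK0.of X) + Z.hom (AbK0.of W) := by
  obtain ⟨f, g, w, h⟩ := h
  rw [← map_add]
  exact congrArg Z.hom (AbK0.of_shortExact _ h)

theorem phase_mem {X : A} (h : ¬ IsZero X) : Z.phase X ∈ Set.Ioc (0 : ℝ) 1 :=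
  InHalfPlane.phase_mem (Z.mem_halfPlane X h)

/-- The function `Im (Z(X) e^{-iπφ})`, whose sign compares the phase of `X` with `φ`. -/
noncomputable def imAt (φ : ℝ) (X : A) : ℝ := imRotate φ (Z.hom (AbK0.of X))

variable {Z}

theorem imAt_neg_iff {X : A} (h : ¬ IsZero X) {φ : ℝ} (hφ : φ ∈ Set.Ioc (0 : ℝ) 1) :
    Z.imAt φ X < 0 ↔ Z.phase X < φ :=
  InHalfPlane.imRotate_neg_iff (Z.mem_halfPlane X h) hφ

theorem imAt_pos_iff {X : A} (h : ¬ IsZero X) {φ : ℝ} (hφ : φ ∈ Set.Ioc (0 : ℝ) 1) :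
    0 < Z.imAt φ X ↔ φ < Z.phase X :=
  InHalfPlane.imRotate_pos_iff (Z.mem_halfPlane X h) hφ

theorem imAt_of_isZero {X : A} (h : IsZero X) (φ : ℝ) : Z.imAt φ X = 0 := by
  rw [imAt, Z.hom_of_isZero h, map_zero]

theorem imAt_of_isSES {X Y W : A} (h : IsSES X Y W) (φ : ℝ) :
    Z.imAt φ Y = Z.imAt φ X + Z.imAt φ W := by
  rw [imAt, hom_of_isSES h, map_add]; rfl

theorem imAt_nonpos {X : A} {φ : ℝ} (hφ : φ ∈ Set.Ioc (0 : ℝ) 1)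
    (h : ¬ IsZero X → Z.phase X ≤ φ) : Z.imAt φ X ≤ 0 := by
  by_cases hX : IsZero X
  · rw [imAt_of_isZero hX]
  · exact not_lt.1 fun h' => not_lt.2 (h hX) ((imAt_pos_iff hX hφ).1 h')

theorem imAt_phase {X : A} (h : ¬ IsZero X) : Z.imAt (Z.phase X) X = 0 :=
  le_antisymm (not_lt.1 fun h' => lt_irrefl _ ((imAt_pos_iff h (Z.phase_mem h)).1 h'))
    (not_lt.1 fun h' => lt_irrefl _ ((imAt_neg_iff h (Z.phase_mem h)).1 h'))

theorem isSES_image {X Y : A} (f : X ⟶ Y) : IsSES (kernel f) X (Abelian.image f) := by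
  refine ⟨kernel.ι f, Abelian.factorThruImage f, ?_, ?_⟩
  · rw [← cancel_mono (Abelian.image.ι f), Category.assoc, Abelian.image.fac,
      kernel.condition, zero_comp]
  · have h : (ShortComplex.mk (kernel.ι (Abelian.factorThruImage f)) (Abelian.factorThruImage f)
        (kernel.condition _)).ShortExact :=
      { exact := ShortComplex.exact_of_f_is_kernel _ (kernelIsKernel _)
        mono_f := inferInstance
        epi_g := inferInstance }
    have hk : IsLimit (KernelFork.ofι (kernel.ι f) (show kernel.ι f ≫
        Abelian.factorThruImage f = 0 by
          rw [← cancel_mono (Abelian.image.ι f), Category.assoc, Abelian.image.fac,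
            kernel.condition, zero_comp])) :=
      KernelFork.IsLimit.ofι' _ _ fun k hk => ⟨kernel.lift f k (by
        rw [← Abelian.image.fac f, ← Category.assoc, hk, zero_comp]), by simp⟩
    exact
      { exact := ShortComplex.exact_of_f_is_kernel _ hk
        mono_f := inferInstance
        epi_g := inferInstance }

/-- A nonzero image is a subobject of `Y`, hence of phase below that of `X`, while the kernel has
phase at most that of `X`. Rotated by the phase of `X`, their charges would have negative imaginary
sum, but the charge of `X` gives zero. -/
theorem Semistable.homZero {X Y : A} (hX : Z.Semistable X) (hY : Z.Semistable Y)
    (h : Z.phase Y < Z.phase X) : HomZero X Y := fun f => by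
  have hI : IsZero (Abelian.image f) := by
    by_contra hI
    have h1 : Z.phase (Abelian.image f) ≤ Z.phase Y :=
      hY.2 _ (Abelian.image.ι f) inferInstance hI
    have h2 := imAt_of_isSES (Z := Z) (isSES_image f) (Z.phase X)
    have h3 : Z.imAt (Z.phase X) (kernel f) ≤ 0 :=
      imAt_nonpos (Z.phase_mem hX.1) fun h => hX.2 _ (kernel.ι f) inferInstance h
    have h4 := (imAt_neg_iff hI (Z.phase_mem hX.1)).2 (h1.trans_lt h)
    rw [imAt_phase hX.1] at h2
    linarith
  rw [← Abelian.image.fac f, hI.eq_of_src (Abelian.image.ι f) 0, comp_zero]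

theorem isIso_of_isSES_left {X Y W : A} (h : IsSES X Y W) (hX : IsZero X) :
    Nonempty (W ≅ Y) := by
  obtain ⟨f, g, w, h⟩ := h
  have := h.isIso_g_iff.2 hX
  exact ⟨(asIso g).symm⟩

theorem homZero_of_isSES {X Y W T : A} (h : IsSES X Y W) (hX : HomZero T X) (hW : HomZero T W) :
    HomZero T Y := fun u => by
  obtain ⟨f, g, w, h⟩ := h
  have := h.mono_f
  have hl : h.exact.lift u (hW (u ≫ g)) ≫ f = u := h.exact.lift_f u (hW (u ≫ g))
  rw [← hl, hX (h.exact.lift u (hW (u ≫ g))), zero_comp]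

/-- The bottom step of the filtration is itself the semistable piece of largest phase. -/
theorem HNTower.exists_mono {l : List ℝ} {X : A} (h : Z.HNTower l X) (hl : l.Pairwise (· < ·))
    (hl0 : l ≠ []) :
    ∃ (S : A) (i : S ⟶ X), Mono i ∧ Z.Semistable S ∧ ∀ φ ∈ l, φ ≤ Z.phase S := by
  induction h with
  | nil => exact absurd rfl hl0
  | @cons X' X E φ l h hT hE ih =>
    obtain ⟨hφ, hl⟩ := List.pairwise_cons.1 hl
    by_cases h0 : l = []
    · subst h0
      cases h with
      | nil h =>
        obtain ⟨e⟩ := isIso_of_isSES_left hT h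
        exact ⟨E, e.hom, inferInstance, hE.1, by simp [hE.2]⟩
    · obtain ⟨S, i, hi, hS, hlS⟩ := ih hl h0
      obtain ⟨f, g, w, hT⟩ := hT
      have : Mono f := hT.mono_f
      refine ⟨S, i ≫ f, mono_comp _ _, hS, fun ψ hψ => ?_⟩
      rcases List.mem_cons.1 hψ with rfl | hψ
      · obtain ⟨χ, hχ⟩ := List.exists_mem_of_ne_nil l h0
        exact (hφ χ hχ).le.trans (hlS χ hχ)
      · exact hlS ψ hψ

theorem HNTower.homZero {l : List ℝ} {X : A} (h : Z.HNTower l X) {T : A} (hT : Z.Semistable T)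
    (hl : ∀ φ ∈ l, φ < Z.phase T) : HomZero T X := by
  induction h with
  | nil h => exact homZero_of_isZero_right h
  | cons h hX hE ih =>
    exact homZero_of_isSES hX (ih fun φ hφ => hl φ (List.mem_cons_of_mem _ hφ))
      (hT.homZero hE.1 (hE.2 ▸ hl _ List.mem_cons_self))

theorem HNTower.imAt_nonpos {l : List ℝ} {X : A} (h : Z.HNTower l X) {φ : ℝ}
    (hφ : φ ∈ Set.Ioc (0 : ℝ) 1) (hl : ∀ ψ ∈ l, ψ ≤ φ) : Z.imAt φ X ≤ 0 := by
  induction h with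
  | nil h => rw [imAt_of_isZero h]
  | cons h hX hE ih =>
    rw [imAt_of_isSES hX]
    exact add_nonpos (ih fun ψ hψ => hl ψ (List.mem_cons_of_mem _ hψ))
      (StabilityFunction.imAt_nonpos hφ fun _ => hE.2 ▸ hl _ List.mem_cons_self)

theorem exists_maximal_destabilizing (hZ : Z.HasHN) {X : A} (hX : ¬ IsZero X) :
    ∃ (S : A) (i : S ⟶ X), Mono i ∧ Z.Semistable S ∧
      ∀ T, Z.Semistable T → Z.phase S < Z.phase T → HomZero T X := by
  obtain ⟨l, hl, h⟩ := Z.hasHN_iff.1 hZ X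
  have hl0 : l ≠ [] := by
    rintro rfl
    cases h with
    | nil h => exact hX h
  obtain ⟨S, i, hi, hS, hlS⟩ := h.exists_mono hl hl0
  exact ⟨S, i, hi, hS, fun T hT hST => h.homZero hT fun φ hφ => (hlS φ hφ).trans_lt hST⟩

/-- Only semistable test objects are needed, because a destabilizing subobject contains a
destabilizing semistable one, its own first Harder–Narasimhan piece. -/
theorem semistable_of_homZero (hZ : Z.HasHN) {X : A} (hX : ¬ IsZero X)
    (h : ∀ T, Z.Semistable T → Z.phase X < Z.phase T → HomZero T X) : Z.Semistable X := by
  refine ⟨hX, fun B i hi hB => ?_⟩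
  by_contra! hlt
  obtain ⟨l, hl, hl'⟩ := Z.hasHN_iff.1 hZ B
  have hl0 : l ≠ [] := by
    rintro rfl
    cases hl' with
    | nil h => exact hB h
  obtain ⟨S, j, hj, hS, hlS⟩ := hl'.exists_mono hl hl0
  by_cases hSX : Z.phase X < Z.phase S
  · have : Mono (j ≫ i) := mono_comp _ _
    have h0 : j ≫ i = 0 := h S hS hSX _
    exact hS.1 (IsZero.of_mono_eq_zero _ h0)
  -- If the largest phase in `B` were at most the phase of `X`, then by additivity so would be the
  -- phase of `B` itself.
  · have h1 := hl'.imAt_nonpos (Z.phase_mem hX) fun ψ hψ => (hlS ψ hψ).trans (not_lt.1 hSX)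
    exact absurd ((imAt_pos_iff hB (Z.phase_mem hX)).2 hlt) (not_lt.2 h1)

end StabilityFunction

/-! ### The action of a fusion category preserves semistable objects -/

section Regular

variable {k : Type*} [Field k] {C : Type*} [Category* C] [Abelian C] [Linear k C]
  [MonoidalCategory C] [MonoidalPreadditive C] [MonoidalLinear k C]

attribute [local instance] Abelian.hasFiniteBiproducts

/-- In a fusion category, every object is a direct summand of a multiple of the direct sum of the
simple objects. -/
theorem exists_regular (hC : FusionCategory k C) : ∃ R : C, ∀ c : C, ∃ (n : ℕ) (a : Fin n → (c ⟶ R)) (b : Fin n → (R ⟶ c)),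
    ∑ j, a j ≫ b j = 𝟙 c := by
  classical
  let := irrFintype k C
  refine ⟨⨁ fun s : Irr C => s.rep, fun c => ?_⟩
  obtain ⟨n, S, hS, ⟨e⟩⟩ := hC.semisimple c
  have hs : ∀ j, ∃ s : Irr C, Nonempty (s.rep ≅ S j) := fun j => by
    have hj := hS j
    let q : Quotient (isIsomorphicSetoid C) := Quotient.mk _ (S j)
    obtain ⟨i⟩ : IsIsomorphic q.out (S j) := Quotient.mk_out (s := isIsomorphicSetoid C) (S j)
    have : Simple q.out := Simple.of_iso i
    exact ⟨⟨q, this⟩, ⟨i⟩⟩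
  choose s hs using hs
  let i := fun j => (hs j).some
  refine ⟨n, fun j => e.hom ≫ biproduct.π S j ≫ (i j).inv ≫ biproduct.ι (fun s : Irr C => s.rep) (s j),
    fun j => biproduct.π (fun s : Irr C => s.rep) (s j) ≫ (i j).hom ≫ biproduct.ι S j ≫ e.inv, ?_⟩
  have h : ∀ j, (e.hom ≫ biproduct.π S j ≫ (i j).inv ≫ biproduct.ι (fun s : Irr C => s.rep) (s j)) ≫
      (biproduct.π (fun s : Irr C => s.rep) (s j) ≫ (i j).hom ≫ biproduct.ι S j ≫ e.inv) =
      e.hom ≫ (biproduct.π S j ≫ biproduct.ι S j) ≫ e.inv := fun j => by simp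
  rw [Finset.sum_congr rfl fun j _ => h j, ← Preadditive.comp_sum, ← Preadditive.sum_comp,
    biproduct.total, Category.id_comp, e.hom_inv_id]

end Regular

/-! ### Transferring Hom-vanishing from the regular object to all objects. -/

section ActionHom

variable {C : Type*} [Category* C] [Preadditive C] [MonoidalCategory C]
  {M : Type*} [Category* M] [Preadditive M] [MonoidalLeftAction C M] [ModuleCategory C M]

theorem sum_actionHomLeft {c R : C} {n : ℕ} {a : Fin n → (c ⟶ R)} {b : Fin n → (R ⟶ c)}
    (h : ∑ j, a j ≫ b j = 𝟙 c) (X : M) : ∑ j, (a j ⊵ₗ X) ≫ (b j ⊵ₗ X) = 𝟙 (c ⊙ₗ X) := by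
  have := actionRight_additive C X
  have h' := congrArg (fun t => (MonoidalLeftAction.actionRight C X).map t) h
  simp only [Functor.map_sum, Functor.map_comp] at h'
  exact h'.trans ((MonoidalLeftAction.actionRight C X).map_id c)

variable {R : C} (hR : ∀ c : C, ∃ (n : ℕ) (a : Fin n → (c ⟶ R)) (b : Fin n → (R ⟶ c)),
    ∑ j, a j ≫ b j = 𝟙 c)
include hR

/-- The identity of `c ⊙ₗ X` is a sum of morphisms factoring through `R ⊙ₗ X`. -/
theorem homZero_action_right {T X : M} (h : HomZero T (R ⊙ₗ X)) (c : C) :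
    HomZero T (c ⊙ₗ X) := fun f => by
  obtain ⟨n, a, b, hab⟩ := hR c
  rw [← Category.comp_id f, ← sum_actionHomLeft hab X, Preadditive.comp_sum]
  refine Finset.sum_eq_zero fun j _ => ?_
  rw [← Category.assoc, h (f ≫ a j ⊵ₗ X), zero_comp]

theorem homZero_action_left {X Y : M} (h : HomZero (R ⊙ₗ X) Y) (c : C) :
    HomZero (c ⊙ₗ X) Y := fun f => by
  obtain ⟨n, a, b, hab⟩ := hR c
  rw [← Category.id_comp f, ← sum_actionHomLeft hab X, Preadditive.sum_comp]
  refine Finset.sum_eq_zero fun j _ => ?_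
  rw [Category.assoc, h (b j ⊵ₗ X ≫ f), comp_zero]

theorem isZero_action {X : M} (h : IsZero (R ⊙ₗ X)) (c : C) : IsZero (c ⊙ₗ X) := by
  rw [IsZero.iff_id_eq_zero]
  exact homZero_action_left hR (homZero_of_isZero_left h) c _

end ActionHom

/-! ### Semistability of the objects `c ⊙ₗ E`. -/

section ActionSemistable

variable {k : Type*} [Field k] {C : Type*} [Category* C] [Abelian C] [Linear k C]
  [MonoidalCategory C] [MonoidalPreadditive C] [MonoidalLinear k C] [FusionCategory k C]
  {A : Type*} [Category* A] [Abelian A] [MonoidalLeftAction C A] [ModuleCategory C A]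
  {Z : StabilityFunction A}

/-- The two charges differ by the real factor `FPdim c`, which is positive because both lie in the
half plane. -/
theorem StabilityFunction.IsEquivariant.phase_action (hZ : Z.IsEquivariant k C) {c : C} {X : A}
    (hX : ¬ IsZero X) (hcX : ¬ IsZero (c ⊙ₗ X : A)) : Z.phase (c ⊙ₗ X) = Z.phase X := by
  have h := hZ (AbK0.of c) (AbK0.of X)
  rw [AbK0.act_of] at h
  have h2 : InHalfPlane (Z.hom (AbK0.of (c ⊙ₗ X : A))) := Z.mem_halfPlane _ hcX
  rw [h] at h2
  have h3 := InHalfPlane.pos_of_mul (Z.mem_halfPlane _ hX) h2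
  rw [phase, phase, h, Complex.arg_real_mul _ h3]

/-- The maximal phase in `R ⊙ₗ E` is bounded by the phase of `E` through rigidity; the bound then
passes to `c ⊙ₗ E`, on which the test of `semistable_of_homZero` is run. -/
theorem StabilityFunction.Semistable.action (hHN : Z.HasHN) (hZ : Z.IsEquivariant k C) {E : A}
    (hE : Z.Semistable E) (c : C) (hc : ¬ IsZero (c ⊙ₗ E : A)) : Z.Semistable (c ⊙ₗ E : A) := by
  obtain ⟨R, hR⟩ := exists_regular (k := k) (C := C) inferInstance
  have hRE : ¬ IsZero (R ⊙ₗ E : A) := fun h => hc (isZero_action hR h c)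
  obtain ⟨S, i, hi, hS, hmax⟩ := exists_maximal_destabilizing hHN hRE
  obtain ⟨hr⟩ := FusionCategory.right_dual k R
  let Y := HasRightDual.rightDual R
  -- The unit object is a summand of a multiple of `R`, so `R` annihilates no nonzero object.
  have hRS : ¬ IsZero (R ⊙ₗ S : A) := fun h =>
    hS.1 ((isZero_action hR h (𝟙_ C)).of_iso (λₗ[C] S).symm)
  have hphase := hZ.phase_action hS.1 hRS
  have hRS' : Z.Semistable (R ⊙ₗ S : A) := by
    refine semistable_of_homZero hHN hRS fun T hT hST => ?_
    rw [hphase] at hST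
    -- `R ⊗ R` is again a summand of a multiple of `R`, so the bound for `R ⊙ₗ E` also holds for `R
    -- ⊙ₗ R ⊙ₗ E`, which contains `R ⊙ₗ S` because a right adjoint preserves monomorphisms.
    have h1 : HomZero T ((R ⊗ R) ⊙ₗ E : A) := homZero_action_right hR (hmax T hT hST) _
    have h2 : HomZero T (R ⊙ₗ R ⊙ₗ E : A) := h1.of_iso (Iso.refl _) (αₗ R R E).symm
    have : (MonoidalLeftAction.actionLeft A R).IsRightAdjoint :=
      (actionAdjunction A R Y).isRightAdjoint
    have hm : Mono (R ⊴ₗ i) :=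
      inferInstanceAs (Mono ((MonoidalLeftAction.actionLeft A R).map i))
    intro f
    rw [← cancel_mono (R ⊴ₗ i), h2 (f ≫ R ⊴ₗ i), zero_comp]
  have hle : Z.phase S ≤ Z.phase E := by
    by_contra! hlt
    have h1 : HomZero (R ⊙ₗ S : A) E := hRS'.homZero hE (by rwa [hphase])
    have h2 : HomZero (Y ⊙ₗ S : A) E := homZero_action_left hR h1 Y
    have h3 : i = 0 := by
      -- Under the adjunction, the inclusion `S ⟶ R ⊙ₗ E` corresponds to a morphism `Y ⊙ₗ S ⟶ E`,
      -- which has to vanish.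
      have adj := actionAdjunction A R Y
      apply (adj.homEquiv S E).symm.injective
      exact (h2 _).trans (h2 _).symm
    exact hS.1 (IsZero.of_mono_eq_zero _ h3)
  refine semistable_of_homZero hHN hc fun T hT hTE => ?_
  rw [hZ.phase_action hE.1 hc] at hTE
  exact homZero_action_right hR (hmax T hT (hle.trans_lt hTE)) c

end ActionSemistable

/-! ### From hearts to slicings -/

theorem sub_ceil_mem_Ioc (φ : ℝ) : φ - (⌈φ⌉ - 1 : ℤ) ∈ Set.Ioc (0 : ℝ) 1 := by
  have h1 := Int.le_ceil φ
  have h2 := Int.ceil_lt_add_one φ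
  push_cast
  constructor <;> linarith

theorem int_eq_of_sub_mem_Ioc {φ : ℝ} {m n : ℤ} (hm : φ - m ∈ Set.Ioc (0 : ℝ) 1)
    (hn : φ - n ∈ Set.Ioc (0 : ℝ) 1) : m = n := by
  have h1 : (m : ℝ) < n + 1 := by linarith [hm.1, hn.2]
  have h2 : (n : ℝ) < m + 1 := by linarith [hn.1, hm.2]
  have h1' : m < n + 1 := by exact_mod_cast h1
  have h2' : n < m + 1 := by exact_mod_cast h2
  lia

section SemistableSlice

variable {D : Type*} [Category* D] [Preadditive D] [HasZeroObject D] [HasShift D ℤ]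
  [∀ n : ℤ, (shiftFunctor D n).Additive] [Pretriangulated D]
  {H : ObjectProperty D} {Z : StabilityFunction H.FullSubcategory}

theorem semistableSlice_of_iso {φ : ℝ} {X Y : D} (h : semistableSlice Z φ X) (e : X ≅ Y) :
    semistableSlice Z φ Y := by
  obtain ⟨n, E, hn, hE, ⟨i⟩⟩ := h
  exact ⟨n, E, hn, hE, ⟨e.symm ≪≫ i⟩⟩

theorem semistableSlice_shift {φ : ℝ} {X : D} (h : semistableSlice Z φ X) (a : ℤ) :
    semistableSlice Z (φ + a) (X⟦a⟧) := by
  obtain ⟨n, E, hn, hE, ⟨i⟩⟩ := h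
  have hφ : φ + a - (n + a : ℤ) = φ - n := by push_cast; ring
  exact ⟨n + a, E, by rwa [hφ], by rwa [hφ],
    ⟨(shiftFunctor D a).mapIso i ≪≫ shiftShiftIso _ n a _ rfl⟩⟩

theorem semistableSlice_add_one (φ : ℝ) :
    semistableSlice Z (φ + 1) = shiftedBy (semistableSlice Z φ) 1 := by
  ext X
  constructor
  · intro h
    have h' := semistableSlice_shift h (-1)
    rw [Int.cast_neg, Int.cast_one, add_neg_cancel_right] at h'
    exact ⟨_, h', ⟨(shiftCancelIso X (-1) 1 (by simp)).symm⟩⟩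
  · rintro ⟨Y, hY, ⟨i⟩⟩
    have h := semistableSlice_shift hY 1
    rw [Int.cast_one] at h
    exact semistableSlice_of_iso h i.symm

theorem mem_heart_of_semistableSlice [H.IsClosedUnderIsomorphisms] {φ : ℝ}
    (hφ : φ ∈ Set.Ioc (0 : ℝ) 1) {X : D} (h : semistableSlice Z φ X) : H X := by
  obtain ⟨n, E, hn, -, ⟨i⟩⟩ := h
  obtain rfl : n = 0 := int_eq_of_sub_mem_Ioc hn (by simpa using hφ)
  exact H.prop_of_iso (i ≪≫ shiftZeroIso _).symm E.property

theorem semistableSlice_of_semistable {E : H.FullSubcategory} {φ : ℝ}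
    (hφ : φ ∈ Set.Ioc (0 : ℝ) 1) (hE : Z.Semistable E ∧ Z.phase E = φ) :
    semistableSlice Z φ E.obj :=
  ⟨0, E, by simpa using hφ, Or.inr (by simpa using hE), ⟨(shiftZeroIso _).symm⟩⟩

variable [IsBoundedHeart H]

theorem isZero_of_isZero_heart {E : H.FullSubcategory} (hE : IsZero E) : IsZero E.obj :=
  H.ι.map_isZero hE

theorem isZero_heart_of_isZero {E : H.FullSubcategory} (hE : IsZero E.obj) : IsZero E := by
  rw [IsZero.iff_id_eq_zero]
  exact H.ι.map_injective (hE.eq_of_src _ _)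

theorem semistableSlice_of_isZero (φ : ℝ) {X : D} (h : IsZero X) : semistableSlice Z φ X := by
  let E : H.FullSubcategory := ⟨0, H.prop_zero⟩
  exact ⟨⌈φ⌉ - 1, E, sub_ceil_mem_Ioc φ, Or.inl (isZero_heart_of_isZero (isZero_zero D)),
    ⟨h.iso ((isZero_shift_iff _ _).2 (isZero_zero D))⟩⟩

variable [IsTriangulated D]

theorem semistableSlice_homZero {φ ψ : ℝ} (hφψ : φ < ψ) {X Y : D} (hX : semistableSlice Z ψ X)
    (hY : semistableSlice Z φ Y) : HomZero X Y := by
  let := IsBoundedHeart.abelian H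
  obtain ⟨n, E, hn, hE, ⟨i⟩⟩ := hX
  obtain ⟨m, F, hm, hF, ⟨j⟩⟩ := hY
  rcases lt_or_ge m n with hmn | hmn
  · exact IsBoundedHeart.homZero H hmn ⟨E.obj, E.property, ⟨i⟩⟩ ⟨F.obj, F.property, ⟨j⟩⟩
  -- Here `m < φ < ψ ≤ n + 1`, so both objects lie in the same shift of the heart and semistability
  -- decides.
  · have h1 : (m : ℝ) < n + 1 := by linarith [hm.1, hn.2]
    have h1' : m < n + 1 := by exact_mod_cast h1
    obtain rfl : m = n := by lia
    refine HomZero.of_iso (HomZero.shift ?_ m) i j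
    have h : HomZero E F := by
      rcases hE with hE | hE
      · exact homZero_of_isZero_left hE
      rcases hF with hF | hF
      · exact homZero_of_isZero_right hF
      exact hE.1.homZero hF.1 (by rw [hE.2, hF.2]; linarith)
    intro f
    exact congrArg (fun t => t.hom) (h (ObjectProperty.homMk f))

theorem triTower_of_hnTower {l : List ℝ} {E : H.FullSubcategory} (h : Z.HNTower l E) :
    TriTower (semistableSlice Z) l E.obj := by
  let := IsBoundedHeart.abelian H
  have := h.map (N' := IsZero) (R' := IsExtension) (Q' := semistableSlice Z)
    (fun E : H.FullSubcategory => E.obj) id (fun _ h => isZero_of_isZero_heart h)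
    (fun _ _ _ ⟨_, _, _, h⟩ => IsBoundedHeart.isExtension_of_shortExact H _ h)
    (fun φ _ X (hX : Z.Semistable X ∧ Z.phase X = φ) =>
      semistableSlice_of_semistable (hX.2 ▸ Z.phase_mem hX.1.1) hX)
  simpa using this

theorem phase_mem_of_hnTower {l : List ℝ} {E : H.FullSubcategory} (h : Z.HNTower l E) :
    ∀ φ ∈ l, φ ∈ Set.Ioc (0 : ℝ) 1 := by
  let := IsBoundedHeart.abelian H
  induction h with
  | nil => simp
  | cons h hX hE ih =>
    intro φ hφ
    rcases List.mem_cons.1 hφ with rfl | hφ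
    · exact hE.2 ▸ Z.phase_mem hE.1.1
    · exact ih φ hφ

/-- Each piece in `H⟦n⟧` is refined by a shifted Harder–Narasimhan filtration. Its phases lie in
`(n, n + 1]`, so the blocks for different `n` do not interleave. -/
theorem exists_semistable_triTower (hZ : Z.HasHN) {l : List ℤ} {X : D}
    (h : TriTower (shiftedBy H) l X) (hl : l.Pairwise (· < ·)) :
    ∃ l' : List ℝ, l'.Pairwise (· < ·) ∧
      (∀ φ ∈ l', ∃ n ∈ l, φ - (n : ℤ) ∈ Set.Ioc (0 : ℝ) 1) ∧ TriTower (semistableSlice Z) l' X := by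
  induction h with
  | nil h => exact ⟨[], .nil, by simp, .nil h⟩
  | @cons X' X E n l h hT hE ih =>
    obtain ⟨hn, hl⟩ := List.pairwise_cons.1 hl
    obtain ⟨l', hl', hll', h'⟩ := ih hl
    obtain ⟨A, hA, ⟨i⟩⟩ := hE
    obtain ⟨a, ha, hA'⟩ := Z.hasHN_iff.1 hZ ⟨A, hA⟩
    have haφ := phase_mem_of_hnTower hA'
    have hA'' : TriTower (semistableSlice Z) (a.map (· + (n : ℝ))) (A⟦n⟧) :=
      (triTower_of_hnTower hA').map (fun X : D => X⟦n⟧) (· + (n : ℝ))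
        (fun _ h => (isZero_shift_iff _ n).2 h) (fun _ _ _ h => h.shift n)
        (fun _ _ _ h => semistableSlice_shift h n)
    refine ⟨a.map (· + (n : ℝ)) ++ l', ?_, ?_, h'.concat (hA''.of_iso i.symm) hT⟩
    · refine List.pairwise_append.2 ⟨ha.map _ fun x y h => by linarith, hl', ?_⟩
      intro x hx y hy
      obtain ⟨x', hx', rfl⟩ := List.mem_map.1 hx
      obtain ⟨m, hm, hym⟩ := hll' y hy
      have h1 : (n : ℝ) + 1 ≤ m := by exact_mod_cast hn m hm
      linarith [hym.1, (haφ x' hx').2]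
    · intro φ hφ
      rcases List.mem_append.1 hφ with hφ | hφ
      · obtain ⟨x, hx, rfl⟩ := List.mem_map.1 hφ
        exact ⟨n, List.mem_cons_self, by simpa using haφ x hx⟩
      · obtain ⟨m, hm, h⟩ := hll' φ hφ
        exact ⟨m, List.mem_cons_of_mem _ hm, h⟩

theorem semistableSlice_isPreslicing (hZ : Z.HasHN) : IsPreslicing (semistableSlice Z) where
  of_iso _ _ _ e h := semistableSlice_of_iso h e
  of_isZero φ _ h := semistableSlice_of_isZero φ h
  homZero _ _ hij _ _ hX hY := semistableSlice_homZero hij hX hY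
  homZero_shift i j hij X Y hX hY := by
    have h := semistableSlice_shift hX 1
    exact semistableSlice_homZero (by push_cast; linarith) h hY
  tower X := by
    obtain ⟨l, hl, -, h⟩ := hasTower_iff.1 (IsBoundedHeart.tower (H := H) X)
    obtain ⟨l', hl', -, h'⟩ := exists_semistable_triTower hZ h hl
    exact hasTower_iff.2 ⟨l', hl', by simp, h'⟩

theorem semistableSlice_isSlicing (hZ : Z.HasHN) : IsSlicing (semistableSlice Z) where
  additive φ :=
    have h := semistableSlice_isPreslicing hZ
    isAdditiveSubcategory_of_extension (h.of_iso φ) (h.of_isZero φ)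
      fun _ _ _ => h.mem_extension
  shift := semistableSlice_add_one
  hom_eq_zero _ _ h _ _ hX hY := semistableSlice_homZero h hX hY
  tower := (semistableSlice_isPreslicing hZ).tower

theorem sliceInterval_semistableSlice (hZ : Z.HasHN) :
    sliceInterval (semistableSlice Z) (Set.Ioc 0 1) = H := by
  ext X
  constructor
  · intro h
    obtain ⟨l, -, hl, h'⟩ := hasTower_iff.1 h
    clear h
    induction h' with
    | nil h => exact H.prop_of_isZero h
    | cons h hT hE ih =>
      exact IsBoundedHeart.mem_extension H hT (ih fun i hi => hl i (List.mem_cons_of_mem _ hi))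
        (mem_heart_of_semistableSlice (hl _ List.mem_cons_self) hE)
  · intro h
    obtain ⟨l, hl, hl'⟩ := Z.hasHN_iff.1 hZ ⟨X, h⟩
    exact hasTower_iff.2 ⟨l, hl, phase_mem_of_hnTower hl', triTower_of_hnTower hl'⟩

theorem chargeOfHeart_semistableSlice {φ : ℝ} {X : D} (hX : semistableSlice Z φ X)
    (hX0 : ¬ IsZero X) : ∃ m : ℝ, 0 < m ∧
      chargeOfHeart Z.hom (TriK0.of X) = m * Complex.exp (Complex.I * Real.pi * φ) := by
  let := IsBoundedHeart.abelian H
  obtain ⟨n, E, hn, hE, ⟨i⟩⟩ := hX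
  have hE0 : ¬ IsZero E := fun h =>
    hX0 (((isZero_shift_iff _ n).2 (isZero_of_isZero_heart h)).of_iso i)
  have hE' := hE.resolve_left hE0
  have hmem : InHalfPlane (Z.hom (AbK0.of E)) := Z.mem_halfPlane E hE0
  obtain ⟨m, hm, h⟩ := hmem.exists_eq
  refine ⟨m, hm, ?_⟩
  have hp : Complex.arg (Z.hom (AbK0.of E)) / Real.pi = φ - n := hE'.2
  rw [TriK0.of_iso i, TriK0.map_of_shift, chargeOfHeart_of, h, hp]
  -- The sign `(-1) ^ n` coming from the shift is `exp (nπi)`, which restores the phase `φ` from `φ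
  -- - n`.
  have h1 : Complex.exp (Complex.I * Real.pi * φ) =
      Complex.exp (n * (Real.pi * Complex.I)) *
        Complex.exp (Complex.I * Real.pi * ((φ - n : ℝ) : ℂ)) := by
    rw [← Complex.exp_add]
    congr 1
    push_cast
    ring
  rw [h1, Complex.exp_int_mul, Complex.exp_pi_mul_I]
  ring

end SemistableSlice

/-! ### Exact actions -/

section ExactAction

variable {C : Type*} [Category* C] [Preadditive C] [MonoidalCategory C]
  {D : Type*} [Category* D] [Preadditive D] [HasZeroObject D] [HasShift D ℤ]
  [∀ n : ℤ, (shiftFunctor D n).Additive] [Pretriangulated D]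
  [MonoidalLeftAction C D] [TriangulatedModuleCategory C D]

theorem IsExtension.action {X Y Z : D} (h : IsExtension X Y Z) (c : C) :
    IsExtension (c ⊙ₗ X : D) (c ⊙ₗ Y) (c ⊙ₗ Z) := by
  obtain ⟨_, _⟩ := TriangulatedModuleCategory.exact_action (M := D) c
  obtain ⟨f, g, h, hT⟩ := h
  exact ⟨_, _, _, (MonoidalLeftAction.actionLeft D c).map_distinguished _ hT⟩

theorem nonempty_action_shift_iso (c : C) (X : D) (n : ℤ) :
    Nonempty ((c ⊙ₗ (X⟦n⟧) : D) ≅ (c ⊙ₗ X : D)⟦n⟧) := by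
  obtain ⟨_, _⟩ := TriangulatedModuleCategory.exact_action (M := D) c
  exact ⟨((MonoidalLeftAction.actionLeft D c).commShiftIso n).app X⟩

theorem isZero_action_of_isZero (c : C) {X : D} (h : IsZero X) : IsZero (c ⊙ₗ X : D) :=
  (MonoidalLeftAction.actionLeft D c).map_isZero h

end ExactAction

/-! ### Equivariance of the stability condition attached to a heart. -/

section EquivariantOfHeart

variable {k : Type*} [Field k] {C : Type*} [Category* C] [Abelian C] [Linear k C]
  [MonoidalCategory C] [MonoidalPreadditive C] [MonoidalLinear k C] [FusionCategory k C]
  {D : Type*} [Category* D] [Preadditive D] [HasZeroObject D] [HasShift D ℤ]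
  [∀ n : ℤ, (shiftFunctor D n).Additive] [Pretriangulated D] [IsTriangulated D]
  [MonoidalLeftAction C D] [TriangulatedModuleCategory C D]

theorem semistableSlice_action {H : ObjectProperty D} [IsBoundedHeart H] [IsActionStable C H]
    {Z : StabilityFunction H.FullSubcategory} (hZ : Z.HasHN) (hC : Z.IsEquivariant k C) (c : C)
    {φ : ℝ} {X : D} (h : semistableSlice Z φ X) : semistableSlice Z φ (c ⊙ₗ X : D) := by
  let := IsBoundedHeart.abelian H
  obtain ⟨n, E, hn, hE, ⟨i⟩⟩ := h
  obtain ⟨j⟩ := nonempty_action_shift_iso c E.obj n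
  refine ⟨n, c ⊙ₗ E, hn, ?_, ⟨(MonoidalLeftAction.actionLeft D c).mapIso i ≪≫ j⟩⟩
  -- The zero case is separate because `c ⊙ₗ E` can vanish, for instance for `c = 0`, and zero
  -- objects do not count as semistable.
  by_cases h0 : IsZero (c ⊙ₗ E : H.FullSubcategory)
  · exact Or.inl h0
  · have hE0 : ¬ IsZero E := fun h =>
      h0 ((MonoidalLeftAction.actionLeft H.FullSubcategory c).map_isZero h)
    have hE' := hE.resolve_left hE0
    exact Or.inr ⟨hE'.1.action hZ hC c h0, (hC.phase_action hE0 h0).trans hE'.2⟩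

/-- Both sides are biadditive, objects of `C` generate `K₀(C)`, and objects of the heart generate
`K₀(D)`. -/
theorem charge_act_of_heart (H : ObjectProperty D) [IsBoundedHeart H] {f : TriK0 D →+ ℂ}
    (h : ∀ (c : C) (E : D), H E →
      f (TriK0.of (c ⊙ₗ E : D)) = (FPdim k C (AbK0.of c) : ℂ) * f (TriK0.of E))
    (a : AbK0 C) (x : TriK0 D) :
    f (TriK0.act k C D a x) = (FPdim k C a : ℂ) * f x := by
  have h₁ (c : C) : f.comp (TriK0.act k C D (AbK0.of c)) =
      (AddMonoidHom.mulLeft (FPdim k C (AbK0.of c) : ℂ)).comp f :=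
    TriK0.hom_ext_of_heart H fun E hE => h c E hE
  have h₂ : f.comp ((TriK0.act k C D).flip x) = (AddMonoidHom.mulRight (f x)).comp
      (Complex.ofRealHom.toAddMonoidHom.comp (FPdim k C)) :=
    AbK0.hom_ext fun c => DFunLike.congr_fun (h₁ c) x
  exact DFunLike.congr_fun h₂ a

/-- The stability condition given by an equivariant heart. -/
noncomputable def EquivariantHeart.stabilityCondition (d : EquivariantHeart k C D) :
    EquivariantStabilityCondition k C D :=
  have := d.isBoundedHeart
  have := d.isActionStable
  { slice := semistableSlice d.Z
    isSlicing := semistableSlice_isSlicing d.hasHN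
    charge := chargeOfHeart d.Z.hom
    charge_slice := fun _ _ => chargeOfHeart_semistableSlice
    action_slice := fun c _ _ => semistableSlice_action d.hasHN d.equivariant c
    charge_equivariant := charge_act_of_heart d.heart fun c E hE => by
      have h := d.equivariant (AbK0.of c) (AbK0.of ⟨E, hE⟩)
      rwa [AbK0.act_of, ← chargeOfHeart_of, ← chargeOfHeart_of] at h }

theorem EquivariantHeart.corresponds_stabilityCondition (d : EquivariantHeart k C D) :
    Corresponds d.stabilityCondition d := by
  have := d.isBoundedHeart
  exact ⟨(sliceInterval_semistableSlice d.hasHN).symm, fun E => (chargeOfHeart_of d.Z.hom E).symm⟩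

end EquivariantOfHeart

/-! ### From slicings to hearts -/

theorem InHalfPlane.add {w w' : ℂ} (h : InHalfPlane w) (h' : InHalfPlane w') :
    InHalfPlane (w + w') := by
  simp only [InHalfPlane, Complex.add_im, Complex.add_re] at *
  rcases h with h | h <;> rcases h' with h' | h'
  · exact Or.inl (by linarith)
  · exact Or.inl (by linarith)
  · exact Or.inl (by linarith)
  · exact Or.inr ⟨by linarith, by linarith⟩

section Slicing

variable {D : Type*} [Category* D] [Preadditive D] [HasZeroObject D] [HasShift D ℤ]
  [∀ n : ℤ, (shiftFunctor D n).Additive] [Pretriangulated D] {P : ℝ → ObjectProperty D}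

namespace IsSlicing

variable (hP : IsSlicing P)
include hP

theorem mem_of_iso {φ : ℝ} {X Y : D} (h : P φ X) (e : X ≅ Y) : P φ Y :=
  have := hP.additive φ
  (P φ).prop_of_iso e h

theorem mem_of_isZero (φ : ℝ) {X : D} (h : IsZero X) : P φ X :=
  have := hP.additive φ
  (P φ).prop_of_isZero h

theorem mem_shift_one_iff {φ : ℝ} {X : D} : P (φ + 1) (X⟦(1 : ℤ)⟧) ↔ P φ X := by
  rw [hP.shift]
  constructor
  · rintro ⟨Y, hY, ⟨i⟩⟩
    exact hP.mem_of_iso hY ((shiftFunctor D (1 : ℤ)).preimageIso i).symm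
  · exact fun h => ⟨X, h, ⟨Iso.refl _⟩⟩

theorem mem_shift {φ : ℝ} {X : D} (h : P φ X) (n : ℤ) : P (φ + n) (X⟦n⟧) := by
  induction n with
  | zero => simpa using hP.mem_of_iso h (shiftZeroIso X).symm
  | succ n ih =>
    have := hP.mem_of_iso (hP.mem_shift_one_iff.2 ih) (shiftShiftIso X n 1 (n + 1) rfl)
    rwa [add_assoc, ← Int.cast_one (R := ℝ), ← Int.cast_add] at this
  | pred n ih =>
    refine hP.mem_shift_one_iff.1 (hP.mem_of_iso ?_ (shiftShiftIso X (-n - 1) 1 (-n) (by lia)).symm)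
    convert ih using 1
    push_cast
    ring

theorem isPreslicing : IsPreslicing P where
  of_iso _ _ _ e h := hP.mem_of_iso h e
  of_isZero φ _ h := hP.mem_of_isZero φ h
  homZero _ _ hij _ _ hX hY := hP.hom_eq_zero _ _ hij _ _ hX hY
  homZero_shift _ _ hij _ _ hX hY :=
    hP.hom_eq_zero _ _ (by linarith) _ _ (hP.mem_shift_one_iff.2 hX) hY
  tower := hP.tower

theorem hasTower_shift {I : Set ℝ} {X : D} (h : HasTower P I X) (n : ℤ) :
    HasTower P {φ | φ - n ∈ I} (X⟦n⟧) := by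
  obtain ⟨l, hl, hI, h⟩ := hasTower_iff.1 h
  refine hasTower_iff.2 ⟨l.map (· + (n : ℝ)), hl.map _ fun x y h => by linarith, ?_,
    h.map (fun X : D => X⟦n⟧) (· + (n : ℝ)) (fun _ h => (isZero_shift_iff _ n).2 h)
      (fun _ _ _ h => h.shift n) (fun _ _ _ h => hP.mem_shift h n)⟩
  intro φ hφ
  obtain ⟨ψ, hψ, rfl⟩ := List.mem_map.1 hφ
  simpa using hI ψ hψ

variable [IsTriangulated D]

theorem sliceInterval_extension {X Y Z : D} (hT : IsExtension X Y Z)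
    (hX : sliceInterval P (Set.Ioc 0 1) X) (hZ : sliceInterval P (Set.Ioc 0 1) Z) :
    sliceInterval P (Set.Ioc 0 1) Y := by
  rw [← Set.Ioi_inter_Iic] at *
  exact hP.isPreslicing.hasTower_extension (isUpperSet_Ioi 0) (isLowerSet_Iic 1) hT hX hZ

/-- Replacing each phase `φ` by `⌈φ⌉ - 1` is monotone but not strictly so; the resulting weakly
ordered tower is made strict by `TriTower.merge`, using that the heart is closed under extensions.
-/
theorem isBoundedHeart : IsBoundedHeart (sliceInterval P (Set.Ioc 0 1)) where
  toIsAdditiveSubcategory := isAdditiveSubcategory_of_extension (fun _ _ e h => h.of_iso e)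
    (fun _ h => .of_isZero h) fun _ _ _ => hP.sliceInterval_extension
  hom_eq_zero m n hnm X Y hX hY := by
    refine hP.isPreslicing.homZero_of_hasTower (fun φ hφ ψ hψ => ?_)
      (hP.hasTower_shift hX m) (hP.hasTower_shift hY n)
    have h : (n : ℝ) + 1 ≤ m := by exact_mod_cast hnm
    linarith [hφ.1, hψ.2]
  tower X := by
    obtain ⟨l, hl, -, h⟩ := hasTower_iff.1 (hP.tower X)
    have h' : TriTower (shiftedBy (sliceInterval P (Set.Ioc 0 1))) (l.map fun φ => ⌈φ⌉ - 1) X := by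
      refine h.map (fun X : D => X) (fun φ => ⌈φ⌉ - 1) (fun _ h => h) (fun _ _ _ h => h)
        fun φ _ E hE => ?_
      have hE' := hP.mem_shift hE (-(⌈φ⌉ - 1))
      rw [Int.cast_neg, ← sub_eq_add_neg] at hE'
      exact ⟨_, .of_mem (sub_ceil_mem_Ioc φ) hE', ⟨(shiftCancelIso E _ _ (by lia)).symm⟩⟩
    obtain ⟨l', hl', -, h''⟩ := h'.merge (fun n X Y Z hT hX hZ => by
        obtain ⟨X', hX', ⟨i⟩⟩ := hX
        obtain ⟨Z', hZ', ⟨j⟩⟩ := hZ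
        refine ⟨Y⟦-n⟧, hP.sliceInterval_extension ((hT.shift (-n)).of_iso
          ((shiftFunctor D (-n)).mapIso i ≪≫ shiftCancelIso X' n (-n) (by lia)) (Iso.refl _)
          ((shiftFunctor D (-n)).mapIso j ≪≫ shiftCancelIso Z' n (-n) (by lia))) hX' hZ',
          ⟨(shiftCancelIso Y (-n) n (by lia)).symm⟩⟩)
      (hl.map _ fun x y h => by have := Int.ceil_mono h.le; lia)
    exact hasTower_iff.2 ⟨l', hl', by simp, h''⟩

end IsSlicing

/-- The condition on a central charge to be compatible with a slicing. -/
abbrev IsCentralCharge (P : ℝ → ObjectProperty D) (f : TriK0 D →+ ℂ) : Prop :=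
  ∀ (φ : ℝ) (E : D), P φ E → ¬ IsZero E →
    ∃ m : ℝ, 0 < m ∧ f (TriK0.of E) = m * Complex.exp (Complex.I * Real.pi * φ)

/-- The half plane is closed under addition. Slices contain zero objects, so vanishing pieces have
to be passed over. -/
theorem IsCentralCharge.isZero_or_inHalfPlane {f : TriK0 D →+ ℂ} (hf : IsCentralCharge P f)
    {X : D} (hX : sliceInterval P (Set.Ioc 0 1) X) :
    IsZero X ∨ InHalfPlane (f (TriK0.of X)) := by
  obtain ⟨l, -, hl, h⟩ := hasTower_iff.1 hX
  clear hX
  induction h with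
  | nil h => exact Or.inl h
  | @cons X' X E φ l _ hT hE ih =>
    replace ih := ih fun i hi => hl i (List.mem_cons_of_mem _ hi)
    by_cases hE0 : IsZero E
    · obtain ⟨e⟩ := hT.iso_of_right hE0
      rw [TriK0.of_iso e] at ih
      exact ih.imp_left fun h => h.of_iso e.symm
    · right
      obtain ⟨m, hm, hE⟩ := hf φ E hE hE0
      have hE' := inHalfPlane_mul_exp hm (hl φ List.mem_cons_self)
      rw [← hE] at hE'
      rw [TriK0.of_isExtension hT, map_add]
      rcases ih with ih | ih
      · rwa [TriK0.of_isZero ih, map_zero, zero_add]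
      · exact ih.add hE'

theorem IsCentralCharge.imRotate_nonpos {f : TriK0 D →+ ℂ} (hf : IsCentralCharge P f)
    {φ : ℝ} (hφ : φ ∈ Set.Ioc (0 : ℝ) 1) {X : D} (hX : HasTower P (Set.Ioc 0 φ) X) :
    imRotate φ (f (TriK0.of X)) ≤ 0 := by
  obtain ⟨l, -, hl, h⟩ := hasTower_iff.1 hX
  clear hX
  induction h with
  | nil h => rw [TriK0.of_isZero h, map_zero, map_zero]
  | @cons X' X E ψ l _ hT hE ih =>
    rw [TriK0.of_isExtension hT, map_add, map_add]
    refine add_nonpos (ih fun i hi => hl i (List.mem_cons_of_mem _ hi)) ?_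
    by_cases hE0 : IsZero E
    · rw [TriK0.of_isZero hE0, map_zero, map_zero]
    · obtain ⟨m, hm, hE⟩ := hf ψ E hE hE0
      have hψ := hl ψ List.mem_cons_self
      have hψ' : ψ ∈ Set.Ioc (0 : ℝ) 1 := ⟨hψ.1, hψ.2.trans hφ.2⟩
      rw [hE, ← not_lt, (inHalfPlane_mul_exp hm hψ').imRotate_pos_iff hφ, arg_mul_exp hm hψ']
      exact not_lt.2 hψ.2

variable [IsTriangulated D]

section Restriction

variable {f : TriK0 D →+ ℂ} (hP : IsSlicing P) (hf : IsCentralCharge P f)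
  {H : ObjectProperty D} [IsBoundedHeart H] (hH : H = sliceInterval P (Set.Ioc 0 1))

/-- The restriction of a central charge to the standard heart. -/
noncomputable def restrictCharge (H : ObjectProperty D) [IsBoundedHeart H] (f : TriK0 D →+ ℂ) :
    AbK0 H.FullSubcategory →+ ℂ :=
  AbK0.lift (fun E => f (TriK0.of E.obj)) fun S hS => by
    rw [TriK0.of_isExtension (IsBoundedHeart.isExtension_of_shortExact H S hS), map_add]

theorem restrictCharge_of (E : H.FullSubcategory) :
    restrictCharge H f (AbK0.of E) = f (TriK0.of E.obj) :=
  AbK0.lift_of ..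

include hf hH in
theorem restrictCharge_mem_halfPlane (E : H.FullSubcategory) (hE : ¬ IsZero E) :
    InHalfPlane (restrictCharge H f (AbK0.of E)) := by
  rw [restrictCharge_of]
  exact (hf.isZero_or_inHalfPlane (hH ▸ E.property)).resolve_left
    fun h => hE (isZero_heart_of_isZero h)

variable {Z : StabilityFunction H.FullSubcategory}
  (hZ : ∀ E : H.FullSubcategory, Z.hom (AbK0.of E) = f (TriK0.of E.obj))

include hP hf hH hZ

/-- The objects of the slices of phase in `(0, 1]` are semistable objects of the standard heart. -/
theorem semistable_of_slice {φ : ℝ} (hφ : φ ∈ Set.Ioc (0 : ℝ) 1) {E : H.FullSubcategory}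
    (hE : P φ E.obj) (hE0 : ¬ IsZero E) : Z.Semistable E ∧ Z.phase E = φ := by
  let := IsBoundedHeart.abelian H
  have hphase : Z.phase E = φ := by
    obtain ⟨m, hm, h⟩ := hf φ _ hE fun h => hE0 (isZero_heart_of_isZero h)
    rw [StabilityFunction.phase, hZ, h, arg_mul_exp hm hφ]
  refine ⟨⟨hE0, fun B i hi hB => ?_⟩, hphase⟩
  rw [hphase, ← not_lt, ← StabilityFunction.imAt_pos_iff hB hφ, not_lt]
  have hS : (ShortComplex.mk i (cokernel.π i) (cokernel.condition i)).ShortExact :=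
    { exact := ShortComplex.exact_cokernel i, mono_f := hi, epi_g := inferInstance }
  have hT := IsBoundedHeart.isExtension_of_shortExact H _ hS
  have hB' : HasTower P (Set.Ioc 0 1) B.obj := hH ▸ B.property
  have hC : HasTower P (Set.Ioc 0 1) (cokernel i).obj := hH ▸ (cokernel i).property
  have hBφ : HasTower P (Set.Ioc 0 φ) B.obj := by
    rw [← Set.Ioi_inter_Iic]
    refine hP.isPreslicing.hasTower_of_homZero (isUpperSet_Ioi 0) (isLowerSet_Iic φ) ?_ ?_
    · intro ψ hψ Y hY
      refine hP.isPreslicing.homZero_of_hasTower (J := {ψ}) ?_ hB' (.of_mem rfl hY)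
      intro x hx y hy
      rw [Set.mem_singleton_iff.1 hy]
      exact (not_lt.1 hψ).trans_lt hx.1
    · intro ψ hψ Y hY
      rw [Set.mem_Iic, not_le] at hψ
      -- `B` sits between `C⟦-1⟧`, where `C` is the cokernel, and `E`. The phases of `C⟦-1⟧` lie in
      -- `(-1, 0]`, so neither end receives morphisms from a slice of phase `ψ > φ > 0`.
      refine hT.invRotate.homZero_mid_right ?_ (hP.hom_eq_zero _ _ hψ _ _ hY hE)
      refine hP.isPreslicing.homZero_of_hasTower (I := {ψ}) ?_ (.of_mem rfl hY)
        (hP.hasTower_shift hC (-1))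
      intro x hx y hy
      rw [Set.mem_singleton_iff.1 hx]
      have := hy.2
      push_cast at this
      linarith [hφ.1]
  rw [StabilityFunction.imAt, hZ]
  exact hf.imRotate_nonpos hφ hBφ

/-- A tower with phases in `(0, 1]` is a Harder–Narasimhan filtration once its zero pieces are
dropped, hence the passage to a sublist. -/
theorem hasHN_of_isSlicing : Z.HasHN := by
  let := IsBoundedHeart.abelian H
  have key {l : List ℝ} {X : D} (h : TriTower P l X) (hl : ∀ i ∈ l, i ∈ Set.Ioc (0 : ℝ) 1) :
      ∃ (hX : H X) (l' : List ℝ), l'.Sublist l ∧ Z.HNTower l' ⟨X, hX⟩ := by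
    induction h with
    | nil h => exact ⟨H.prop_of_isZero h, [], .refl _, .nil (isZero_heart_of_isZero h)⟩
    | @cons X' X E φ l _ hT hE ih =>
      obtain ⟨hX', l', hl', h'⟩ := ih fun i hi => hl i (List.mem_cons_of_mem _ hi)
      have hφ := hl φ List.mem_cons_self
      have hHE : H E := hH ▸ HasTower.of_mem hφ hE
      have hX := IsBoundedHeart.mem_extension H hT hX' hHE
      by_cases hE0 : IsZero E
      · obtain ⟨e⟩ := hT.iso_of_right hE0
        exact ⟨hX, l', hl'.cons _, h'.congr (fun X Y => Nonempty (X ≅ Y))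
          (fun _ _ ⟨e⟩ h => h.of_iso e.symm) (fun _ _ _ _ ⟨e⟩ h => h.congr_mid e)
          ⟨ObjectProperty.isoMk _ e⟩⟩
      · exact ⟨hX, φ :: l', hl'.cons_cons _, .cons h'
          (IsBoundedHeart.shortExact_of_isExtension H (Z := ⟨E, hHE⟩) hT)
          (semistable_of_slice hP hf hH hZ hφ hE fun h => hE0 (isZero_of_isZero_heart h))⟩
  refine Z.hasHN_iff.2 fun X => ?_
  have hX : HasTower P (Set.Ioc 0 1) X.obj := hH ▸ X.property
  obtain ⟨l, hl, hI, h⟩ := hasTower_iff.1 hX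
  obtain ⟨_, l', hl', h'⟩ := key h hI
  exact ⟨l', hl.sublist hl', h'⟩

/-- Both families are preslicings, so one inclusion suffices; it follows by shifting each slice into
the heart. -/
theorem slice_eq_semistableSlice : P = semistableSlice Z := by
  refine hP.isPreslicing.eq_of_le
    (semistableSlice_isPreslicing (hasHN_of_isSlicing hP hf hH hZ)) fun φ X hX => ?_
  have hφ := sub_ceil_mem_Ioc φ
  have hX' := hP.mem_shift hX (-(⌈φ⌉ - 1))
  rw [Int.cast_neg, ← sub_eq_add_neg] at hX'
  refine ⟨⌈φ⌉ - 1, ⟨X⟦-(⌈φ⌉ - 1)⟧, hH ▸ HasTower.of_mem hφ hX'⟩, hφ, ?_,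
    ⟨(shiftCancelIso X _ _ (by lia)).symm⟩⟩
  by_cases h0 : IsZero (⟨X⟦-(⌈φ⌉ - 1)⟧, hH ▸ HasTower.of_mem hφ hX'⟩ : H.FullSubcategory)
  · exact Or.inl h0
  · exact Or.inr (semistable_of_slice hP hf hH hZ hφ hX' h0)

end Restriction

end Slicing

/-! ### The correspondence -/

section Correspondence

variable {k : Type*} [Field k] {C : Type*} [Category* C] [Abelian C] [Linear k C]
  [MonoidalCategory C] [MonoidalPreadditive C] [MonoidalLinear k C] [FusionCategory k C]
  {D : Type*} [Category* D] [Preadditive D] [HasZeroObject D] [HasShift D ℤ]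
  [∀ n : ℤ, (shiftFunctor D n).Additive] [Pretriangulated D] [IsTriangulated D]
  [MonoidalLeftAction C D] [TriangulatedModuleCategory C D]

theorem HasTower.action {P : ℝ → ObjectProperty D} {I : Set ℝ} {X : D} (h : HasTower P I X) (c : C)
    (hc : ∀ φ E, P φ E → P φ (c ⊙ₗ E)) : HasTower P I (c ⊙ₗ X) := by
  obtain ⟨l, hl, hI, h⟩ := hasTower_iff.1 h
  refine hasTower_iff.2 ⟨l, hl, hI, ?_⟩
  simpa using h.map (N' := IsZero) (R' := IsExtension) (Q' := P) (fun X : D => (c ⊙ₗ X : D)) id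
    (fun _ h => isZero_action_of_isZero c h) (fun _ _ _ h => h.action c) (fun φ _ => hc φ)

namespace EquivariantStabilityCondition

variable (σ : EquivariantStabilityCondition k C D)

/-- The standard heart of an equivariant stability condition, with the restriction of the central
charge. -/
noncomputable def equivariantHeart : EquivariantHeart k C D :=
  have := σ.isSlicing.isBoundedHeart
  have : IsActionStable C (sliceInterval σ.slice (Set.Ioc 0 1)) :=
    ⟨fun c _ h => HasTower.action h c (σ.action_slice c)⟩
  { heart := sliceInterval σ.slice (Set.Ioc 0 1)
    Z := ⟨restrictCharge _ σ.charge, restrictCharge_mem_halfPlane σ.charge_slice rfl⟩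
    hasHN := hasHN_of_isSlicing σ.isSlicing σ.charge_slice rfl restrictCharge_of
    equivariant := by
      let := IsBoundedHeart.abelian (sliceInterval σ.slice (Set.Ioc 0 1))
      let z := restrictCharge (sliceInterval σ.slice (Set.Ioc 0 1)) σ.charge
      intro a x
      have h₁ (c : C) : z.comp (AbK0.act k C _ (AbK0.of c)) =
          (AddMonoidHom.mulLeft (FPdim k C (AbK0.of c) : ℂ)).comp z :=
        AbK0.hom_ext fun E =>
          (restrictCharge_of (c ⊙ₗ E)).trans <|
            (σ.charge_equivariant (AbK0.of c) (TriK0.of E.obj)).trans <|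
              congrArg _ (restrictCharge_of E).symm
      have h₂ : z.comp ((AbK0.act k C _).flip x) = (AddMonoidHom.mulRight (z x)).comp
          (Complex.ofRealHom.toAddMonoidHom.comp (FPdim k C)) :=
        AbK0.hom_ext fun c => DFunLike.congr_fun (h₁ c) x
      exact DFunLike.congr_fun h₂ a }

theorem corresponds_equivariantHeart : Corresponds σ σ.equivariantHeart :=
  have := σ.isSlicing.isBoundedHeart
  ⟨rfl, restrictCharge_of (H := sliceInterval σ.slice (Set.Ioc 0 1))⟩

end EquivariantStabilityCondition

namespace Corresponds

variable {σ σ' : EquivariantStabilityCondition k C D} {d d' : EquivariantHeart k C D}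

theorem slice_eq (h : Corresponds σ d) : σ.slice = semistableSlice d.Z :=
  have := d.isBoundedHeart
  slice_eq_semistableSlice σ.isSlicing σ.charge_slice h.1 h.2

theorem heart_unique (h : Corresponds σ d) (h' : Corresponds σ d') : d = d' := by
  obtain ⟨H, Z, _, _⟩ := d
  obtain ⟨H', Z', _, _⟩ := d'
  obtain rfl : H = H' := h.1.trans h'.1.symm
  obtain ⟨z, _⟩ := Z
  obtain ⟨z', _⟩ := Z'
  obtain rfl : z = z' := AbK0.hom_ext fun E => (h.2 E).trans (h'.2 E).symm
  rfl

theorem stabilityCondition_unique (h : Corresponds σ d) (h' : Corresponds σ' d) : σ = σ' := by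
  have := d.isBoundedHeart
  have hs : σ.slice = σ'.slice := h.slice_eq.trans h'.slice_eq.symm
  have hc : σ.charge = σ'.charge := TriK0.hom_ext_of_heart d.heart fun E hE =>
    (h.2 ⟨E, hE⟩).symm.trans (h'.2 ⟨E, hE⟩)
  obtain ⟨⟨P, _, f, _⟩, _, _⟩ := σ
  obtain ⟨⟨P', _, f', _⟩, _, _⟩ := σ'
  obtain rfl : P = P' := hs
  obtain rfl : f = f' := hc
  rfl

/-- The same homomorphism `z` serves both sides, because two homomorphisms on `K₀(D)` that agree on
the heart are equal. -/
theorem factors_iff (h : Corresponds σ d) {Λ : Type*} [AddCommGroup Λ] (v : TriK0 D →+ Λ) :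
    (∃ z : Λ →+ ℂ, ∀ x : TriK0 D, σ.charge x = z (v x)) ↔
      ∃ z : Λ →+ ℂ, ∀ E : d.heart.FullSubcategory,
        d.Z.hom (AbK0.of E) = z (v (TriK0.of E.obj)) := by
  have := d.isBoundedHeart
  refine exists_congr fun z => ⟨fun hz E => (h.2 E).trans (hz _), fun hz => ?_⟩
  exact DFunLike.congr_fun (TriK0.hom_ext_of_heart d.heart (g := z.comp v) fun E hE =>
    (h.2 ⟨E, hE⟩).symm.trans (hz ⟨E, hE⟩))

end Corresponds

end Correspondence

end FusionStab

theorem mainTheorem6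
    {k : Type*} [Field k] {C : Type*} [Category* C] [Abelian C] [Linear k C]
    [MonoidalCategory C] [MonoidalPreadditive C] [MonoidalLinear k C]
    [FusionStab.FusionCategory k C]
    {D : Type*} [Category* D] [Preadditive D] [HasZeroObject D] [HasShift D ℤ]
    [∀ n : ℤ, (shiftFunctor D n).Additive] [Pretriangulated D] [IsTriangulated D]
    [MonoidalLeftAction C D] [FusionStab.TriangulatedModuleCategory C D] :
    (∀ σ : FusionStab.EquivariantStabilityCondition k C D,
      ∃! d : FusionStab.EquivariantHeart k C D, FusionStab.Corresponds σ d) ∧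
    (∀ d : FusionStab.EquivariantHeart k C D,
      ∃! σ : FusionStab.EquivariantStabilityCondition k C D, FusionStab.Corresponds σ d) ∧
    (∀ (σ : FusionStab.EquivariantStabilityCondition k C D)
      (d : FusionStab.EquivariantHeart k C D), FusionStab.Corresponds σ d →
      (∀ φ : ℝ, σ.slice φ = FusionStab.semistableSlice d.Z φ) ∧
      (FusionStab.IsLocallyFinite σ.slice ↔
        FusionStab.IsLocallyFinite (FusionStab.semistableSlice d.Z)) ∧
      (∀ (Λ : Type*) [AddCommGroup Λ] [Module.Free ℤ Λ] [Module.Finite ℤ Λ]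
        (v : FusionStab.TriK0 D →+ Λ),
        (∃ z : Λ →+ ℂ, ∀ x : FusionStab.TriK0 D, σ.charge x = z (v x)) ↔
        (∃ z : Λ →+ ℂ, ∀ E : d.heart.FullSubcategory,
          d.Z.hom (FusionStab.AbK0.of E) = z (v (FusionStab.TriK0.of E.obj))))) := by
  refine ⟨fun σ => ⟨_, σ.corresponds_equivariantHeart, fun d h =>
      h.heart_unique σ.corresponds_equivariantHeart⟩,
    fun d => ⟨_, d.corresponds_stabilityCondition, fun σ h =>
      h.stabilityCondition_unique d.corresponds_stabilityCondition⟩,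
    -- Local finiteness depends on the slicing alone, so it transfers along the equality of the two
    -- slicings.
    fun σ d h => ⟨fun φ => congrFun h.slice_eq φ, by rw [h.slice_eq], fun Λ _ _ _ v =>
      h.factors_iff v⟩⟩
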